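/- Let $X, X_1, X_2, \dots$ be identically distributed non-degenerate real random variables with $X_1, X_2, \dots$ independent, let $S_n=\sum_{i=1}^n X_i$, and let $$a_n=\inf\{x>0:\ n\,y^{-2}\,E\big[X^2 I(|X|<y)\big]\le 1 \text{ for all } y\ge x\},$$ which is positive for all large $n$. For $\alpha\in(0,2]$ and real $\gamma$, $c,p,q\ge 0$ with $p+q=1$, write $G\sim S(\alpha,\gamma,c,p,q)$ if the probability law $G$ on $\mathbb R$ has characteristic function $$f(t)=\exp\Big\{i\gamma t+c|t|^{\alpha}\frac{\Gamma(3-\alpha)}{\alpha(\alpha-1)}\Big[\cos\frac{\pi\alpha}{2}+i(p-q)\frac{t}{|t|}\sin\frac{\pi\alpha}{2}\Big]\Big\}\quad(\alpha\neq 1),$$ $$f(t)=\exp\Big\{i\gamma t-c|t|\Big[\frac{\pi}{2}+i(p-q)\frac{t}{|t|}\log|t|\Big]\Big\}\quad(\alpha=1),$$ for $t\ne0$, with $f(0)=1$. Say that $X$ is in the domain of attraction of $G$ if there are real constants $A_n$ and $B_n>0$ such that $(S_n-A_n)/B_n$ converges in distribution to $G$. Let $G\sim S(\alpha,\gamma,c,p,q)$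 with $\alpha\in(0,2]$ and $c>0$ (so that $G$ is non-degenerate). If there are constants $A_n>0$ such that $S_n/A_n$ converges in distribution to $G$, then (1) $X$ is in the domain of attraction of $G$; (2) $X$ is integrable with $EX=0$ if $1<\alpha\le 2$, and $\lim_{n\to\infty} n\,E\sin(X/a_n)$ exists and is finite if $\alpha=1$. Conversely, if (1) and (2) hold, then $S_n/a_n$ converges in distribution to a law $G'\sim S(\alpha,\gamma',1,p,q)$, where $\gamma'=0$ if $\alpha\ne1$ and $\gamma'=\lim_{n\to\infty} n\,E\sin(X/a_n)$ if $\alpha=1$. -/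

import Mathlib

open MeasureTheory ProbabilityTheory Filter Topology

noncomputable section

/-- The characteristic function of the stable law `S(α, γ, c, p, q)`. At `t = 0` the factor
`t / |t|` is multiplied by a zero, so that the value there is `1`. -/
def stableCharFun (α γ c p q t : ℝ) : ℂ :=
  if α = 1 then
    Complex.exp (Complex.I * γ * t
      - (c * |t| : ℝ) * ((Real.pi / 2 : ℝ) + Complex.I * ((p - q) * (t / |t|) * Real.log |t| : ℝ)))
  else
    Complex.exp (Complex.I * γ * t
      + (c * |t| ^ α * (Real.Gamma (3 - α) / (α * (α - 1))) : ℝ)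
        * ((Real.cos (Real.pi * α / 2) : ℝ)
          + Complex.I * ((p - q) * (t / |t|) * Real.sin (Real.pi * α / 2) : ℝ)))

/-- `G ∼ S(α, γ, c, p, q)`: the index satisfies `0 < α ≤ 2`, the parameters satisfy
`c, p, q ≥ 0` and `p + q = 1`, and `G` has the characteristic function of this stable law. -/
structure IsStableLaw (α γ c p q : ℝ) (G : ProbabilityMeasure ℝ) : Prop where
  index_pos : 0 < α
  index_le : α ≤ 2
  scale_nonneg : 0 ≤ c
  p_nonneg : 0 ≤ p
  q_nonneg : 0 ≤ q
  p_add_q : p + q = 1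
  charFun_eq : ∀ t : ℝ, charFun (G : Measure ℝ) t = stableCharFun α γ c p q t

section

variable {Ω : Type*} [MeasurableSpace Ω]

/-- The partial sum `S_n` of the first `n` terms of a sequence of random variables; `Xs i` is the
`(i+1)`-st term. -/
def partialSum (Xs : ℕ → Ω → ℝ) (n : ℕ) (ω : Ω) : ℝ := ∑ i ∈ Finset.range n, Xs i ω

/-- The truncated second moment `E X² I(|X| < x)`. -/
def truncSecondMoment (P : Measure Ω) (X : Ω → ℝ) (x : ℝ) : ℝ :=
  ∫ ω in {ω | |X ω| < x}, X ω ^ 2 ∂P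

/-- The norming constants
`a_n = inf {x > 0 : n y⁻² E X² I(|X| < y) ≤ 1 for all y ≥ x}`.
The inequality is required at all `y ≥ x`, because at a single point it holds for every
sufficiently small `x > 0`, whatever `X` is. -/
def normConst (P : Measure Ω) (X : Ω → ℝ) (n : ℕ) : ℝ :=
  sInf {x : ℝ | 0 < x ∧ ∀ y : ℝ, x ≤ y → (n : ℝ) * (truncSecondMoment P X y / y ^ 2) ≤ 1}

/-- `n E sin (X / a_n)`. -/
def sinCentering (P : Measure Ω) (X : Ω → ℝ) (n : ℕ) : ℝ :=
  n * ∫ ω, Real.sin (X ω / normConst P X n) ∂P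

/-- `X`, with independent copies `Xs`, is in the domain of attraction of `G`: the partial sums,
suitably centred and normed, converge in distribution to `G`. -/
def InDomainOfAttraction (P : Measure Ω) [IsProbabilityMeasure P] (Xs : ℕ → Ω → ℝ)
    (G : ProbabilityMeasure ℝ) : Prop :=
  ∃ A B : ℕ → ℝ, (∀ n, 0 < B n) ∧
    TendstoInDistribution (fun n ω => (partialSum Xs n ω - A n) / B n) atTop
      (id : ℝ → ℝ) (fun _ => P) (G : Measure ℝ)

/-- `E X = 0` if `1 < α ≤ 2`, and `lim n E sin (X / a_n)` exists and is finite if `α = 1`. -/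
def CenteringCondition (P : Measure Ω) (X : Ω → ℝ) (α : ℝ) : Prop :=
  (1 < α ∧ α ≤ 2 → Integrable X P ∧ ∫ ω, X ω ∂P = 0) ∧
  (α = 1 → ∃ l : ℝ, Tendsto (sinCentering P X) atTop (𝓝 l))

end

end

/-! Write φ for the characteristic function of X and ψ for `stableExponent`. With the drift γ
absorbed into the centring, attraction to G says φ(t/B_n)^n exp(-i t b_n) → exp ψ(t), locally
uniformly in the sense of continuous convergence (`AttractedTo`). The proof finds the right norming
first and the right centring afterwards.

Norming. Symmetrisation shows that n E min(1, (X/B_n)²) stays bounded. If E X² = ∞, or if EX = 0, it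
follows that n |φ(t/B_n) - 1|² → 0, so φ^n may be replaced by exp(n(φ - 1)). This is an infinitely
divisible law with canonical measure M_n = n (1 - sin x / x) P(X/B_n ∈ dx) and centring n E
sin(X/B_n). The weight 1 - sin x / x is the mean of 1 - cos(hx) over h in [0, 1]. Hence second
differences of the Lévy exponent, averaged over h, give the characteristic function of the canonical
measure and ignore drift (`charFun_eq_integral_secondDiff`). So M_n converges weakly to the
canonical measure M of the stable law, provided the logarithms can be controlled; a preliminary
rescaling that makes ψ small on [-1, 1] ensures this.

The measure M is found from the integral of (e^{-rx} - 1 + r sin x) x^{-1-α}, evaluated in the right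
half-plane and continued to the imaginary axis (`laplaceStable_imaginary`). What matters is that its
truncated second moment is c s^{2-α}. Therefore n B_n^{-2} E X² I(|X| < s B_n) → c s^{2-α}, whence
a_n / B_n → c^{1/α} (`tendsto_normConst_div`), and a_n are norming constants for scale parameter 1
(`exists_normConst`).

Centring, α = 1. Here ψ(1) is real, so imaginary parts at t = 1 identify the centring as n E
sin(X/a_n) + o(1). Uncentred convergence then amounts to convergence of that sequence.

Centring, α ≠ 1. Now ψ is exactly homogeneous, so B_n / B_{2n} → 2^{-1/α} and b_{2n} - 2
(B_n/B_{2n}) b_n → 0 (`tendsto_ratio`, `tendsto_drift_sub`). For α < 1 the recursion contracts and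
b_n → 0. For α > 1 the tail bounds make X integrable, and B_n is o(n) along doublings. The weak law
of large numbers then shows that convergent b_n force EX = 0. Conversely, if EX = 0, it gives b_m
B_m / m → 0 along m = 2^k n, and summing the recursion back to n gives b_n → 0. -/

/-! ### The weight 1 - sin x / x and quotients by it. -/

/-- The weight `1 - sin x / x`, which is comparable to `min 1 x²`. -/
noncomputable def sincWeight (x : ℝ) : ℝ := 1 - Real.sinc x

lemma continuous_sincWeight : Continuous sincWeight :=
  continuous_const.sub Real.continuous_sinc

lemma sincWeight_zero : sincWeight 0 = 0 := by simp [sincWeight]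

lemma sincWeight_neg (x : ℝ) : sincWeight (-x) = sincWeight x := by simp [sincWeight]

lemma sincWeight_nonneg (x : ℝ) : 0 ≤ sincWeight x := by
  have := Real.sinc_le_one x; unfold sincWeight; linarith

lemma sincWeight_le_two (x : ℝ) : sincWeight x ≤ 2 := by
  have := Real.neg_one_le_sinc x; unfold sincWeight; linarith

lemma sin_cubic_bound {x : ℝ} (hx : |x| ≤ 1) :
    |Real.sin x - (x - x ^ 3 / 6)| ≤ |x| ^ 4 * (5 / 96) := by
  refine (Real.sin_bound hx).trans ?_
  have : |x| ^ 5 ≤ |x| ^ 4 := pow_le_pow_of_le_one (abs_nonneg x) hx (by norm_num)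
  nlinarith [pow_nonneg (abs_nonneg x) 4]

lemma abs_sub_sin_le_sq (x : ℝ) : |x - Real.sin x| ≤ 2 * x ^ 2 := by
  rcases le_total |x| 1 with hx | hx
  · have := abs_le.1 (sin_cubic_bound hx)
    have h3 : |x| ^ 3 ≤ x ^ 2 := by rw [← sq_abs x]; nlinarith [abs_nonneg x, sq_nonneg |x|]
    have h4 : |x| ^ 4 ≤ x ^ 2 := by
      have : |x| ^ 4 = |x| ^ 3 * |x| := by ring
      nlinarith [abs_nonneg x, pow_nonneg (abs_nonneg x) 3]
    have h5 : |x ^ 3| ≤ x ^ 2 := by rwa [abs_pow]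
    have h6 := abs_le.1 h5
    rw [abs_le]; constructor <;> nlinarith [sq_nonneg x]
  · have h4 := Real.abs_sin_le_one x
    have h5 : |x| ≤ x ^ 2 := by rw [← sq_abs]; nlinarith
    exact (abs_sub _ _).trans (by linarith)

lemma abs_sincWeight_sub_le {x : ℝ} (hx : |x| ≤ 1) : |sincWeight x - x ^ 2 / 6| ≤ |x| ^ 3 * (5 / 96) := by
  rcases eq_or_ne x 0 with rfl | h0
  · simp [sincWeight]
  have h := sin_cubic_bound hx
  have e : sincWeight x - x ^ 2 / 6 = -(Real.sin x - (x - x ^ 3 / 6)) / x := by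
    rw [sincWeight, Real.sinc_of_ne_zero h0]; field_simp; ring
  rw [e, abs_div, abs_neg, div_le_iff₀ (abs_pos.2 h0)]
  calc _ ≤ |x| ^ 4 * (5 / 96) := h
    _ = _ := by ring

/-- This mean-value formula is the reason for the choice of weight: a second difference with step
`h` produces the factor 1 - cos(hx), and averaging over the step produces the weight itself. -/
lemma integral_one_sub_cos (x : ℝ) : ∫ h in (0 : ℝ)..1, (1 - Real.cos (h * x)) = sincWeight x := by
  rcases eq_or_ne x 0 with rfl | h0
  · simp [sincWeight]
  rw [intervalIntegral.integral_sub (by simp) (Continuous.intervalIntegrable (by fun_prop) _ _),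
    intervalIntegral.integral_comp_mul_right _ h0, integral_cos, sincWeight,
    Real.sinc_of_ne_zero h0]
  simp; ring

lemma sincWeight_le_sq (x : ℝ) : sincWeight x ≤ x ^ 2 / 2 := by
  rw [← integral_one_sub_cos]
  have : ∫ h in (0 : ℝ)..1, (1 - Real.cos (h * x)) ≤ ∫ h in (0 : ℝ)..1, x ^ 2 / 2 := by
    apply intervalIntegral.integral_mono_on (by norm_num)
      (Continuous.intervalIntegrable (by fun_prop) _ _) (by simp)
    intro h hh
    have := Real.one_sub_sq_div_two_le_cos (x := h * x)
    have h1 : h ^ 2 ≤ 1 := by nlinarith [hh.1, hh.2]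
    nlinarith [sq_nonneg x, mul_nonneg (sub_nonneg.2 h1) (sq_nonneg x)]
  simpa using this

lemma sq_div_ten_le_sincWeight {x : ℝ} (hx : |x| ≤ 1) : x ^ 2 / 10 ≤ sincWeight x := by
  have h := (abs_le.1 (abs_sincWeight_sub_le hx)).1
  have h3 : |x| ^ 3 ≤ x ^ 2 := by
    rw [← sq_abs x]; nlinarith [abs_nonneg x, sq_nonneg |x|]
  nlinarith [sq_nonneg x]

lemma inv_forty_le_sincWeight {x : ℝ} (hx : 1 ≤ |x|) : 1 / 40 ≤ sincWeight x := by
  have h0 : x ≠ 0 := by rintro rfl; simp at hx; linarith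
  rcases le_total 2 |x| with h2 | h2
  · have : Real.sinc x ≤ 1 / 2 := by
      rw [Real.sinc_of_ne_zero h0]
      refine (le_abs_self _).trans ?_
      rw [abs_div, div_le_iff₀ (abs_pos.2 h0)]
      have := Real.abs_sin_le_one x
      linarith
    unfold sincWeight; linarith
  -- For 1 ≤ |x| ≤ 2 the duplication formula reduces the bound to x/2, where the Taylor estimate
  -- applies.
  · have e : Real.sinc x = Real.sinc (x / 2) * Real.cos (x / 2) := by
      rw [Real.sinc_of_ne_zero h0, Real.sinc_of_ne_zero (by positivity)]
      have : Real.sin x = 2 * Real.sin (x / 2) * Real.cos (x / 2) := by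
        rw [← Real.sin_two_mul]; ring_nf
      rw [this]; field_simp
    have hh : |x / 2| ≤ 1 := by rw [abs_div]; norm_num; linarith
    have h1 := sq_div_ten_le_sincWeight hh
    have h2 := sincWeight_le_sq (x / 2)
    have h4 : (x / 2) ^ 2 ≤ 1 := by rw [← sq_abs]; nlinarith [abs_nonneg (x / 2)]
    have h5 : 1 / 4 ≤ (x / 2) ^ 2 := by
      rw [← sq_abs, abs_div]; norm_num; nlinarith
    have hc := Real.cos_le_one (x / 2)
    unfold sincWeight at *
    rw [e]
    have : 0 ≤ Real.sinc (x / 2) := by linarith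
    nlinarith [mul_nonneg this (sub_nonneg.2 hc)]

lemma min_one_sq_le_sincWeight (x : ℝ) : min 1 (x ^ 2) ≤ 40 * sincWeight x := by
  rcases le_total |x| 1 with h | h
  · have := sq_div_ten_le_sincWeight h
    exact (min_le_right _ _).trans (by nlinarith [sq_nonneg x])
  · have := inv_forty_le_sincWeight h
    exact (min_le_left _ _).trans (by linarith)

lemma sincWeight_le_min (x : ℝ) : sincWeight x ≤ 2 * min 1 (x ^ 2) := by
  rcases min_cases 1 (x ^ 2) with ⟨h, _⟩ | ⟨h, _⟩ <;> rw [h]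
  · have := sincWeight_le_two x; linarith
  · have := sincWeight_le_sq x; nlinarith [sq_nonneg x]

lemma sincWeight_pos {x : ℝ} (hx : x ≠ 0) : 0 < sincWeight x := by
  have := min_one_sq_le_sincWeight x
  have h : 0 < min 1 (x ^ 2) := lt_min one_pos (by positivity)
  linarith

lemma tendsto_sincWeight_div_sq : Tendsto (fun x => sincWeight x / x ^ 2) (𝓝[≠] 0) (𝓝 (1 / 6)) := by
  rw [tendsto_iff_norm_sub_tendsto_zero]
  have hg : Tendsto (fun x : ℝ => |x| * (5 / 96)) (𝓝[≠] 0) (𝓝 0) := by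
    have : Tendsto (fun x : ℝ => |x| * (5 / 96)) (𝓝 0) (𝓝 (|0| * (5 / 96))) :=
      Continuous.tendsto (by fun_prop) _
    simpa using this.mono_left nhdsWithin_le_nhds
  refine squeeze_zero' (Eventually.of_forall fun _ => norm_nonneg _) ?_ hg
  have h1 : ∀ᶠ x : ℝ in 𝓝[≠] 0, |x| ≤ 1 := by
    apply nhdsWithin_le_nhds
    filter_upwards [Metric.closedBall_mem_nhds (0 : ℝ) one_pos] with x hx using by simpa using hx
  filter_upwards [h1, self_mem_nhdsWithin] with x hx h0
  have h0 : x ≠ 0 := h0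
  have h := abs_sincWeight_sub_le hx
  have e : sincWeight x / x ^ 2 - 1 / 6 = (sincWeight x - x ^ 2 / 6) / x ^ 2 := by field_simp
  rw [Real.norm_eq_abs, e, abs_div, abs_of_nonneg (sq_nonneg x), div_le_iff₀ (by positivity)]
  calc _ ≤ _ := h
    _ = _ := by rw [← sq_abs x]; ring

/-- The quotient of `f` by the weight, extended by `6 L` at the origin; this is the continuous
extension if `f x / x²` tends to `L`. -/
noncomputable def divWeight (f : ℝ → ℂ) (L : ℂ) (x : ℝ) : ℂ :=
  if x = 0 then 6 * L else f x / sincWeight x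

lemma divWeight_mul (f : ℝ → ℂ) (L : ℂ) (hf : f 0 = 0) (x : ℝ) :
    divWeight f L x * sincWeight x = f x := by
  unfold divWeight
  split_ifs with h
  · subst h; simp [sincWeight_zero, hf]
  · have : (sincWeight x : ℂ) ≠ 0 := by exact_mod_cast (sincWeight_pos h).ne'
    field_simp

lemma continuous_divWeight {f : ℝ → ℂ} {L : ℂ} (hf : Continuous f)
    (hL : Tendsto (fun x : ℝ => f x / (x : ℂ) ^ 2) (𝓝[≠] 0) (𝓝 L)) : Continuous (divWeight f L) := by
  rw [continuous_iff_continuousAt]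
  intro x
  rcases eq_or_ne x 0 with rfl | h0
  · rw [continuousAt_iff_punctured_nhds]
    have h6 := tendsto_sincWeight_div_sq.ofReal
    have h := hL.div h6 (by norm_num)
    have e : divWeight f L 0 = L / ((1 / 6 : ℝ) : ℂ) := by
      simp [divWeight]; ring
    rw [e]
    refine h.congr' ?_
    filter_upwards [self_mem_nhdsWithin] with x h0
    have h0 : x ≠ 0 := h0
    have := (sincWeight_pos h0).ne'
    simp only [divWeight, if_neg h0, Pi.div_apply]
    push_cast
    have h2 : (x : ℂ) ≠ 0 := by exact_mod_cast h0
    have h3 : (sincWeight x : ℂ) ≠ 0 := by exact_mod_cast this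
    field_simp
  · have : ContinuousAt (fun x => f x / (sincWeight x : ℂ)) x := by
      refine hf.continuousAt.div ?_ ?_
      · exact (Complex.continuous_ofReal.comp continuous_sincWeight).continuousAt
      · exact_mod_cast (sincWeight_pos h0).ne'
    refine this.congr ?_
    filter_upwards [isOpen_ne.mem_nhds h0] with y hy
    have hy : y ≠ 0 := hy
    simp [divWeight, hy]

lemma bounded_divWeight {f : ℝ → ℂ} {L : ℂ} {C : ℝ} (hf : Continuous f) (hC : ∀ x, ‖f x‖ ≤ C)
    (hL : Tendsto (fun x : ℝ => f x / (x : ℂ) ^ 2) (𝓝[≠] 0) (𝓝 L)) :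
    ∃ D : ℝ, ∀ x, ‖divWeight f L x‖ ≤ D := by
  obtain ⟨D, hD⟩ := (isCompact_Icc (a := (-1 : ℝ)) (b := 1)).exists_bound_of_continuousOn
    (continuous_divWeight hf hL).continuousOn
  refine ⟨max D (40 * C), fun x => ?_⟩
  rcases le_total |x| 1 with h | h
  · exact (hD x (abs_le.1 h)).trans (le_max_left _ _)
  · refine le_trans ?_ (le_max_right _ _)
    have h0 : x ≠ 0 := by rintro rfl; simp at h; linarith
    have hw := inv_forty_le_sincWeight h
    have hp := sincWeight_pos h0
    rw [divWeight, if_neg h0, norm_div, Complex.norm_real, Real.norm_of_nonneg hp.le,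
      div_le_iff₀ hp]
    have h1 := hC x
    have h2 := norm_nonneg (f x)
    nlinarith

/-! ### The Lévy–Khintchine kernel with centring sin x. -/

/-- The numerator `e^{itx} - 1 - i t sin x` of the Lévy–Khintchine formula. -/
noncomputable def centredExp (t x : ℝ) : ℂ :=
  Complex.exp (t * x * Complex.I) - 1 - t * Real.sin x * Complex.I

lemma continuous_centredExp : Continuous (fun z : ℝ × ℝ => centredExp z.1 z.2) := by
  unfold centredExp; fun_prop

lemma norm_centredExp_le (t x : ℝ) : ‖centredExp t x‖ ≤ 2 + |t| := by
  unfold centredExp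
  have h1 : ‖Complex.exp (t * x * Complex.I)‖ = 1 := by
    rw [← Complex.ofReal_mul]; exact Complex.norm_exp_ofReal_mul_I _
  have h2 : ‖(t * Real.sin x * Complex.I : ℂ)‖ ≤ |t| := by
    rw [← Complex.ofReal_mul, norm_mul, Complex.norm_I, mul_one, Complex.norm_real, norm_mul]
    have := Real.abs_sin_le_one x
    calc _ ≤ ‖t‖ * 1 := by gcongr; exact this
      _ = |t| := by simp
  calc _ ≤ ‖Complex.exp (t * x * Complex.I)‖ + ‖(1 : ℂ)‖ + ‖(t * Real.sin x * Complex.I : ℂ)‖ :=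
        (norm_sub_le _ _).trans (add_le_add_left (norm_sub_le _ _) _)
    _ ≤ _ := by rw [h1, norm_one]; linarith

lemma norm_exp_sub_one_sub_le (z : ℝ) :
    ‖Complex.exp (z * Complex.I) - 1 - z * Complex.I‖ ≤ 3 * z ^ 2 := by
  rcases le_total |z| 1 with h | h
  · have h1 : ‖(z * Complex.I : ℂ)‖ ≤ 1 := by simpa using h
    have := Complex.norm_exp_sub_one_sub_id_le h1
    refine this.trans ?_
    simp; nlinarith [sq_nonneg z]
  · have h1 : ‖Complex.exp (z * Complex.I)‖ = 1 := Complex.norm_exp_ofReal_mul_I _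
    calc _ ≤ ‖Complex.exp (z * Complex.I)‖ + ‖(1 : ℂ)‖ + ‖(z * Complex.I : ℂ)‖ :=
          (norm_sub_le _ _).trans (add_le_add_left (norm_sub_le _ _) _)
      _ = 2 + |z| := by rw [h1]; simp; norm_num
      _ ≤ _ := by rw [← sq_abs]; nlinarith

lemma norm_centredExp_le_sq (t x : ℝ) : ‖centredExp t x‖ ≤ (3 * t ^ 2 + 2 * |t|) * x ^ 2 := by
  have h1 := norm_exp_sub_one_sub_le (t * x)
  have h2 := abs_sub_sin_le_sq x
  have e : centredExp t x = (Complex.exp ((t * x : ℝ) * Complex.I) - 1 - (t * x : ℝ) * Complex.I)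
      + ((t * (x - Real.sin x) : ℝ) * Complex.I) := by
    unfold centredExp; push_cast; ring
  rw [e]
  refine (norm_add_le _ _).trans ?_
  have h3 : ‖((t * (x - Real.sin x) : ℝ) * Complex.I : ℂ)‖ ≤ |t| * (2 * x ^ 2) := by
    rw [norm_mul, Complex.norm_I, mul_one, Complex.norm_real, Real.norm_eq_abs, abs_mul]
    gcongr
  nlinarith

lemma tendsto_centredExp_div_sq (t : ℝ) :
    Tendsto (fun x : ℝ => centredExp t x / (x : ℂ) ^ 2) (𝓝[≠] 0) (𝓝 (-(t : ℂ) ^ 2 / 2)) := by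
  have key : Tendsto (fun x : ℝ =>
      ((Real.cos (t * x) - 1) / x ^ 2 : ℝ) + ((Real.sin (t * x) - t * Real.sin x) / x ^ 2 : ℝ) * Complex.I)
      (𝓝[≠] 0) (𝓝 (((-t ^ 2 / 2 : ℝ) : ℂ) + ((0 : ℝ) : ℂ) * Complex.I)) := by
    have hsmall : ∀ᶠ x : ℝ in 𝓝[≠] 0, |t * x| ≤ 1 ∧ |x| ≤ 1 := by
      apply nhdsWithin_le_nhds
      have h1 : Tendsto (fun x : ℝ => |t * x|) (𝓝 0) (𝓝 |t * 0|) := Continuous.tendsto (by fun_prop) _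
      have h2 : Tendsto (fun x : ℝ => |x|) (𝓝 0) (𝓝 |0|) := Continuous.tendsto (by fun_prop) _
      simp only [mul_zero, abs_zero] at h1 h2
      exact ((h1.eventually_lt_const one_pos).and (h2.eventually_lt_const one_pos)).mono
        fun x hx => ⟨hx.1.le, hx.2.le⟩
    refine Tendsto.add (Tendsto.ofReal ?_) ((Tendsto.ofReal ?_).mul_const _)
    · rw [tendsto_iff_norm_sub_tendsto_zero]
      have hg : Tendsto (fun x : ℝ => (|t| ^ 4 * (5 / 96)) * x ^ 2) (𝓝[≠] 0) (𝓝 0) := by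
        have : Tendsto (fun x : ℝ => (|t| ^ 4 * (5 / 96)) * x ^ 2) (𝓝 0)
          (𝓝 ((|t| ^ 4 * (5 / 96)) * 0 ^ 2)) := Continuous.tendsto (by fun_prop) _
        simpa using this.mono_left nhdsWithin_le_nhds
      refine squeeze_zero' (Eventually.of_forall fun _ => norm_nonneg _) ?_ hg
      filter_upwards [hsmall, self_mem_nhdsWithin] with x hx h0
      have h0 : x ≠ 0 := h0
      have h := Real.cos_bound hx.1
      have e : (Real.cos (t * x) - 1) / x ^ 2 - -t ^ 2 / 2
        = (Real.cos (t * x) - (1 - (t * x) ^ 2 / 2)) / x ^ 2 := by field_simp; ring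
      rw [Real.norm_eq_abs, e, abs_div, abs_of_nonneg (sq_nonneg x), div_le_iff₀ (by positivity)]
      refine h.trans (le_of_eq ?_)
      rw [abs_mul, mul_pow, ← sq_abs x]; ring
    · rw [tendsto_iff_norm_sub_tendsto_zero]
      have hg : Tendsto (fun x : ℝ => (|t| ^ 3 + |t|  + |t| ^ 4 + |t|) * |x|) (𝓝[≠] 0) (𝓝 0) := by
        have : Tendsto (fun x : ℝ => (|t| ^ 3 + |t|  + |t| ^ 4 + |t|) * |x|) (𝓝 0)
          (𝓝 ((|t| ^ 3 + |t|  + |t| ^ 4 + |t|) * |0|)) := Continuous.tendsto (by fun_prop) _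
        simpa using this.mono_left nhdsWithin_le_nhds
      refine squeeze_zero' (Eventually.of_forall fun _ => norm_nonneg _) ?_ hg
      filter_upwards [hsmall, self_mem_nhdsWithin] with x hx h0
      have h0 : x ≠ 0 := h0
      have ha := sin_cubic_bound hx.1
      have hb := sin_cubic_bound hx.2
      have e : Real.sin (t * x) - t * Real.sin x = (Real.sin (t * x) - (t * x - (t * x) ^ 3 / 6))
        - t * (Real.sin x - (x - x ^ 3 / 6)) - (t * x) ^ 3 / 6 + t * x ^ 3 / 6 := by ring
      rw [sub_zero, Real.norm_eq_abs, abs_div, abs_of_nonneg (sq_nonneg x),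
        div_le_iff₀ (by positivity), e]
      have hx4 : |x| ^ 4 ≤ |x| ^ 3 := pow_le_pow_of_le_one (abs_nonneg x) hx.2 (by norm_num)
      have A1 : |t * (Real.sin x - (x - x ^ 3 / 6))| ≤ |t| * (|x| ^ 3 * (5 / 96)) := by
        rw [abs_mul]; exact mul_le_mul_of_nonneg_left (hb.trans (by linarith)) (abs_nonneg t)
      have A2 : |(t * x) ^ 3 / 6| ≤ |t| ^ 3 * |x| ^ 3 := by
        rw [abs_div, abs_pow, abs_mul, mul_pow]; norm_num
        nlinarith [mul_nonneg (pow_nonneg (abs_nonneg t) 3) (pow_nonneg (abs_nonneg x) 3)]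
      have A3 : |t * x ^ 3 / 6| ≤ |t| * |x| ^ 3 := by
        rw [abs_div, abs_mul, abs_pow]; norm_num
        nlinarith [mul_nonneg (abs_nonneg t) (pow_nonneg (abs_nonneg x) 3)]
      have A4 : |Real.sin (t * x) - (t * x - (t * x) ^ 3 / 6)| ≤ |t| ^ 4 * |x| ^ 3 := by
        refine ha.trans ?_
        rw [abs_mul, mul_pow]
        have : |t| ^ 4 * |x| ^ 4 ≤ |t| ^ 4 * |x| ^ 3 := by gcongr
        nlinarith [mul_nonneg (pow_nonneg (abs_nonneg t) 4) (pow_nonneg (abs_nonneg x) 4)]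
      have h3 : (|t| ^ 3 + |t|  + |t| ^ 4 + |t|) * |x| * x ^ 2
        = (|t| ^ 3 + |t|  + |t| ^ 4 + |t|) * |x| ^ 3 := by rw [← sq_abs x]; ring
      rw [h3]
      refine (abs_add_le _ _).trans ((add_le_add_left ((abs_sub _ _).trans
        (add_le_add_left (abs_sub _ _) _)) _).trans ?_)
      nlinarith [mul_nonneg (abs_nonneg t) (pow_nonneg (abs_nonneg x) 3)]
  refine (key.congr fun x => ?_).trans (le_of_eq ?_)
  · rw [centredExp, show (t * x * Complex.I : ℂ) = ((t * x : ℝ) : ℂ) * Complex.I by push_cast; ring,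
      Complex.exp_mul_I, ← Complex.ofReal_cos, ← Complex.ofReal_sin]
    push_cast; ring
  · push_cast; simp

/-- The kernel of the Lévy–Khintchine formula with respect to the canonical measure. -/
noncomputable def levyKernel (t : ℝ) : ℝ → ℂ := divWeight (centredExp t) (-(t : ℂ) ^ 2 / 2)

lemma continuous_levyKernel (t : ℝ) : Continuous (levyKernel t) :=
  continuous_divWeight (continuous_centredExp.comp (by fun_prop : Continuous fun x : ℝ => (t, x)))
    (tendsto_centredExp_div_sq t)

lemma norm_levyKernel_le (t x : ℝ) : ‖levyKernel t x‖ ≤ 40 * (3 * t ^ 2 + 2 * |t| + 2) := by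
  have ht := abs_nonneg t
  have ht2 := sq_nonneg t
  unfold levyKernel divWeight
  split_ifs with h
  · rw [norm_mul, norm_div, norm_neg, norm_pow, Complex.norm_real, Real.norm_eq_abs, sq_abs]
    norm_num; nlinarith
  · have hp := sincWeight_pos h
    rw [norm_div, Complex.norm_real, Real.norm_of_nonneg hp.le, div_le_iff₀ hp]
    have h1 := norm_centredExp_le t x
    have h2 := norm_centredExp_le_sq t x
    have h3 := min_one_sq_le_sincWeight x
    rcases min_cases 1 (x ^ 2) with ⟨e, _⟩ | ⟨e, _⟩ <;> rw [e] at h3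
    · nlinarith
    · nlinarith [sq_nonneg x]

lemma levyKernel_mul (t x : ℝ) : levyKernel t x * sincWeight x = centredExp t x :=
  divWeight_mul _ _ (by simp [centredExp]) x

/-- The Lévy exponent with canonical measure `M` and no drift. -/
noncomputable def levyExponent (M : Measure ℝ) (t : ℝ) : ℂ := ∫ x, levyKernel t x ∂M

lemma integrable_levyKernel (M : Measure ℝ) [IsFiniteMeasure M] (t : ℝ) :
    Integrable (levyKernel t) M :=
  Integrable.of_bound (continuous_levyKernel t).aestronglyMeasurable _
    (Eventually.of_forall (norm_levyKernel_le t))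

/-! ### Second differences recover the canonical measure. -/

/-- The symmetric second difference of a function on the line. -/
noncomputable def secondDiff (f : ℝ → ℂ) (t h : ℝ) : ℂ := f t - f (t + h) / 2 - f (t - h) / 2

/-- The quotient of `1 - cos (h x)` by the weight. -/
noncomputable def cosKernel (h x : ℝ) : ℝ :=
  if x = 0 then 3 * h ^ 2 else (1 - Real.cos (h * x)) / sincWeight x

lemma cosKernel_nonneg (h x : ℝ) : 0 ≤ cosKernel h x := by
  unfold cosKernel
  split_ifs
  · positivity
  · exact div_nonneg (by linarith [Real.cos_le_one (h * x)]) (sincWeight_nonneg x)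

lemma cosKernel_le {h : ℝ} (hh : |h| ≤ 1) (x : ℝ) : cosKernel h x ≤ 80 := by
  have h1 : h ^ 2 ≤ 1 := by rw [← sq_abs]; nlinarith [abs_nonneg h]
  unfold cosKernel
  split_ifs with h0
  · linarith
  · rw [div_le_iff₀ (sincWeight_pos h0)]
    have h2 := Real.one_sub_sq_div_two_le_cos (x := h * x)
    have h3 := Real.neg_one_le_cos (h * x)
    have h4 := min_one_sq_le_sincWeight x
    rcases min_cases 1 (x ^ 2) with ⟨e, _⟩ | ⟨e, _⟩ <;> rw [e] at h4
    · nlinarith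
    · nlinarith [mul_nonneg (sub_nonneg.2 h1) (sq_nonneg x)]

lemma measurable_cosKernel : Measurable (fun z : ℝ × ℝ => cosKernel z.1 z.2) := by
  unfold cosKernel
  refine Measurable.ite (measurableSet_eq_fun measurable_snd measurable_const) (by fun_prop) ?_
  exact Measurable.div (by fun_prop) (continuous_sincWeight.measurable.comp measurable_snd)

/-- The value 3h² at the origin is the limit of (h²x²/2)/(x²/6), so the normalisation also holds
there, and an atom of the canonical measure at 0 (the Gaussian part) needs no separate treatment. -/
lemma integral_cosKernel (x : ℝ) : ∫ h in (0 : ℝ)..1, cosKernel h x = 1 := by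
  unfold cosKernel
  split_ifs with h
  · rw [intervalIntegral.integral_const_mul, integral_pow]; norm_num
  · rw [intervalIntegral.integral_div, integral_one_sub_cos, div_self (sincWeight_pos h).ne']

/-- The terms linear in `t` cancel in a second difference, so only e^{itx} times a nonnegative
factor free of `t` is left. -/
lemma secondDiff_levyKernel (t h x : ℝ) :
    secondDiff (fun s => levyKernel s x) t h = Complex.exp (t * x * Complex.I) * cosKernel h x := by
  simp only [secondDiff, levyKernel, divWeight, cosKernel]
  split_ifs with h0
  · subst h0; simp; ring
  · have : (sincWeight x : ℂ) ≠ 0 := by exact_mod_cast (sincWeight_pos h0).ne'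
    unfold centredExp
    have e1 : Complex.exp ((t + h : ℝ) * x * Complex.I)
        = Complex.exp (t * x * Complex.I) * Complex.exp ((h * x : ℂ) * Complex.I) := by
      rw [← Complex.exp_add]; push_cast; ring_nf
    have e2 : Complex.exp ((t - h : ℝ) * x * Complex.I)
        = Complex.exp (t * x * Complex.I) * Complex.exp (-(h * x : ℂ) * Complex.I) := by
      rw [← Complex.exp_add]; push_cast; ring_nf
    have e3 : (Real.cos (h * x) : ℂ)
        = (Complex.exp ((h * x : ℂ) * Complex.I) + Complex.exp (-(h * x : ℂ) * Complex.I)) / 2 := by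
      push_cast; rw [Complex.cos]
    rw [e1, e2]
    rw [show ((((1 - Real.cos (h * x)) / sincWeight x : ℝ)) : ℂ)
      = (1 - (Real.cos (h * x) : ℂ)) / sincWeight x by push_cast; rfl, e3]
    push_cast
    field_simp
    ring

lemma secondDiff_levyExponent (M : Measure ℝ) [IsFiniteMeasure M] (t h : ℝ) :
    secondDiff (levyExponent M) t h = ∫ x, Complex.exp (t * x * Complex.I) * cosKernel h x ∂M := by
  simp_rw [← secondDiff_levyKernel]
  simp only [secondDiff, levyExponent]
  have i (s : ℝ) := integrable_levyKernel M s
  rw [integral_sub (f := fun x => levyKernel t x - levyKernel (t + h) x / 2)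
      ((i _).sub ((i _).div_const _)) ((i _).div_const _),
    integral_sub (i _) ((i _).div_const _), integral_div, integral_div]

/-- The bound is the second difference at `t = 0`, hence uniform in `t`. Control of one real number
per step therefore controls the complex second differences at all points. -/
lemma norm_secondDiff_levyExponent_le (M : Measure ℝ) [IsFiniteMeasure M] (t h : ℝ) :
    ‖secondDiff (levyExponent M) t h‖ ≤ ∫ x, cosKernel h x ∂M := by
  rw [secondDiff_levyExponent]
  refine (norm_integral_le_integral_norm _).trans (le_of_eq ?_)
  congr 1; ext x
  rw [norm_mul, ← Complex.ofReal_mul, Complex.norm_exp_ofReal_mul_I, one_mul, Complex.norm_real,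
    Real.norm_of_nonneg (cosKernel_nonneg h x)]

lemma integral_cosKernel_eq (M : Measure ℝ) [IsFiniteMeasure M] (h : ℝ) :
    ((∫ x, cosKernel h x ∂M : ℝ) : ℂ) = secondDiff (levyExponent M) 0 h := by
  rw [secondDiff_levyExponent, ← integral_complex_ofReal]
  simp

lemma integral_cosKernel_le (M : Measure ℝ) [IsFiniteMeasure M] {h : ℝ} (hh : |h| ≤ 1) :
    ∫ x, cosKernel h x ∂M ≤ 80 * M.real Set.univ := by
  have : ‖∫ x, cosKernel h x ∂M‖ ≤ 80 * M.real Set.univ :=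
    norm_integral_le_of_norm_le_const (Eventually.of_forall fun x => by
      rw [Real.norm_of_nonneg (cosKernel_nonneg h x)]; exact cosKernel_le hh x)
  exact (le_abs_self _).trans this

/-- By Fubini, the factor multiplying e^{itx} is averaged over the step, and this average is 1. -/
lemma charFun_eq_integral_secondDiff (M : Measure ℝ) [IsFiniteMeasure M] (t : ℝ) :
    charFun M t = ∫ h in (0 : ℝ)..1, secondDiff (levyExponent M) t h := by
  have : ∀ h, secondDiff (levyExponent M) t h
    = ∫ x, Complex.exp (t * x * Complex.I) * cosKernel h x ∂M := secondDiff_levyExponent M t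
  simp_rw [this, intervalIntegral.integral_of_le zero_le_one]
  rw [integral_integral_swap, charFun_apply_real]
  · congr 1; ext x
    rw [integral_const_mul, integral_complex_ofReal, ← intervalIntegral.integral_of_le zero_le_one,
      integral_cosKernel]
    simp
  · refine Integrable.of_bound (C := 80) ?_ ?_
    · refine AEStronglyMeasurable.mul (Continuous.aestronglyMeasurable (by fun_prop)) ?_
      exact (Complex.measurable_ofReal.comp measurable_cosKernel).aestronglyMeasurable
    · have : ∀ᵐ z : ℝ × ℝ ∂((volume.restrict (Set.Ioc 0 1)).prod M), z.1 ∈ Set.Ioc (0 : ℝ) 1 :=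
        Measure.quasiMeasurePreserving_fst.ae (ae_restrict_mem measurableSet_Ioc)
      filter_upwards [this] with z hz
      rw [Function.uncurry, norm_mul, ← Complex.ofReal_mul, Complex.norm_exp_ofReal_mul_I, one_mul,
        Complex.norm_real, Real.norm_of_nonneg (cosKernel_nonneg _ _)]
      exact cosKernel_le (abs_le.2 ⟨by linarith [hz.1], hz.2⟩) _

/-! ### The Laplace-type integral of the stable jump density. -/

/-- The integrand `(min 1 x²) x^{-1-α}`, which dominates all the integrands below. -/
noncomputable def stableDominant (α x : ℝ) : ℝ := min 1 (x ^ 2) * x ^ (-1 - α)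

lemma integrableOn_stableDominant {α : ℝ} (h0 : 0 < α) (h2 : α < 2) :
    IntegrableOn (stableDominant α) (Set.Ioi 0) := by
  have hm : Measurable (stableDominant α) := by unfold stableDominant; fun_prop
  rw [← Set.Ioc_union_Ioi_eq_Ioi zero_le_one]
  refine IntegrableOn.union ?_ ?_
  · have h : IntegrableOn (fun x : ℝ => x ^ (1 - α)) (Set.Ioc 0 1) := by
      have := intervalIntegral.intervalIntegrable_rpow' (a := 0) (b := 1) (r := 1 - α) (by linarith)
      rwa [intervalIntegrable_iff_integrableOn_Ioc_of_le zero_le_one] at this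
    refine h.mono' hm.aestronglyMeasurable ?_
    filter_upwards [ae_restrict_mem measurableSet_Ioc] with x hx
    have hx0 : 0 < x := hx.1
    have hp := Real.rpow_nonneg hx0.le (-1 - α)
    rw [stableDominant, Real.norm_of_nonneg (mul_nonneg (le_min zero_le_one (sq_nonneg x)) hp)]
    calc _ ≤ x ^ 2 * x ^ (-1 - α) := by gcongr; exact min_le_right _ _
      _ = x ^ (1 - α) := by
        rw [← Real.rpow_natCast, ← Real.rpow_add hx0]; congr 1; push_cast; ring
  · refine (integrableOn_Ioi_rpow_of_lt (a := -1 - α) (by linarith) one_pos).mono'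
      hm.aestronglyMeasurable ?_
    filter_upwards [ae_restrict_mem measurableSet_Ioi] with x hx
    have hx0 : 0 < x := one_pos.trans hx
    have hp := Real.rpow_nonneg hx0.le (-1 - α)
    rw [stableDominant, Real.norm_of_nonneg (mul_nonneg (le_min zero_le_one (sq_nonneg x)) hp)]
    calc _ ≤ 1 * x ^ (-1 - α) := by gcongr; exact min_le_left _ _
      _ = _ := one_mul _

lemma stableDominant_nonneg {α x : ℝ} (hx : 0 < x) : 0 ≤ stableDominant α x :=
  mul_nonneg (le_min zero_le_one (sq_nonneg x)) (Real.rpow_nonneg hx.le _)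

lemma norm_mul_rpow_le_of_le_min {α x C : ℝ} {z : ℂ} (hx : 0 < x) (h1 : ‖z‖ ≤ C) (h2 : ‖z‖ ≤ C * x ^ 2) :
    ‖z * ((x ^ (-1 - α) : ℝ) : ℂ)‖ ≤ C * stableDominant α x := by
  have hp := Real.rpow_nonneg hx.le (-1 - α)
  rw [norm_mul, Complex.norm_real, Real.norm_of_nonneg hp, stableDominant, ← mul_assoc]
  gcongr
  rcases min_cases 1 (x ^ 2) with ⟨e, _⟩ | ⟨e, _⟩ <;> rw [e] <;> linarith

lemma Complex.norm_exp_le_one_of_re_nonpos {z : ℂ} (hz : z.re ≤ 0) : ‖Complex.exp z‖ ≤ 1 := by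
  rw [Complex.norm_exp]; exact Real.exp_le_one_iff.2 hz

lemma Complex.norm_exp_sub_one_le_of_re_nonpos {z : ℂ} (hz : z.re ≤ 0) :
    ‖Complex.exp z - 1‖ ≤ 2 * ‖z‖ := by
  rcases le_total ‖z‖ 1 with h | h
  · exact Complex.norm_exp_sub_one_le h
  · have := Complex.norm_exp_le_one_of_re_nonpos hz
    calc _ ≤ ‖Complex.exp z‖ + ‖(1 : ℂ)‖ := norm_sub_le _ _
      _ ≤ _ := by rw [norm_one]; linarith

lemma Complex.norm_exp_sub_one_sub_le_of_re_nonpos {z : ℂ} (hz : z.re ≤ 0) :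
    ‖Complex.exp z - 1 - z‖ ≤ 3 * ‖z‖ ^ 2 := by
  rcases le_total ‖z‖ 1 with h | h
  · exact (Complex.norm_exp_sub_one_sub_id_le h).trans (by nlinarith [sq_nonneg ‖z‖])
  · have := Complex.norm_exp_le_one_of_re_nonpos hz
    calc _ ≤ ‖Complex.exp z‖ + ‖(1 : ℂ)‖ + ‖z‖ :=
          (norm_sub_le _ _).trans (add_le_add_left (norm_sub_le _ _) _)
      _ ≤ _ := by rw [norm_one]; nlinarith

/-- The integrand `e^{-rx} - 1 + r sin x`. -/
noncomputable def laplaceRemainder (r : ℂ) (x : ℝ) : ℂ :=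
  Complex.exp (-(r * x)) - 1 + r * Real.sin x

lemma re_neg_mul_ofReal_nonpos {r : ℂ} (hr : 0 ≤ r.re) {x : ℝ} (hx : 0 < x) : (-(r * x)).re ≤ 0 := by
  simp; positivity

lemma norm_laplaceRemainder_mul_le {α x : ℝ} {r : ℂ} (hr : 0 ≤ r.re) (hx : 0 < x) :
    ‖laplaceRemainder r x * ((x ^ (-1 - α) : ℝ) : ℂ)‖
      ≤ (3 * ‖r‖ ^ 2 + 2 * ‖r‖ + 2) * stableDominant α x := by
  have hre := re_neg_mul_ofReal_nonpos hr hx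
  have hn : ‖-(r * x)‖ = ‖r‖ * x := by
    rw [norm_neg, norm_mul, Complex.norm_real, Real.norm_of_nonneg hx.le]
  refine norm_mul_rpow_le_of_le_min hx ?_ ?_
  · have h1 := Complex.norm_exp_le_one_of_re_nonpos hre
    have h2 : ‖r * (Real.sin x : ℂ)‖ ≤ ‖r‖ * 1 := by
      rw [norm_mul, Complex.norm_real]; gcongr; exact Real.abs_sin_le_one x
    calc _ ≤ ‖Complex.exp (-(r * x))‖ + ‖(1 : ℂ)‖ + ‖r * (Real.sin x : ℂ)‖ :=
          (norm_add_le _ _).trans (add_le_add_left (norm_sub_le _ _) _)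
      _ ≤ _ := by rw [norm_one]; nlinarith [norm_nonneg r]
  · have h1 := Complex.norm_exp_sub_one_sub_le_of_re_nonpos hre
    have h2 : ‖r * ((x - Real.sin x : ℝ) : ℂ)‖ ≤ ‖r‖ * (2 * x ^ 2) := by
      rw [norm_mul, Complex.norm_real]; gcongr; exact abs_sub_sin_le_sq x
    have e : laplaceRemainder r x
        = (Complex.exp (-(r * x)) - 1 - -(r * x)) - r * ((x - Real.sin x : ℝ) : ℂ) := by
      unfold laplaceRemainder; push_cast; ring
    rw [e]
    refine (norm_sub_le _ _).trans ?_
    rw [hn] at h1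
    nlinarith [norm_nonneg r, sq_nonneg x]

/-- The derivative of `laplaceRemainder` in `r`. -/
noncomputable def laplaceRemainderDeriv (r : ℂ) (x : ℝ) : ℂ :=
  -(x * Complex.exp (-(r * x))) + Real.sin x

lemma mul_norm_exp_le {r : ℂ} {ε x : ℝ} (hε : 0 < ε) (hr : ε ≤ r.re) (hx : 0 < x) :
    x * ‖Complex.exp (-(r * x))‖ ≤ 1 / ε ∧ x ^ 2 * ‖Complex.exp (-(r * x))‖ ≤ 2 / ε ^ 2 := by
  have hre : (-(r * x)).re ≤ -(ε * x) := by simp; nlinarith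
  have h1 : ‖Complex.exp (-(r * x))‖ ≤ Real.exp (-(ε * x)) := by
    rw [Complex.norm_exp]; exact Real.exp_le_exp.2 hre
  have hu : 0 < ε * x := by positivity
  have h2 := Real.quadratic_le_exp_of_nonneg hu.le
  have h3 : Real.exp (-(ε * x)) * Real.exp (ε * x) = 1 := by rw [← Real.exp_add]; simp
  have h4 := Real.exp_pos (-(ε * x))
  constructor
  · rw [le_div_iff₀ hε]
    calc x * ‖Complex.exp (-(r * x))‖ * ε ≤ x * Real.exp (-(ε * x)) * ε := by gcongr
      _ = Real.exp (-(ε * x)) * (ε * x) := by ring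
      _ ≤ Real.exp (-(ε * x)) * Real.exp (ε * x) := by gcongr; nlinarith
      _ = 1 := h3
  · rw [le_div_iff₀ (by positivity)]
    calc x ^ 2 * ‖Complex.exp (-(r * x))‖ * ε ^ 2 ≤ x ^ 2 * Real.exp (-(ε * x)) * ε ^ 2 := by gcongr
      _ = 2 * (Real.exp (-(ε * x)) * ((ε * x) ^ 2 / 2)) := by ring
      _ ≤ 2 * (Real.exp (-(ε * x)) * Real.exp (ε * x)) := by gcongr; nlinarith
      _ = 2 := by rw [h3, mul_one]

lemma norm_laplaceRemainderDeriv_mul_le {α x ε R : ℝ} {r : ℂ} (hε : 0 < ε) (hr : ε ≤ r.re)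
    (hR : ‖r‖ ≤ R) (hx : 0 < x) :
    ‖laplaceRemainderDeriv r x * ((x ^ (-1 - α) : ℝ) : ℂ)‖
      ≤ (1 / ε + 2 * R + 3) * stableDominant α x := by
  have hre := re_neg_mul_ofReal_nonpos (hε.le.trans hr) hx
  have hn : ‖-(r * x)‖ = ‖r‖ * x := by
    rw [norm_neg, norm_mul, Complex.norm_real, Real.norm_of_nonneg hx.le]
  have hR0 := (norm_nonneg r).trans hR
  have hi : 0 < 1 / ε := by positivity
  refine norm_mul_rpow_le_of_le_min hx ?_ ?_
  · have h1 := (mul_norm_exp_le hε hr hx).1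
    refine (norm_add_le _ _).trans ?_
    rw [norm_neg, norm_mul, Complex.norm_real, Complex.norm_real, Real.norm_of_nonneg hx.le]
    have := Real.abs_sin_le_one x
    rw [← Real.norm_eq_abs] at this
    linarith
  · have h1 := Complex.norm_exp_sub_one_le_of_re_nonpos hre
    have e : laplaceRemainderDeriv r x
        = -(x * (Complex.exp (-(r * x)) - 1)) - ((x - Real.sin x : ℝ) : ℂ) := by
      unfold laplaceRemainderDeriv; push_cast; ring
    rw [e]
    refine (norm_sub_le _ _).trans ?_
    rw [norm_neg, norm_mul, Complex.norm_real, Complex.norm_real, Real.norm_of_nonneg hx.le,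
      Real.norm_eq_abs]
    have h2 := abs_sub_sin_le_sq x
    rw [hn] at h1
    have h3 : x * ‖Complex.exp (-(r * x)) - 1‖ ≤ x * (2 * (R * x)) := by
      gcongr; exact h1.trans (by gcongr)
    nlinarith [sq_nonneg x]

/-- `∫₀^∞ (e^{-rx} - 1 + r sin x) x^{-1-α} dx`. -/
noncomputable def laplaceStable (α : ℝ) (r : ℂ) : ℂ :=
  ∫ x in Set.Ioi (0 : ℝ), laplaceRemainder r x * ((x ^ (-1 - α) : ℝ) : ℂ)

/-- The derivative of `laplaceStable`. -/
noncomputable def laplaceStableDeriv (α : ℝ) (r : ℂ) : ℂ :=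
  ∫ x in Set.Ioi (0 : ℝ), laplaceRemainderDeriv r x * ((x ^ (-1 - α) : ℝ) : ℂ)

lemma measurable_laplaceRemainder_mul (α : ℝ) (r : ℂ) :
    Measurable fun x : ℝ => laplaceRemainder r x * ((x ^ (-1 - α) : ℝ) : ℂ) := by
  unfold laplaceRemainder; fun_prop

lemma measurable_laplaceRemainderDeriv_mul (α : ℝ) (r : ℂ) :
    Measurable fun x : ℝ => laplaceRemainderDeriv r x * ((x ^ (-1 - α) : ℝ) : ℂ) := by
  unfold laplaceRemainderDeriv; fun_prop

lemma integrableOn_laplaceRemainder {α : ℝ} (h0 : 0 < α) (h2 : α < 2) {r : ℂ} (hr : 0 ≤ r.re) :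
    IntegrableOn (fun x : ℝ => laplaceRemainder r x * ((x ^ (-1 - α) : ℝ) : ℂ)) (Set.Ioi 0) := by
  refine ((integrableOn_stableDominant h0 h2).const_mul (3 * ‖r‖ ^ 2 + 2 * ‖r‖ + 2)).mono'
    (measurable_laplaceRemainder_mul α r).aestronglyMeasurable ?_
  filter_upwards [ae_restrict_mem measurableSet_Ioi] with x hx
  exact norm_laplaceRemainder_mul_le hr hx

lemma half_re_ball {r : ℂ} {z : ℂ} (hz : z ∈ Metric.ball r (r.re / 2)) :
    r.re / 2 ≤ z.re ∧ ‖z‖ ≤ ‖r‖ + r.re / 2 := by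
  rw [Metric.mem_ball, dist_eq_norm] at hz
  constructor
  · have := (abs_le.1 (Complex.abs_re_le_norm (z - r))).1
    simp at this; linarith
  · have : z = r + (z - r) := by ring
    rw [this]; exact (norm_add_le _ _).trans (by linarith)

lemma hasDerivAt_laplaceStable {α : ℝ} (h0 : 0 < α) (h2 : α < 2) {r : ℂ} (hr : 0 < r.re) :
    HasDerivAt (laplaceStable α) (laplaceStableDeriv α r) r := by
  have hε : 0 < r.re / 2 := by positivity
  refine (hasDerivAt_integral_of_dominated_loc_of_deriv_le (𝕜 := ℂ)
    (F := fun r x => laplaceRemainder r x * ((x ^ (-1 - α) : ℝ) : ℂ))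
    (F' := fun r x => laplaceRemainderDeriv r x * ((x ^ (-1 - α) : ℝ) : ℂ))
    (bound := fun x => (1 / (r.re / 2) + 2 * (‖r‖ + r.re / 2) + 3) * stableDominant α x)
    (Metric.ball_mem_nhds r hε)
    (Eventually.of_forall fun z => (measurable_laplaceRemainder_mul α z).aestronglyMeasurable)
    (integrableOn_laplaceRemainder h0 h2 hr.le)
    (measurable_laplaceRemainderDeriv_mul α r).aestronglyMeasurable ?_
    ((integrableOn_stableDominant h0 h2).const_mul _) ?_).2
  · filter_upwards [ae_restrict_mem measurableSet_Ioi] with x hx z hz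
    exact norm_laplaceRemainderDeriv_mul_le hε (half_re_ball hz).1 (half_re_ball hz).2 hx
  · refine Eventually.of_forall fun x z _ => ?_
    have h := (((hasDerivAt_id z).mul_const (x : ℂ)).neg.cexp.sub_const 1).add
      ((hasDerivAt_id z).mul_const (Real.sin x : ℂ))
    refine (h.mul_const ((x ^ (-1 - α) : ℝ) : ℂ)).congr_deriv ?_
    simp only [laplaceRemainderDeriv, Pi.neg_apply, id, one_mul]; ring

lemma hasDerivAt_laplaceStableDeriv {α : ℝ} (h0 : 0 < α) (h2 : α < 2) {r : ℂ} (hr : 0 < r.re) :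
    HasDerivAt (laplaceStableDeriv α)
      (∫ x in Set.Ioi (0 : ℝ), (x : ℂ) ^ 2 * Complex.exp (-(r * x)) * ((x ^ (-1 - α) : ℝ) : ℂ)) r := by
  have hε : 0 < r.re / 2 := by positivity
  refine (hasDerivAt_integral_of_dominated_loc_of_deriv_le (𝕜 := ℂ)
    (F := fun r x => laplaceRemainderDeriv r x * ((x ^ (-1 - α) : ℝ) : ℂ))
    (F' := fun r x => (x : ℂ) ^ 2 * Complex.exp (-(r * x)) * ((x ^ (-1 - α) : ℝ) : ℂ))
    (bound := fun x => (2 / (r.re / 2) ^ 2 + 1) * stableDominant α x)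
    (Metric.ball_mem_nhds r hε)
    (Eventually.of_forall fun z => (measurable_laplaceRemainderDeriv_mul α z).aestronglyMeasurable)
    ?_ (Measurable.aestronglyMeasurable (by fun_prop)) ?_
    ((integrableOn_stableDominant h0 h2).const_mul _) ?_).2
  · refine ((integrableOn_stableDominant h0 h2).const_mul (1 / r.re + 2 * ‖r‖ + 3)).mono'
      (measurable_laplaceRemainderDeriv_mul α r).aestronglyMeasurable ?_
    filter_upwards [ae_restrict_mem measurableSet_Ioi] with x hx
    exact norm_laplaceRemainderDeriv_mul_le hr le_rfl le_rfl hx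
  · filter_upwards [ae_restrict_mem measurableSet_Ioi] with x hx z hz
    have hz1 := (half_re_ball hz).1
    have hx : 0 < x := hx
    have hb := (mul_norm_exp_le hε hz1 hx).2
    have he := Complex.norm_exp_le_one_of_re_nonpos (re_neg_mul_ofReal_nonpos (hε.le.trans hz1) hx)
    have e : ‖(x : ℂ) ^ 2 * Complex.exp (-(z * x))‖ = x ^ 2 * ‖Complex.exp (-(z * x))‖ := by
      rw [norm_mul, norm_pow, Complex.norm_real, Real.norm_eq_abs, sq_abs]
    have hp : 0 < 2 / (r.re / 2) ^ 2 := by positivity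
    refine norm_mul_rpow_le_of_le_min hx ?_ ?_ <;> rw [e]
    · linarith
    · nlinarith [sq_nonneg x]
  · refine Eventually.of_forall fun x z _ => ?_
    have h := ((((hasDerivAt_id z).mul_const (x : ℂ)).neg.cexp.const_mul (x : ℂ)).neg).add_const
      (Real.sin x : ℂ)
    refine (h.mul_const ((x ^ (-1 - α) : ℝ) : ℂ)).congr_deriv ?_
    simp only [Pi.neg_apply, id, one_mul]; ring

lemma integral_sq_mul_exp_mul_rpow {α r : ℝ} (h2 : α < 2) (hr : 0 < r) :
    ∫ x in Set.Ioi (0 : ℝ), (x : ℂ) ^ 2 * Complex.exp (-((r : ℂ) * x)) * ((x ^ (-1 - α) : ℝ) : ℂ)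
      = Real.Gamma (2 - α) * (r : ℂ) ^ ((α : ℂ) - 2) := by
  have h := Complex.integral_cpow_mul_exp_neg_mul_Ioi (a := ((2 - α : ℝ) : ℂ)) (r := r)
    (by simp; linarith) hr
  rw [Complex.Gamma_ofReal] at h
  rw [mul_comm (Real.Gamma (2 - α) : ℂ)]
  have e : (1 / (r : ℂ)) ^ ((2 - α : ℝ) : ℂ) = (r : ℂ) ^ ((α : ℂ) - 2) := by
    rw [one_div, Complex.inv_cpow _ _ (by rw [Complex.arg_ofReal_of_nonneg hr.le]; exact Real.pi_pos.ne),
      ← Complex.cpow_neg]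
    congr 1; push_cast; ring
  rw [← e, ← h]
  refine setIntegral_congr_fun measurableSet_Ioi fun x hx => ?_
  have hx : 0 < x := hx
  have e2 : ((x : ℂ)) ^ (((2 - α : ℝ) : ℂ) - 1) = (x : ℂ) ^ 2 * ((x ^ (-1 - α) : ℝ) : ℂ) := by
    rw [show (((2 - α : ℝ) : ℂ) - 1) = ((1 - α : ℝ) : ℂ) by push_cast; ring,
      ← Complex.ofReal_cpow hx.le, ← Complex.ofReal_pow, ← Complex.ofReal_mul]
    congr 1
    rw [← Real.rpow_natCast, ← Real.rpow_add hx]; congr 1; push_cast; ring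
  simp only [e2]; ring

lemma continuousOn_laplaceStable {α : ℝ} (h0 : 0 < α) (h2 : α < 2) :
    ContinuousOn (laplaceStable α) {r : ℂ | 0 ≤ r.re} := by
  intro r hr
  refine tendsto_integral_filter_of_dominated_convergence
    (fun x => (3 * (‖r‖ + 1) ^ 2 + 2 * (‖r‖ + 1) + 2) * stableDominant α x)
    (Eventually.of_forall fun z => (measurable_laplaceRemainder_mul α z).aestronglyMeasurable) ?_
    ((integrableOn_stableDominant h0 h2).const_mul _) ?_
  · have hb : ∀ᶠ z in 𝓝[{r : ℂ | 0 ≤ r.re}] r, ‖z‖ < ‖r‖ + 1 :=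
      nhdsWithin_le_nhds ((continuous_norm.tendsto r).eventually_lt_const (by linarith))
    filter_upwards [hb, self_mem_nhdsWithin] with z hz hz0
    filter_upwards [ae_restrict_mem measurableSet_Ioi] with x hx
    refine (norm_laplaceRemainder_mul_le hz0 hx).trans ?_
    have := stableDominant_nonneg (α := α) hx
    gcongr
  · refine Eventually.of_forall fun x => ?_
    have : Continuous fun z => laplaceRemainder z x * ((x ^ (-1 - α) : ℝ) : ℂ) := by
      unfold laplaceRemainder; fun_prop
    exact (this.tendsto r).mono_left nhdsWithin_le_nhds

/-- The function whose second derivative is `Γ(2 - α) r^{α - 2}`. -/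
noncomputable def stablePrimitive (α : ℝ) (r : ℂ) : ℂ :=
  if α = 1 then r * Complex.log r
  else (Real.Gamma (2 - α) / (α * (α - 1)) : ℝ) * r ^ (α : ℂ)

/-- The derivative of `stablePrimitive`. -/
noncomputable def stablePrimitiveDeriv (α : ℝ) (r : ℂ) : ℂ :=
  if α = 1 then Complex.log r + 1
  else (Real.Gamma (2 - α) / (α - 1) : ℝ) * r ^ ((α : ℂ) - 1)

lemma hasDerivAt_stablePrimitive {α : ℝ} (h0 : 0 < α) {r : ℂ} (hr : r ∈ Complex.slitPlane) :
    HasDerivAt (stablePrimitive α) (stablePrimitiveDeriv α r) r := by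
  unfold stablePrimitive stablePrimitiveDeriv
  split_ifs with h
  · refine ((hasDerivAt_id r).mul (Complex.hasDerivAt_log hr)).congr_deriv ?_
    have := Complex.slitPlane_ne_zero hr
    simp [this]
  · refine (((hasDerivAt_id r).cpow_const hr).const_mul _).congr_deriv ?_
    have h1 : (α : ℂ) - 1 ≠ 0 := by
      rw [sub_ne_zero]; exact_mod_cast h
    have h2 : (α : ℂ) ≠ 0 := by exact_mod_cast h0.ne'
    push_cast
    simp
    field_simp

lemma hasDerivAt_stablePrimitiveDeriv {α : ℝ} {r : ℂ} (hr : r ∈ Complex.slitPlane) :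
    HasDerivAt (stablePrimitiveDeriv α) (Real.Gamma (2 - α) * r ^ ((α : ℂ) - 2)) r := by
  unfold stablePrimitiveDeriv
  split_ifs with h
  · refine ((Complex.hasDerivAt_log hr).add_const 1).congr_deriv ?_
    subst h
    norm_num [Complex.cpow_neg_one]
  · refine (((hasDerivAt_id r).cpow_const hr).const_mul _).congr_deriv ?_
    have h1 : (α : ℂ) - 1 ≠ 0 := by
      rw [sub_ne_zero]; exact_mod_cast h
    push_cast
    simp only [id, mul_one]
    rw [show (α : ℂ) - 1 - 1 = α - 2 by ring]
    field_simp

lemma isOpen_re_pos : IsOpen {r : ℂ | 0 < r.re} := isOpen_lt continuous_const Complex.continuous_re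

lemma isPreconnected_re_pos : IsPreconnected {r : ℂ | 0 < r.re} :=
  (convex_halfSpace_re_gt 0).isPreconnected

lemma eq_const_of_hasDerivAt_zero {f : ℂ → ℂ} (hf : ∀ r : ℂ, 0 < r.re → HasDerivAt f 0 r) :
    ∀ r : ℂ, 0 < r.re → f r = f 1 := by
  intro r hr
  exact isOpen_re_pos.is_const_of_deriv_eq_zero isPreconnected_re_pos
    (fun z hz => (hf z hz).differentiableAt.differentiableWithinAt)
    (fun z hz => (hf z hz).deriv) hr (by simp)

lemma re_pos_mem_slitPlane {r : ℂ} (hr : 0 < r.re) : r ∈ Complex.slitPlane := Or.inl hr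

/-- By the identity theorem it is enough to evaluate the Gamma integral at positive real `r`. -/
lemma eqOn_re_pos_of_eqOn_real {f g : ℂ → ℂ} (hf : DifferentiableOn ℂ f {r : ℂ | 0 < r.re})
    (hg : DifferentiableOn ℂ g {r : ℂ | 0 < r.re}) (h : ∀ x : ℝ, 0 < x → f x = g x) :
    Set.EqOn f g {r : ℂ | 0 < r.re} := by
  refine AnalyticOnNhd.eqOn_of_preconnected_of_frequently_eq (hf.analyticOnNhd isOpen_re_pos)
    (hg.analyticOnNhd isOpen_re_pos) isPreconnected_re_pos (z₀ := 1) (by simp) ?_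
  have h1 : Tendsto (fun x : ℝ => (x : ℂ)) (𝓝[≠] 1) (𝓝[≠] 1) := by
    refine tendsto_nhdsWithin_iff.2 ⟨?_, ?_⟩
    · exact (Complex.continuous_ofReal.tendsto' 1 1 (by simp)).mono_left nhdsWithin_le_nhds
    · filter_upwards [self_mem_nhdsWithin] with x hx
      simpa using hx
  refine h1.frequently (Eventually.frequently ?_)
  filter_upwards [nhdsWithin_le_nhds (lt_mem_nhds (zero_lt_one (α := ℝ)))] with x hx using h x hx

lemma hasDerivAt_laplaceStableDeriv_eq {α : ℝ} (h0 : 0 < α) (h2 : α < 2) {r : ℂ} (hr : 0 < r.re) :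
    HasDerivAt (laplaceStableDeriv α) (Real.Gamma (2 - α) * r ^ ((α : ℂ) - 2)) r := by
  have hd : DifferentiableOn ℂ (laplaceStableDeriv α) {r : ℂ | 0 < r.re} := fun z hz =>
    (hasDerivAt_laplaceStableDeriv h0 h2 hz).differentiableAt.differentiableWithinAt
  have key := eqOn_re_pos_of_eqOn_real (hd.deriv isOpen_re_pos)
    (g := fun r => Real.Gamma (2 - α) * r ^ ((α : ℂ) - 2)) ?_ ?_ hr
  · exact (hasDerivAt_laplaceStableDeriv h0 h2 hr).differentiableAt.hasDerivAt.congr_deriv key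
  · intro z hz
    exact (((hasDerivAt_id z).cpow_const (re_pos_mem_slitPlane hz)).const_mul
      _).differentiableAt.differentiableWithinAt
  · intro x hx
    rw [(hasDerivAt_laplaceStableDeriv h0 h2 (by simpa using hx)).deriv,
      integral_sq_mul_exp_mul_rpow h2 hx]

lemma tendsto_stablePrimitive_zero {α : ℝ} (h0 : 0 < α) :
    Tendsto (fun x : ℝ => stablePrimitive α x) (𝓝[>] 0) (𝓝 0) := by
  unfold stablePrimitive
  split_ifs with h
  · have : Tendsto (fun x : ℝ => ((x * Real.log x : ℝ) : ℂ)) (𝓝[>] 0) (𝓝 ((0 : ℝ) : ℂ)) := by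
      refine Tendsto.ofReal ?_
      have := (Real.continuous_mul_log.tendsto 0).mono_left (nhdsWithin_le_nhds (s := Set.Ioi 0))
      simpa using this
    refine this.congr' ?_
    filter_upwards [self_mem_nhdsWithin] with x hx
    rw [Complex.ofReal_mul, Complex.ofReal_log (le_of_lt hx)]
  · have : Tendsto (fun x : ℝ => (Real.Gamma (2 - α) / (α * (α - 1)) : ℝ) * ((x ^ α : ℝ) : ℂ))
        (𝓝[>] 0) (𝓝 ((Real.Gamma (2 - α) / (α * (α - 1)) : ℝ) * ((0 : ℝ) : ℂ))) := by
      refine (Tendsto.ofReal ?_).const_mul _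
      have := ((Real.continuousAt_rpow_const 0 α (Or.inr h0.le)).tendsto).mono_left
        (nhdsWithin_le_nhds (s := Set.Ioi 0))
      rwa [Real.zero_rpow h0.ne'] at this
    simp only [Complex.ofReal_zero, mul_zero] at this
    refine this.congr' ?_
    filter_upwards [self_mem_nhdsWithin] with x hx
    rw [Complex.ofReal_cpow (le_of_lt hx)]

/-- Both functions have second derivative Γ(2-α) r^{α-2}, so they differ by an affine function A + B
r. Letting r decrease to 0 gives A = 0, and comparing imaginary parts at r = 1 shows that B is real.
On the imaginary axis B r is a pure drift, so the value of B is never needed. -/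
lemma exists_laplaceStable_eq {α : ℝ} (h0 : 0 < α) (h2 : α < 2) :
    ∃ B : ℝ, ∀ r : ℂ, 0 < r.re → laplaceStable α r = stablePrimitive α r + B * r := by
  obtain ⟨B, hB⟩ : ∃ B : ℂ, ∀ r : ℂ, 0 < r.re →
      laplaceStableDeriv α r - stablePrimitiveDeriv α r = B :=
    ⟨_, eq_const_of_hasDerivAt_zero fun r hr =>
      ((hasDerivAt_laplaceStableDeriv_eq h0 h2 hr).sub
        (hasDerivAt_stablePrimitiveDeriv (re_pos_mem_slitPlane hr))).congr_deriv (by ring)⟩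
  obtain ⟨A, hA⟩ : ∃ A : ℂ, ∀ r : ℂ, 0 < r.re →
      laplaceStable α r - stablePrimitive α r - B * r = A :=
    ⟨_, eq_const_of_hasDerivAt_zero (f := fun r => laplaceStable α r - stablePrimitive α r - B * r)
      fun r hr => (((hasDerivAt_laplaceStable h0 h2 hr).sub
        (hasDerivAt_stablePrimitive h0 (re_pos_mem_slitPlane hr))).sub
          ((hasDerivAt_id r).const_mul B)).congr_deriv (by rw [← hB r hr]; ring)⟩
  have hA0 : A = 0 := by
    have t1 : Tendsto (fun x : ℝ => laplaceStable α x) (𝓝[>] 0) (𝓝 (laplaceStable α 0)) := by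
      refine (continuousOn_laplaceStable h0 h2 0 (by simp)).tendsto.comp
        (tendsto_nhdsWithin_iff.2 ⟨?_, ?_⟩)
      · exact (Complex.continuous_ofReal.tendsto' 0 0 (by simp)).mono_left nhdsWithin_le_nhds
      · filter_upwards [self_mem_nhdsWithin] with x hx
        simpa using le_of_lt hx
    have hz : laplaceStable α 0 = 0 := by simp [laplaceStable, laplaceRemainder]
    have t3 : Tendsto (fun x : ℝ => B * (x : ℂ)) (𝓝[>] 0) (𝓝 (B * ((0 : ℝ) : ℂ))) :=
      ((Complex.continuous_ofReal.tendsto 0).mono_left nhdsWithin_le_nhds).const_mul B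
    have t := (t1.sub (tendsto_stablePrimitive_zero h0)).sub t3
    rw [hz] at t
    simp only [Complex.ofReal_zero, mul_zero, sub_zero] at t
    refine tendsto_nhds_unique (tendsto_const_nhds.congr' ?_) t
    filter_upwards [self_mem_nhdsWithin] with x hx
    exact (hA x (by simpa using hx)).symm
  have hBr : B = ((B.re : ℝ) : ℂ) := by
    have h1 := hA 1 (by simp)
    rw [hA0] at h1
    have k1 : laplaceStable α 1
        = ((∫ x in Set.Ioi (0 : ℝ), (Real.exp (-x) - 1 + Real.sin x) * x ^ (-1 - α) : ℝ) : ℂ) := by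
      rw [← integral_complex_ofReal]
      unfold laplaceStable laplaceRemainder
      congr 1; ext x; push_cast; simp
    have k2 : (stablePrimitive α 1).im = 0 := by
      unfold stablePrimitive
      split_ifs
      · simp
      · rw [Complex.one_cpow, mul_one, Complex.ofReal_im]
    have : B.im = 0 := by
      have h2 := congrArg Complex.im h1
      rw [k1] at h2
      simp [k2] at h2
      exact h2
    exact Complex.ext (by simp) (by simp [this])
  refine ⟨B.re, fun r hr => ?_⟩
  rw [← hBr]
  have := hA r hr
  rw [hA0] at this
  linear_combination this

/-- The Fourier case is the boundary of the half-plane: the integral is continuous on the closed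
half-plane, and the primitive is holomorphic across the imaginary axis away from 0. -/
lemma laplaceStable_imaginary {α : ℝ} (h0 : 0 < α) (h2 : α < 2) :
    ∃ B : ℝ, ∀ t : ℝ, 0 < t → laplaceStable α (-(t * Complex.I))
      = stablePrimitive α (-(t * Complex.I)) - B * t * Complex.I := by
  obtain ⟨B, hB⟩ := exists_laplaceStable_eq h0 h2
  refine ⟨B, fun t ht => ?_⟩
  have hs : -((t : ℂ) * Complex.I) ∈ Complex.slitPlane := Or.inr (by simpa using ht.ne')
  have hc : Tendsto (fun x : ℝ => (x : ℂ) + -((t : ℂ) * Complex.I)) (𝓝[>] 0)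
      (𝓝 (-((t : ℂ) * Complex.I))) :=
    (Continuous.tendsto' (by fun_prop) 0 _ (by simp)).mono_left nhdsWithin_le_nhds
  have t1 : Tendsto (fun x : ℝ => laplaceStable α (x + -((t : ℂ) * Complex.I))) (𝓝[>] 0)
      (𝓝 (laplaceStable α (-((t : ℂ) * Complex.I)))) := by
    refine (continuousOn_laplaceStable h0 h2 _ (by simp)).tendsto.comp
      (tendsto_nhdsWithin_iff.2 ⟨hc, ?_⟩)
    filter_upwards [self_mem_nhdsWithin] with x hx
    simpa using le_of_lt hx
  have t2 := ((hasDerivAt_stablePrimitive h0 hs).continuousAt.tendsto.comp hc).add (hc.const_mul (B : ℂ))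
  have e := tendsto_nhds_unique (t1.congr' ?_) t2
  · rw [e]; ring
  · filter_upwards [self_mem_nhdsWithin] with x hx
    exact hB _ (by simpa using hx)

/-! ### Stable exponents and their canonical measures. -/

/-- The logarithm of the characteristic function of the stable law `S(α, 0, c, p, q)`. -/
noncomputable def stableExponent (α c p q t : ℝ) : ℂ :=
  if α = 1 then
    -((c * |t| : ℝ) * ((Real.pi / 2 : ℝ) + Complex.I * ((p - q) * (t / |t|) * Real.log |t| : ℝ)))
  else
    (c * |t| ^ α * (Real.Gamma (3 - α) / (α * (α - 1))) : ℝ)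
        * ((Real.cos (Real.pi * α / 2) : ℝ)
          + Complex.I * ((p - q) * (t / |t|) * Real.sin (Real.pi * α / 2) : ℝ))

lemma stableCharFun_eq (α γ c p q t : ℝ) :
    stableCharFun α γ c p q t = Complex.exp (γ * t * Complex.I + stableExponent α c p q t) := by
  unfold stableCharFun stableExponent
  split_ifs
  · congr 1; ring
  · congr 1; ring

lemma stableExponent_zero {α : ℝ} (h0 : 0 < α) (c p q : ℝ) : stableExponent α c p q 0 = 0 := by
  unfold stableExponent
  split_ifs
  · simp
  · simp [Real.zero_rpow h0.ne']

lemma stableExponent_neg (α c p q t : ℝ) :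
    stableExponent α c p q (-t) = (starRingEnd ℂ) (stableExponent α c p q t) := by
  unfold stableExponent
  split_ifs
  · simp only [abs_neg, map_neg, map_mul, map_add, Complex.conj_ofReal, Complex.conj_I]
    push_cast; ring
  · simp only [abs_neg, map_mul, map_add, Complex.conj_ofReal, Complex.conj_I]
    push_cast; ring

/-- Here (-it)^α = t^α (cos(πα/2) - i sin(πα/2)), while (-it) log(-it) = -t(π/2 + i log t). With the
sign conventions of the given characteristic functions, jumps in (0, ∞) therefore belong to `q` when
α ≠ 1 and to `p` when α = 1. -/
lemma stablePrimitive_imaginary {α t : ℝ} (h2 : α < 2) (ht : 0 < t) :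
    ((2 - α : ℝ) : ℂ) * stablePrimitive α (-(t * Complex.I))
      = if α = 1 then stableExponent α 1 1 0 t else stableExponent α 1 0 1 t := by
  have hlog : Complex.log (-(t * Complex.I)) = (Real.log t : ℂ) - (Real.pi / 2 : ℝ) * Complex.I := by
    rw [show -((t : ℂ) * Complex.I) = (t : ℂ) * (-Complex.I) by ring,
      Complex.log_ofReal_mul ht (by simp), Complex.log_neg_I]
    push_cast; ring
  have habs : |t| = t := abs_of_pos ht
  unfold stablePrimitive stableExponent
  split_ifs with h
  · subst h
    rw [hlog, habs, div_self ht.ne']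
    push_cast
    linear_combination ((t : ℂ) * (Real.pi / 2)) * Complex.I_mul_I
  · have hne : -((t : ℂ) * Complex.I) ≠ 0 := by simp [ht.ne']
    rw [Complex.cpow_def_of_ne_zero hne, hlog, habs, div_self ht.ne']
    have hG : Real.Gamma (3 - α) = (2 - α) * Real.Gamma (2 - α) := by
      rw [show (3 : ℝ) - α = (2 - α) + 1 by ring, Real.Gamma_add_one (by linarith)]
    have e1 : Complex.exp (((Real.log t : ℂ) - (Real.pi / 2 : ℝ) * Complex.I) * α)
        = ((t ^ α : ℝ) : ℂ) * (Real.cos (Real.pi * α / 2) - Real.sin (Real.pi * α / 2) * Complex.I) := by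
      rw [sub_mul, Complex.exp_sub, Real.rpow_def_of_pos ht, ← Complex.ofReal_mul,
        ← Complex.ofReal_exp, div_eq_mul_inv, ← Complex.exp_neg]
      congr 1
      rw [show -(((Real.pi / 2 : ℝ) : ℂ) * Complex.I * α) = ((-(Real.pi * α / 2) : ℝ) : ℂ) * Complex.I by
        push_cast; ring, Complex.exp_mul_I, ← Complex.ofReal_cos, ← Complex.ofReal_sin,
        Real.cos_neg, Real.sin_neg]
      push_cast; ring
    rw [e1, hG]
    push_cast
    ring

/-- The canonical measure of the totally asymmetric stable law with jumps in `(0, ∞)`. -/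
noncomputable def halfStableMeasure (α c : ℝ) : Measure ℝ :=
  (volume.restrict (Set.Ioi 0)).withDensity
    fun x => ENNReal.ofReal (c * (2 - α) * (sincWeight x * x ^ (-1 - α)))

lemma measurable_halfStable_density (α c : ℝ) :
    Measurable fun x : ℝ => c * (2 - α) * (sincWeight x * x ^ (-1 - α)) := by
  have := continuous_sincWeight.measurable
  fun_prop

lemma isFiniteMeasure_halfStableMeasure {α : ℝ} (h0 : 0 < α) (h2 : α < 2) (c : ℝ) :
    IsFiniteMeasure (halfStableMeasure α c) := by
  refine isFiniteMeasure_withDensity_ofReal (Integrable.hasFiniteIntegral ?_)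
  refine Integrable.const_mul ?_ _
  refine ((integrableOn_stableDominant h0 h2).const_mul 2).mono' ?_ ?_
  · have := continuous_sincWeight.measurable
    exact Measurable.aestronglyMeasurable (by fun_prop)
  · filter_upwards [ae_restrict_mem measurableSet_Ioi] with x hx
    have hp := Real.rpow_nonneg (le_of_lt hx) (-1 - α)
    rw [Real.norm_of_nonneg (mul_nonneg (sincWeight_nonneg x) hp), stableDominant, ← mul_assoc]
    gcongr
    exact sincWeight_le_min x

lemma integral_halfStableMeasure {E : Type*} [NormedAddCommGroup E] [NormedSpace ℝ E] {α c : ℝ}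
    (h2 : α < 2) (hc : 0 ≤ c) (F : ℝ → E) :
    ∫ x, F x ∂(halfStableMeasure α c)
      = (c * (2 - α)) • ∫ x in Set.Ioi (0 : ℝ), (sincWeight x * x ^ (-1 - α)) • F x := by
  rw [halfStableMeasure, integral_withDensity_eq_integral_toReal_smul
    (measurable_halfStable_density α c).ennreal_ofReal
    (Eventually.of_forall fun x => ENNReal.ofReal_lt_top), ← integral_smul]
  refine setIntegral_congr_fun measurableSet_Ioi fun x hx => ?_
  have hp := Real.rpow_nonneg (le_of_lt hx) (-1 - α)
  have := sincWeight_nonneg x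
  have h2' : 0 ≤ 2 - α := by linarith
  rw [ENNReal.toReal_ofReal (by positivity), smul_smul]

lemma levyExponent_halfStableMeasure {α c : ℝ} (h2 : α < 2) (hc : 0 ≤ c) (t : ℝ) :
    levyExponent (halfStableMeasure α c) t
      = (c * (2 - α) : ℝ) * laplaceStable α (-(t * Complex.I)) := by
  rw [levyExponent, integral_halfStableMeasure h2 hc, Complex.real_smul, laplaceStable]
  congr 1
  refine setIntegral_congr_fun measurableSet_Ioi fun x _ => ?_
  rw [Complex.real_smul, mul_comm (sincWeight x), Complex.ofReal_mul, mul_assoc,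
    mul_comm (sincWeight x : ℂ), levyKernel_mul, centredExp, laplaceRemainder, mul_comm]
  congr 1
  rw [show -(-((t : ℂ) * Complex.I) * x) = t * x * Complex.I by ring]
  ring

/-- The quotient of `x²` by the weight. -/
noncomputable def sqKernel (x : ℝ) : ℝ := if x = 0 then 6 else x ^ 2 / sincWeight x

lemma sqKernel_neg (x : ℝ) : sqKernel (-x) = sqKernel x := by
  simp [sqKernel, sincWeight_neg]

/-- The factor 2 - α in the density cancels the one from integrating x^{1-α}. This clean value is
what later fixes the norming constants. -/
lemma integral_sqKernel_halfStableMeasure {α c : ℝ} (h2 : α < 2) (hc : 0 ≤ c) {s : ℝ}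
    (hs : 0 < s) :
    ∫ x, Set.indicator {x : ℝ | |x| < s} sqKernel x ∂(halfStableMeasure α c) = c * s ^ (2 - α) := by
  rw [integral_halfStableMeasure h2 hc]
  have e : ∫ x in Set.Ioi (0 : ℝ),
      (sincWeight x * x ^ (-1 - α)) • Set.indicator {x : ℝ | |x| < s} sqKernel x
      = ∫ x in Set.Ioi (0 : ℝ), Set.indicator (Set.Iio s) (fun x => x ^ (1 - α)) x := by
    refine setIntegral_congr_fun measurableSet_Ioi fun x hx => ?_
    have hx : 0 < x := hx
    by_cases h : x < s
    · have h1 : x ∈ {x : ℝ | |x| < s} := by simpa [abs_of_pos hx] using h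
      have hw := (sincWeight_pos hx.ne').ne'
      rw [Set.indicator_of_mem h1, Set.indicator_of_mem (by exact h), sqKernel, if_neg hx.ne',
        smul_eq_mul]
      have : x ^ (1 - α) = x ^ (-1 - α) * x ^ 2 := by
        rw [← Real.rpow_natCast x 2, ← Real.rpow_add hx]; congr 1; push_cast; ring
      rw [this]; field_simp
    · have h1 : x ∉ {x : ℝ | |x| < s} := by simpa [abs_of_pos hx] using h
      rw [Set.indicator_of_notMem h1, Set.indicator_of_notMem (by exact h), smul_zero]
  rw [e, setIntegral_indicator measurableSet_Iio, Set.Ioi_inter_Iio, ← integral_Ioc_eq_integral_Ioo,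
    ← intervalIntegral.integral_of_le hs.le, integral_rpow (Or.inl (by linarith)),
    Real.zero_rpow (by linarith)]
  have : (2 : ℝ) - α ≠ 0 := by linarith
  rw [show (1 : ℝ) - α + 1 = 2 - α by ring, smul_eq_mul]
  field_simp; ring

lemma levyKernel_neg_arg (t x : ℝ) : levyKernel t (-x) = (starRingEnd ℂ) (levyKernel t x) := by
  unfold levyKernel divWeight
  by_cases h : x = 0
  · simp [h, Complex.conj_ofNat]
  · simp only [neg_eq_zero, if_neg h, sincWeight_neg, map_div₀, Complex.conj_ofReal]
    congr 1
    simp only [centredExp, map_sub, ← Complex.exp_conj, map_mul, Complex.conj_ofReal,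
      Complex.conj_I, map_one, Real.sin_neg]
    push_cast
    congr 1
    · congr 2; ring
    · ring

lemma levyKernel_neg (t x : ℝ) : levyKernel (-t) x = (starRingEnd ℂ) (levyKernel t x) := by
  unfold levyKernel divWeight
  by_cases h : x = 0
  · simp [h, Complex.conj_ofNat]
  · simp only [if_neg h, map_div₀, Complex.conj_ofReal]
    congr 1
    simp only [centredExp, map_sub, ← Complex.exp_conj, map_mul, Complex.conj_ofReal,
      Complex.conj_I, map_one]
    push_cast
    congr 1
    · congr 2; ring
    · ring

lemma levyExponent_neg (M : Measure ℝ) (t : ℝ) :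
    levyExponent M (-t) = (starRingEnd ℂ) (levyExponent M t) := by
  unfold levyExponent
  rw [← integral_conj]
  simp_rw [levyKernel_neg]

lemma levyExponent_zero (M : Measure ℝ) : levyExponent M 0 = 0 := by
  have : ∀ x, levyKernel 0 x = 0 := fun x => by
    unfold levyKernel divWeight; split_ifs <;> simp [centredExp]
  simp [levyExponent, this]

lemma levyExponent_map_neg (M : Measure ℝ) (t : ℝ) :
    levyExponent (M.map (fun x => -x)) t = (starRingEnd ℂ) (levyExponent M t) := by
  unfold levyExponent
  rw [integral_map (by fun_prop) (continuous_levyKernel t).aestronglyMeasurable, ← integral_conj]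
  simp_rw [levyKernel_neg_arg]

lemma measurable_sqKernel : Measurable sqKernel := by
  unfold sqKernel
  refine Measurable.ite (measurableSet_eq_fun measurable_id measurable_const) (by fun_prop) ?_
  exact Measurable.div (by fun_prop) continuous_sincWeight.measurable

lemma sqKernel_nonneg (x : ℝ) : 0 ≤ sqKernel x := by
  unfold sqKernel
  split_ifs
  · norm_num
  · exact div_nonneg (sq_nonneg x) (sincWeight_nonneg x)

lemma sqKernel_le (x : ℝ) : sqKernel x ≤ 40 * max 1 (x ^ 2) := by
  unfold sqKernel
  split_ifs with h
  · have := le_max_left 1 (x ^ 2); linarith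
  · rw [div_le_iff₀ (sincWeight_pos h)]
    have h1 := min_one_sq_le_sincWeight x
    have : max 1 (x ^ 2) * min 1 (x ^ 2) = x ^ 2 := by rw [max_mul_min, one_mul]
    have h3 : 0 ≤ max 1 (x ^ 2) := le_max_of_le_left zero_le_one
    nlinarith [mul_le_mul_of_nonneg_left h1 h3]

lemma integrable_indicator_sqKernel (M : Measure ℝ) [IsFiniteMeasure M] (s : ℝ) :
    Integrable (Set.indicator {x : ℝ | |x| < s} sqKernel) M := by
  have hm : MeasurableSet {x : ℝ | |x| < s} := measurableSet_lt (by fun_prop) measurable_const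
  refine Integrable.of_bound (measurable_sqKernel.indicator hm).aestronglyMeasurable
    (40 * max 1 (s ^ 2)) (Eventually.of_forall fun x => ?_)
  by_cases h : x ∈ {x : ℝ | |x| < s}
  · rw [Set.indicator_of_mem h, Real.norm_of_nonneg (sqKernel_nonneg x)]
    refine (sqKernel_le x).trans ?_
    have : x ^ 2 ≤ s ^ 2 := by
      have h : |x| < s := h
      exact sq_le_sq' (by linarith [(abs_lt.1 h).1]) (abs_lt.1 h).2.le
    gcongr
  · rw [Set.indicator_of_notMem h, norm_zero]; positivity

/-- `M` is the canonical measure, with respect to the weight `1 - sin x / x`, of the stable laws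
with exponent `stableExponent α c p q`. -/
structure IsStableCanonical (α c p q : ℝ) (M : Measure ℝ) : Prop where
  finite : IsFiniteMeasure M
  exponent : ∃ β : ℝ, ∀ t : ℝ, levyExponent M t = stableExponent α c p q t + β * t * Complex.I
  truncated : ∀ s : ℝ, 0 < s →
    ∫ x, Set.indicator {x : ℝ | |x| < s} sqKernel x ∂M = c * s ^ (2 - α)

lemma stableExponent_add {α c p q : ℝ} (hα : α ≠ 1) (t : ℝ) :
    c * (q * stableExponent α 1 0 1 t + p * (starRingEnd ℂ) (stableExponent α 1 0 1 t))
      = (p + q) * stableExponent α c 0 0 t + stableExponent α c p q t - stableExponent α c 0 0 t := by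
  simp only [stableExponent, if_neg hα, map_mul, map_add, Complex.conj_ofReal, Complex.conj_I]
  push_cast; ring

lemma stableExponent_add_one {c p q : ℝ} (t : ℝ) :
    c * (p * stableExponent 1 1 1 0 t + q * (starRingEnd ℂ) (stableExponent 1 1 1 0 t))
      = (p + q) * stableExponent 1 c 0 0 t + stableExponent 1 c p q t - stableExponent 1 c 0 0 t := by
  simp only [stableExponent, if_true, map_neg, map_mul, map_add, Complex.conj_ofReal, Complex.conj_I]
  push_cast; ring

lemma exists_isStableCanonical_of_lt_two {α c p q : ℝ} (h0 : 0 < α) (h2 : α < 2) (hc : 0 ≤ c)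
    (hp : 0 ≤ p) (hq : 0 ≤ q) (hpq : p + q = 1) : ∃ M, IsStableCanonical α c p q M := by
  obtain ⟨p₁, q₁, hp₁, hq₁, hpq₁, hE⟩ : ∃ p₁ q₁ : ℝ, 0 ≤ p₁ ∧ 0 ≤ q₁ ∧ p₁ + q₁ = 1 ∧
      ∀ t : ℝ, 0 < t → (c : ℂ) * (p₁ * (((2 - α : ℝ) : ℂ) * stablePrimitive α (-(t * Complex.I)))
        + q₁ * (starRingEnd ℂ) (((2 - α : ℝ) : ℂ) * stablePrimitive α (-(t * Complex.I))))
        = stableExponent α c p q t := by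
    have hpq' : (p : ℂ) + q = 1 := by exact_mod_cast hpq
    -- The weights of the positive and negative half-lines are `p`, `q` when α = 1 and are exchanged
    -- otherwise, because of the sign conventions.
    by_cases h : α = 1
    · refine ⟨p, q, hp, hq, hpq, fun t ht => ?_⟩
      rw [stablePrimitive_imaginary h2 ht, if_pos h]
      subst h
      rw [stableExponent_add_one, hpq']; ring
    · refine ⟨q, p, hq, hp, by linarith, fun t ht => ?_⟩
      rw [stablePrimitive_imaginary h2 ht, if_neg h, stableExponent_add h, hpq']; ring
  have hN := isFiniteMeasure_halfStableMeasure h0 h2 c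
  set N := halfStableMeasure α c with hNdef
  have hN' : IsFiniteMeasure (N.map fun x => -x) := Measure.isFiniteMeasure_map N _
  set M : Measure ℝ := ENNReal.ofReal p₁ • N + ENNReal.ofReal q₁ • N.map (fun x => -x) with hM
  have hMint : ∀ {E : Type} [NormedAddCommGroup E] [NormedSpace ℝ E] (F : ℝ → E),
      Integrable F N → Integrable F (N.map fun x => -x) →
      ∫ x, F x ∂M = p₁ • ∫ x, F x ∂N + q₁ • ∫ x, F x ∂(N.map fun x => -x) := by
    intro E _ _ F i1 i2
    rw [hM, integral_add_measure (i1.smul_measure ENNReal.ofReal_ne_top)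
      (i2.smul_measure ENNReal.ofReal_ne_top), integral_smul_measure, integral_smul_measure,
      ENNReal.toReal_ofReal hp₁, ENNReal.toReal_ofReal hq₁]
  have hMf : IsFiniteMeasure M := by
    have i1 : IsFiniteMeasure (ENNReal.ofReal p₁ • N) := Measure.smul_finite N ENNReal.ofReal_ne_top
    have i2 : IsFiniteMeasure (ENNReal.ofReal q₁ • N.map (fun x => -x)) :=
      Measure.smul_finite _ ENNReal.ofReal_ne_top
    rw [hM]; infer_instance
  obtain ⟨B, hB⟩ := laplaceStable_imaginary h0 h2
  have hpos : ∀ t : ℝ, 0 < t → levyExponent M t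
      = stableExponent α c p q t + (-(c * (2 - α) * (p₁ - q₁) * B) : ℝ) * t * Complex.I := by
    intro t ht
    have e : levyExponent M t = p₁ • levyExponent N t + q₁ • levyExponent (N.map fun x => -x) t :=
      hMint _ (integrable_levyKernel N t) (integrable_levyKernel _ t)
    rw [e, levyExponent_map_neg, hNdef, levyExponent_halfStableMeasure h2 hc, hB t ht, ← hE t ht]
    simp only [Complex.real_smul, map_mul, map_sub, Complex.conj_ofReal, Complex.conj_I]
    push_cast; ring
  refine ⟨M, hMf, ⟨-(c * (2 - α) * (p₁ - q₁) * B), fun t => ?_⟩, fun s hs => ?_⟩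
  · rcases lt_trichotomy t 0 with h | h | h
    · have := congrArg (starRingEnd ℂ) (hpos (-t) (by linarith))
      rw [← levyExponent_neg, neg_neg] at this
      rw [this, map_add, ← stableExponent_neg, neg_neg]
      simp only [map_mul, Complex.conj_ofReal, Complex.conj_I]
      push_cast; ring
    · subst h
      simp [levyExponent_zero, stableExponent_zero h0]
    · exact hpos t h
  · rw [hMint _ (integrable_indicator_sqKernel N s) (integrable_indicator_sqKernel _ s),
      integral_map (by fun_prop) (integrable_indicator_sqKernel _ s).aestronglyMeasurable]
    have e : ∀ x, Set.indicator {x : ℝ | |x| < s} sqKernel (-x)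
        = Set.indicator {x : ℝ | |x| < s} sqKernel x := fun x => by
      simp [Set.indicator, sqKernel_neg]
    simp_rw [e]
    rw [hNdef, integral_sqKernel_halfStableMeasure h2 hc hs, ← add_smul, hpq₁, one_smul]

lemma exists_isStableCanonical_two {c : ℝ} (hc : 0 ≤ c) (p q : ℝ) :
    ∃ M, IsStableCanonical 2 c p q M := by
  -- In the Gaussian case the kernel is 6·(-t²/2) and `sqKernel` is 6 at the origin, so mass c/6
  -- there gives the exponent -ct²/2 and truncated moment c.
  refine ⟨ENNReal.ofReal (c / 6) • Measure.dirac 0,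
    Measure.smul_finite _ ENNReal.ofReal_ne_top, ⟨0, fun t => ?_⟩, fun s hs => ?_⟩
  · rw [levyExponent, integral_smul_measure, integral_dirac, ENNReal.toReal_ofReal (by positivity)]
    have h1 : Real.Gamma (3 - 2) = 1 := by norm_num [Real.Gamma_one]
    have h2 : Real.cos (Real.pi * 2 / 2) = -1 := by simp
    have h3 : Real.sin (Real.pi * 2 / 2) = 0 := by simp
    have h4 : |t| ^ (2 : ℝ) = t ^ 2 := by norm_num
    rw [stableExponent, if_neg (by norm_num), h1, h2, h3, h4]
    simp [levyKernel, divWeight]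
    ring
  · rw [integral_smul_measure, integral_dirac, ENNReal.toReal_ofReal (by positivity)]
    simp [sqKernel, hs]

lemma exists_isStableCanonical {α c p q : ℝ} (h0 : 0 < α) (h2 : α ≤ 2) (hc : 0 ≤ c)
    (hp : 0 ≤ p) (hq : 0 ≤ q) (hpq : p + q = 1) : ∃ M, IsStableCanonical α c p q M := by
  rcases h2.lt_or_eq with h | rfl
  · exact exists_isStableCanonical_of_lt_two h0 h hc hp hq hpq
  · exact exists_isStableCanonical_two hc p q

/-! ### From convergence of laws to convergence of canonical measures. -/

lemma secondDiff_add_linear (f : ℝ → ℂ) (e t h : ℝ) :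
    secondDiff (fun s => f s + e * s * Complex.I) t h = secondDiff f t h := by
  simp only [secondDiff]; push_cast; ring

lemma exp_two_mul_secondDiff (f : ℝ → ℂ) (t h : ℝ) :
    Complex.exp (2 * secondDiff f t h)
      = Complex.exp (f t) ^ 2 / (Complex.exp (f (t + h)) * Complex.exp (f (t - h))) := by
  rw [← Complex.exp_add, ← Complex.exp_nat_mul, ← Complex.exp_sub]
  congr 1; simp only [secondDiff]; push_cast; ring

/-- On the closed unit disc imaginary parts stay below π in modulus, so the principal logarithm
inverts the exponential. -/
lemma tendsto_of_tendsto_exp {u : ℕ → ℂ} {a : ℂ}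
    (h : Tendsto (fun n => Complex.exp (u n)) atTop (𝓝 (Complex.exp a)))
    (hu : ∀ᶠ n in atTop, ‖u n‖ ≤ 1) (ha : ‖a‖ ≤ 1) : Tendsto u atTop (𝓝 a) := by
  have hlog : ∀ z : ℂ, ‖z‖ ≤ 1 → Complex.log (Complex.exp z) = z := fun z hz => by
    have h1 := abs_le.1 ((Complex.abs_im_le_norm z).trans hz)
    have h2 := Real.pi_gt_three
    exact Complex.log_exp (by linarith) (by linarith)
  have hs : Complex.exp a ∈ Complex.slitPlane := by
    left
    rw [Complex.exp_re]
    have h1 := abs_le.1 ((Complex.abs_im_le_norm a).trans ha)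
    have h2 := Real.pi_gt_three
    exact mul_pos (Real.exp_pos _) (Real.cos_pos_of_mem_Ioo ⟨by linarith, by linarith⟩)
  have := (continuousAt_clog hs).tendsto.comp h
  rw [hlog a ha] at this
  refine this.congr' ?_
  filter_upwards [hu] with n hn using hlog _ hn

lemma measurable_secondDiff_levyExponent (M : Measure ℝ) [IsFiniteMeasure M] (t : ℝ) :
    StronglyMeasurable fun h => secondDiff (levyExponent M) t h := by
  simp_rw [secondDiff_levyExponent]
  refine StronglyMeasurable.integral_prod_right'
    (f := fun z : ℝ × ℝ => Complex.exp (t * z.2 * Complex.I) * cosKernel z.1 z.2) ?_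
  refine Measurable.stronglyMeasurable (Measurable.mul (by fun_prop) ?_)
  exact Complex.measurable_ofReal.comp measurable_cosKernel

/-- Convergence of infinitely divisible laws, up to drift, implies convergence of the
characteristic functions of their canonical measures. The smallness assumption excludes an
ambiguity in the choice of the logarithm. -/
lemma tendsto_charFun_of_tendsto_exp_levyExponent {M : ℕ → Measure ℝ} {M₀ : Measure ℝ}
    [∀ n, IsFiniteMeasure (M n)] [IsFiniteMeasure M₀] {e : ℕ → ℝ} {C : ℝ}
    (hexp : ∀ t : ℝ, Tendsto (fun n => Complex.exp (levyExponent (M n) t + e n * t * Complex.I))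
      atTop (𝓝 (Complex.exp (levyExponent M₀ t))))
    (hmass : ∀ᶠ n in atTop, (M n).real Set.univ ≤ C)
    (hsmall : ∀ h : ℝ, |h| ≤ 1 → ∫ x, cosKernel h x ∂M₀ ≤ 1 / 4) (t : ℝ) :
    Tendsto (fun n => charFun (M n) t) atTop (𝓝 (charFun M₀ t)) := by
  have hD : ∀ t h : ℝ, Tendsto (fun n => Complex.exp (2 * secondDiff (levyExponent (M n)) t h)) atTop
      (𝓝 (Complex.exp (2 * secondDiff (levyExponent M₀) t h))) := by
    intro t h
    have e1 : ∀ n, Complex.exp (2 * secondDiff (levyExponent (M n)) t h) = _ := fun n => by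
      rw [← secondDiff_add_linear _ (e n), exp_two_mul_secondDiff]
    simp_rw [e1]
    rw [exp_two_mul_secondDiff]
    exact ((hexp t).pow 2).div ((hexp (t + h)).mul (hexp (t - h)))
      (mul_ne_zero (Complex.exp_ne_zero _) (Complex.exp_ne_zero _))
  -- At the origin the second difference is real, and the real exponential determines its argument;
  -- no choice of branch arises.
  have hx : ∀ h : ℝ, |h| ≤ 1 → ∀ᶠ n in atTop, ∫ x, cosKernel h x ∂(M n) ≤ 1 / 2 := by
    intro h hh
    have h0 := hD 0 h
    simp_rw [← integral_cosKernel_eq] at h0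
    have h1 := (Complex.continuous_re.tendsto _).comp h0
    have e2 : ∀ y : ℝ, (Complex.exp (2 * (y : ℂ))).re = Real.exp (2 * y) := fun y => by
      rw [← Complex.exp_ofReal_re]; push_cast; rfl
    simp only [Function.comp_def, e2] at h1
    have h2 := h1.eventually_lt_const (u := Real.exp (2 * (1 / 2)))
      (Real.exp_lt_exp.2 (by linarith [hsmall h hh]))
    filter_upwards [h2] with n hn
    linarith [Real.exp_lt_exp.1 hn]
  -- The bound at the origin holds at every `t`, so twice the second difference lies in the unit
  -- disc and the branch is fixed.
  have hconv : ∀ h : ℝ, |h| ≤ 1 → Tendsto (fun n => secondDiff (levyExponent (M n)) t h) atTop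
      (𝓝 (secondDiff (levyExponent M₀) t h)) := by
    intro h hh
    have := tendsto_of_tendsto_exp (hD t h) ?_ ?_
    · simpa using this.const_mul (1 / 2 : ℂ)
    · filter_upwards [hx h hh] with n hn
      have := norm_secondDiff_levyExponent_le (M n) t h
      rw [norm_mul]; norm_num; linarith
    · have := norm_secondDiff_levyExponent_le M₀ t h
      rw [norm_mul]; norm_num; linarith [hsmall h hh]
  simp_rw [charFun_eq_integral_secondDiff]
  refine intervalIntegral.tendsto_integral_filter_of_dominated_convergence (fun _ => 80 * C) ?_ ?_
    (by simp) ?_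
  · exact Eventually.of_forall fun n =>
      (measurable_secondDiff_levyExponent (M n) t).aestronglyMeasurable
  · filter_upwards [hmass] with n hn
    refine Eventually.of_forall fun h hh => ?_
    rw [Set.uIoc_of_le zero_le_one] at hh
    have h1 : |h| ≤ 1 := abs_le.2 ⟨by linarith [hh.1], hh.2⟩
    exact (norm_secondDiff_levyExponent_le _ _ _).trans
      ((integral_cosKernel_le _ h1).trans (by linarith))
  · refine Eventually.of_forall fun h hh => ?_
    rw [Set.uIoc_of_le zero_le_one] at hh
    exact hconv h (abs_le.2 ⟨by linarith [hh.1], hh.2⟩)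

/-- **Lévy's continuity theorem** for finite measures with a non-zero limit. -/
lemma tendsto_integral_of_tendsto_charFun {M : ℕ → Measure ℝ} {M₀ : Measure ℝ}
    [∀ n, IsFiniteMeasure (M n)] [IsFiniteMeasure M₀] (hM₀ : M₀ ≠ 0)
    (h : ∀ t : ℝ, Tendsto (fun n => charFun (M n) t) atTop (𝓝 (charFun M₀ t)))
    {F : ℝ → ℂ} (hF : Continuous F) {C : ℝ} (hC : ∀ x, ‖F x‖ ≤ C) :
    Tendsto (fun n => ∫ x, F x ∂(M n)) atTop (𝓝 (∫ x, F x ∂M₀)) := by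
  have hmass : Tendsto (fun n => (M n).real Set.univ) atTop (𝓝 (M₀.real Set.univ)) := by
    have := h 0
    simp only [charFun_zero] at this
    have := (Complex.continuous_re.tendsto _).comp this
    simpa [Function.comp_def] using this
  have hM₀' : M₀.real Set.univ ≠ 0 := by
    rw [measureReal_def, Ne, ENNReal.toReal_eq_zero_iff]
    simp [hM₀]
  have hne : ∀ᶠ n in atTop, M n ≠ 0 := by
    filter_upwards [hmass.eventually_ne hM₀'] with n hn h0
    simp [h0] at hn
  -- Normalisation is made total by assigning a point mass to measures that cannot be normalised;
  -- only finitely many `n` are affected.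
  have hex : ∀ ν : Measure ℝ, ∃ P : ProbabilityMeasure ℝ, IsFiniteMeasure ν → ν ≠ 0 →
      (P : Measure ℝ) = (ν Set.univ)⁻¹ • ν := by
    intro ν
    by_cases hν : IsFiniteMeasure ν ∧ ν ≠ 0
    · have := hν.1
      have : NeZero ν := ⟨hν.2⟩
      have hp : IsProbabilityMeasure ((ν Set.univ)⁻¹ • ν) := inferInstance
      exact ⟨⟨_, hp⟩, fun _ _ => rfl⟩
    · exact ⟨⟨Measure.dirac 0, inferInstance⟩, fun h1 h2 => absurd ⟨h1, h2⟩ hν⟩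
  choose N hNν using hex
  have hN : ∀ (ν : Measure ℝ) [IsFiniteMeasure ν], ν ≠ 0 → ∀ G : ℝ → ℂ,
      ∫ x, G x ∂(N ν : Measure ℝ) = ((ν.real Set.univ)⁻¹ : ℝ) • ∫ x, G x ∂ν := by
    intro ν hf hν G
    have := hNν ν hf hν
    rw [this, integral_smul_measure, ENNReal.toReal_inv, measureReal_def]
  have hNt : Tendsto (fun n => N (M n)) atTop (𝓝 (N M₀)) := by
    refine ProbabilityMeasure.tendsto_of_tendsto_charFun fun t => ?_
    simp only [charFun_apply_real] at h ⊢
    rw [hN M₀ hM₀]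
    refine Tendsto.congr' ?_ ((hmass.inv₀ hM₀').smul (h t))
    filter_upwards [hne] with n hn
    rw [hN _ hn]
  have h1 := (ProbabilityMeasure.tendsto_iff_forall_integral_rclike_tendsto ℂ).1 hNt
    (BoundedContinuousFunction.ofNormedAddCommGroup F hF C hC)
  simp only [BoundedContinuousFunction.coe_ofNormedAddCommGroup] at h1
  rw [hN M₀ hM₀] at h1
  have h2 := hmass.smul h1
  rw [smul_smul, mul_inv_cancel₀ hM₀', one_smul] at h2
  refine h2.congr' ?_
  filter_upwards [hne, hmass.eventually_ne hM₀'] with n hn hn'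
  rw [hN _ hn, smul_smul, mul_inv_cancel₀ hn', one_smul]

/-! ### Canonical measures of the accompanying infinitely divisible laws. -/

/-- The measure `n (1 - sin x / x) P(X / B ∈ dx)`, for a variable `X` with law `μ`. -/
noncomputable def jumpMeasure (μ : Measure ℝ) (n : ℕ) (B : ℝ) : Measure ℝ :=
  (n : ENNReal) • (μ.map (fun x => x / B)).withDensity fun x => ENNReal.ofReal (sincWeight x)

lemma isFiniteMeasure_jumpMeasure (μ : Measure ℝ) [IsProbabilityMeasure μ] (n : ℕ) (B : ℝ) :
    IsFiniteMeasure (jumpMeasure μ n B) := by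
  have i0 : IsFiniteMeasure (μ.map (fun x => x / B)) := Measure.isFiniteMeasure_map μ _
  have i1 : IsFiniteMeasure ((μ.map (fun x => x / B)).withDensity
      fun x => ENNReal.ofReal (sincWeight x)) := by
    refine isFiniteMeasure_withDensity_ofReal (Integrable.hasFiniteIntegral ?_)
    refine Integrable.of_bound continuous_sincWeight.aestronglyMeasurable 2
      (Eventually.of_forall fun x => ?_)
    rw [Real.norm_of_nonneg (sincWeight_nonneg x)]; exact sincWeight_le_two x
  exact Measure.smul_finite _ (ENNReal.natCast_ne_top n)

lemma integral_jumpMeasure {E : Type*} [NormedAddCommGroup E] [NormedSpace ℝ E]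
    (μ : Measure ℝ) [IsProbabilityMeasure μ] (n : ℕ) (B : ℝ) {F : ℝ → E}
    (hF : StronglyMeasurable F) :
    ∫ x, F x ∂(jumpMeasure μ n B) = (n : ℝ) • ∫ x, sincWeight (x / B) • F (x / B) ∂μ := by
  have hw := continuous_sincWeight.measurable
  rw [jumpMeasure, integral_smul_measure, integral_withDensity_eq_integral_toReal_smul
    hw.ennreal_ofReal (Eventually.of_forall fun x => ENNReal.ofReal_lt_top),
    integral_map (by fun_prop) ?_]
  · simp [ENNReal.toReal_ofReal (sincWeight_nonneg _)]
  · exact (hw.ennreal_ofReal.ennreal_toReal.stronglyMeasurable.smul hF).aestronglyMeasurable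

lemma integral_divWeight_jumpMeasure (μ : Measure ℝ) [IsProbabilityMeasure μ] (n : ℕ) (B : ℝ)
    {f : ℝ → ℂ} {L : ℂ} (hf : Continuous f) (hf0 : f 0 = 0)
    (hL : Tendsto (fun x : ℝ => f x / (x : ℂ) ^ 2) (𝓝[≠] 0) (𝓝 L)) :
    ∫ x, divWeight f L x ∂(jumpMeasure μ n B) = n * ∫ x, f (x / B) ∂μ := by
  rw [integral_jumpMeasure μ n B (continuous_divWeight hf hL).stronglyMeasurable,
    Complex.real_smul, Complex.ofReal_natCast]
  congr 2; ext x
  rw [Complex.real_smul, mul_comm, divWeight_mul f L hf0]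

lemma continuous_centredExp_right (t : ℝ) : Continuous (centredExp t) :=
  continuous_centredExp.comp (by fun_prop : Continuous fun x : ℝ => (t, x))

/-- Up to drift, n(φ - 1) is the exponent of an infinitely divisible law with this canonical
measure. The kernel's centring sin x produces exactly n E sin(X/B). -/
lemma levyExponent_jumpMeasure (μ : Measure ℝ) [IsProbabilityMeasure μ] (n : ℕ) (B t : ℝ) :
    levyExponent (jumpMeasure μ n B) t
      = n * (charFun μ (t / B) - 1) - (n * ∫ x, Real.sin (x / B) ∂μ : ℝ) * t * Complex.I := by
  rw [levyExponent, levyKernel, integral_divWeight_jumpMeasure μ n B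
    (continuous_centredExp_right t) (by simp [centredExp]) (tendsto_centredExp_div_sq t)]
  simp only [centredExp]
  have i1 : Integrable (fun x : ℝ => Complex.exp (t * (x / B : ℝ) * Complex.I)) μ := by
    refine Integrable.of_bound (Continuous.aestronglyMeasurable (by fun_prop)) 1
      (Eventually.of_forall fun x => ?_)
    rw [← Complex.ofReal_mul, Complex.norm_exp_ofReal_mul_I]
  have i2 : Integrable (fun x : ℝ => ((Real.sin (x / B) : ℝ) : ℂ)) μ := by
    refine Integrable.of_bound (Continuous.aestronglyMeasurable (by fun_prop)) 1
      (Eventually.of_forall fun x => ?_)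
    rw [Complex.norm_real]; exact Real.abs_sin_le_one _
  rw [integral_sub (f := fun x : ℝ => Complex.exp (t * (x / B : ℝ) * Complex.I) - 1)
    (i1.sub (integrable_const _)) ((i2.const_mul _).mul_const _),
    integral_sub i1 (integrable_const _), integral_mul_const, integral_const_mul,
    integral_complex_ofReal, charFun_apply_real]
  have e : ∀ x : ℝ, Complex.exp (((t / B : ℝ) : ℂ) * x * Complex.I)
      = Complex.exp (t * (x / B : ℝ) * Complex.I) := fun x => by
    congr 1; push_cast; ring
  simp_rw [e]
  simp
  ring

lemma jumpMeasure_real_univ (μ : Measure ℝ) [IsProbabilityMeasure μ] (n : ℕ) (B : ℝ) :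
    (jumpMeasure μ n B).real Set.univ = n * ∫ x, sincWeight (x / B) ∂μ := by
  have := integral_jumpMeasure μ n B (F := fun _ => (1 : ℝ)) stronglyMeasurable_const
  simpa using this

/-! ### Continuous convergence of characteristic functions. -/

/-- If `P n` tends weakly to `P₀`, the characteristic functions converge continuously. -/
lemma tendsto_charFun_prod {P : ℕ → ProbabilityMeasure ℝ} {P₀ : ProbabilityMeasure ℝ}
    (h : Tendsto P atTop (𝓝 P₀)) (t₀ : ℝ) :
    Tendsto (fun z : ℕ × ℝ => charFun (P z.1 : Measure ℝ) z.2) (atTop ×ˢ 𝓝 t₀)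
      (𝓝 (charFun (P₀ : Measure ℝ) t₀)) := by
  -- Pairing the law with a point mass at the argument turns the characteristic function into the
  -- integral of one bounded continuous function, and products of probability measures are jointly
  -- continuous.
  have h1 : Tendsto (fun z : ℕ × ℝ => (P z.1).prod (diracProba z.2)) (atTop ×ˢ 𝓝 t₀)
      (𝓝 (P₀.prod (diracProba t₀))) := by
    have hc := ProbabilityMeasure.continuous_prod (α := ℝ) (β := ℝ)
    have hp : Tendsto (fun z : ℕ × ℝ => (P z.1, diracProba z.2)) (atTop ×ˢ 𝓝 t₀)
        (𝓝 (P₀, diracProba t₀)) := by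
      rw [nhds_prod_eq]
      exact h.prodMap (continuous_diracProba.tendsto t₀)
    exact Tendsto.comp (hc.tendsto (P₀, diracProba t₀)) hp
  have hb : ∀ x : ℝ × ℝ, ‖Complex.exp (x.2 * x.1 * Complex.I)‖ ≤ 1 := fun x => by
    rw [← Complex.ofReal_mul, Complex.norm_exp_ofReal_mul_I]
  have h2 := (ProbabilityMeasure.tendsto_iff_forall_integral_rclike_tendsto ℂ).1 h1
    (BoundedContinuousFunction.ofNormedAddCommGroup
      (fun x : ℝ × ℝ => Complex.exp (x.2 * x.1 * Complex.I)) (by fun_prop) 1 hb)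
  simp only [BoundedContinuousFunction.coe_ofNormedAddCommGroup] at h2
  have e : ∀ (Q : ProbabilityMeasure ℝ) (t : ℝ),
      ∫ x : ℝ × ℝ, Complex.exp (x.2 * x.1 * Complex.I) ∂(Q.prod (diracProba t) : Measure (ℝ × ℝ))
        = charFun (Q : Measure ℝ) t := by
    intro Q t
    have : ((diracProba t : ProbabilityMeasure ℝ) : Measure ℝ) = Measure.dirac t := rfl
    rw [ProbabilityMeasure.toMeasure_prod, this, integral_prod, charFun_apply_real]
    · simp
    · exact Integrable.of_bound (Continuous.aestronglyMeasurable (by fun_prop)) 1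
        (Eventually.of_forall hb)
  simpa only [e] using h2

/-- The normed sums of independent variables with law `μ`, with norming constants `B` and centring
constants `b` (after norming), converge in law to a law with characteristic function `g`; the
convergence is stated for characteristic functions, as continuous convergence. -/
def AttractedTo (μ : Measure ℝ) (B b : ℕ → ℝ) (g : ℝ → ℂ) : Prop :=
  ∀ t₀ : ℝ, Tendsto (fun z : ℕ × ℝ =>
    charFun μ (z.2 / B z.1) ^ z.1 * Complex.exp (-(z.2 * b z.1 * Complex.I)))
    (atTop ×ˢ 𝓝 t₀) (𝓝 (g t₀))

namespace AttractedTo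

variable {μ : Measure ℝ} {B b : ℕ → ℝ} {g : ℝ → ℂ}

/-- Moving arguments along arbitrary index sequences are what changes of norming and comparisons of
different indices require; pointwise convergence would not suffice. -/
lemma comp (h : AttractedTo μ B b g) {u : ℕ → ℕ} (hu : Tendsto u atTop atTop) {v : ℕ → ℝ} {t : ℝ}
    (hv : Tendsto v atTop (𝓝 t)) :
    Tendsto (fun n => charFun μ (v n / B (u n)) ^ u n * Complex.exp (-(v n * b (u n) * Complex.I)))
      atTop (𝓝 (g t)) := by
  have h1 : Tendsto (fun n => (u n, v n)) atTop (atTop ×ˢ 𝓝 t) := hu.prodMk hv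
  simpa only [Function.comp_def] using (h t).comp h1

lemma pointwise (h : AttractedTo μ B b g) (t : ℝ) :
    Tendsto (fun n => charFun μ (t / B n) ^ n * Complex.exp (-(t * b n * Complex.I)))
      atTop (𝓝 (g t)) :=
  h.comp tendsto_id tendsto_const_nhds

lemma norm_tendsto (h : AttractedTo μ B b g) (t₀ : ℝ) :
    Tendsto (fun z : ℕ × ℝ => ‖charFun μ (z.2 / B z.1)‖ ^ z.1) (atTop ×ˢ 𝓝 t₀) (𝓝 ‖g t₀‖) := by
  refine (h t₀).norm.congr fun z => ?_
  rw [norm_mul, norm_pow, show -((z.2 : ℂ) * b z.1 * Complex.I) = ((-(z.2 * b z.1) : ℝ) : ℂ) * Complex.I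
    by push_cast; ring, Complex.norm_exp_ofReal_mul_I, mul_one]

lemma norm_comp (h : AttractedTo μ B b g) {u : ℕ → ℕ} (hu : Tendsto u atTop atTop) {v : ℕ → ℝ}
    {t : ℝ} (hv : Tendsto v atTop (𝓝 t)) :
    Tendsto (fun n => ‖charFun μ (v n / B (u n))‖ ^ u n) atTop (𝓝 ‖g t‖) := by
  have h1 : Tendsto (fun n => (u n, v n)) atTop (atTop ×ˢ 𝓝 t) := hu.prodMk hv
  simpa only [Function.comp_def] using (h.norm_tendsto t).comp h1

lemma change_scale (h : AttractedTo μ B b g) (hB : ∀ n, B n ≠ 0) {B' : ℕ → ℝ} {r : ℝ}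
    (hr : Tendsto (fun n => B n / B' n) atTop (𝓝 r)) :
    AttractedTo μ B' (fun n => b n * (B n / B' n)) (fun t => g (r * t)) := by
  intro t₀
  have h1 : Tendsto (fun z : ℕ × ℝ => (z.1, B z.1 / B' z.1 * z.2)) (atTop ×ˢ 𝓝 t₀)
      (atTop ×ˢ 𝓝 (r * t₀)) :=
    tendsto_fst.prodMk ((hr.comp tendsto_fst).mul tendsto_snd)
  refine ((h (r * t₀)).comp h1).congr fun z => ?_
  simp only [Function.comp_apply]
  congr 2
  · congr 1
    have := hB z.1
    rw [mul_div_right_comm, div_div_cancel_left' this]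
    ring
  · push_cast; ring_nf

lemma add_drift (h : AttractedTo μ B b g) {s : ℕ → ℝ} {s₀ : ℝ} (hs : Tendsto s atTop (𝓝 s₀)) :
    AttractedTo μ B (fun n => b n + s n) (fun t => g t * Complex.exp (-(t * s₀ * Complex.I))) := by
  intro t₀
  have h1 : Tendsto (fun z : ℕ × ℝ => Complex.exp (-(z.2 * s z.1 * Complex.I))) (atTop ×ˢ 𝓝 t₀)
      (𝓝 (Complex.exp (-(t₀ * s₀ * Complex.I)))) := by
    refine (Complex.continuous_exp.tendsto _).comp ?_
    refine (Tendsto.mul_const _ (Tendsto.mul ?_ ?_)).neg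
    · exact (Complex.continuous_ofReal.tendsto _).comp tendsto_snd
    · exact (Complex.continuous_ofReal.tendsto _).comp (hs.comp tendsto_fst)
  refine ((h t₀).mul h1).congr fun z => ?_
  rw [mul_assoc, ← Complex.exp_add]
  congr 2; push_cast; ring

end AttractedTo

/-! ### Symmetrisation and truncated second moments. -/

/-- The law of the difference of two independent variables with law `μ`. -/
noncomputable def symmLaw (μ : Measure ℝ) : Measure ℝ := (μ.prod μ).map fun z => z.1 - z.2

section

variable (μ : Measure ℝ) [IsProbabilityMeasure μ]

instance isProbabilityMeasure_symmLaw : IsProbabilityMeasure (symmLaw μ) :=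
  Measure.isProbabilityMeasure_map (by fun_prop)

lemma charFun_symmLaw (t : ℝ) : charFun (symmLaw μ) t = ((‖charFun μ t‖ ^ 2 : ℝ) : ℂ) := by
  have e : ∀ z : ℝ × ℝ, Complex.exp (t * (z.1 - z.2 : ℝ) * Complex.I)
      = Complex.exp (t * z.1 * Complex.I) * Complex.exp ((-t : ℝ) * z.2 * Complex.I) := fun z => by
    rw [← Complex.exp_add]; congr 1; push_cast; ring
  rw [charFun_apply_real, symmLaw, integral_map (by fun_prop)
    (Continuous.aestronglyMeasurable (by fun_prop))]
  simp_rw [e]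
  rw [integral_prod_mul (fun x : ℝ => Complex.exp (t * x * Complex.I))
    (fun x : ℝ => Complex.exp ((-t : ℝ) * x * Complex.I)), ← charFun_apply_real,
    ← charFun_apply_real, charFun_neg, Complex.mul_conj, Complex.normSq_eq_norm_sq]

lemma integrable_cos_mul (t : ℝ) : Integrable (fun x => Real.cos (t * x)) μ :=
  Integrable.of_bound (Continuous.aestronglyMeasurable (by fun_prop)) 1
    (Eventually.of_forall fun x => by rw [Real.norm_eq_abs]; exact Real.abs_cos_le_one _)

lemma re_charFun (t : ℝ) : (charFun μ t).re = ∫ x, Real.cos (t * x) ∂μ := by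
  rw [charFun_apply_real]
  have i : Integrable (fun x : ℝ => Complex.exp (t * x * Complex.I)) μ :=
    Integrable.of_bound (Continuous.aestronglyMeasurable (by fun_prop)) 1
      (Eventually.of_forall fun x => by rw [← Complex.ofReal_mul, Complex.norm_exp_ofReal_mul_I])
  have := integral_re i
  simp only [RCLike.re_to_complex] at this
  rw [← this]
  congr 1; ext x
  rw [← Complex.ofReal_mul, Complex.exp_ofReal_mul_I_re]

lemma one_sub_norm_charFun_sq (t : ℝ) :
    1 - ‖charFun μ t‖ ^ 2 = ∫ z, (1 - Real.cos (t * z)) ∂(symmLaw μ) := by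
  have h := re_charFun (symmLaw μ) t
  rw [charFun_symmLaw, Complex.ofReal_re] at h
  rw [integral_sub (integrable_const _) (integrable_cos_mul _ t), ← h]
  simp

/-- The truncated second moment `E min(1, (X/B)²)`. -/
noncomputable def minSqMoment (μ : Measure ℝ) (B : ℝ) : ℝ := ∫ x, min 1 ((x / B) ^ 2) ∂μ

lemma integrable_min_sq (B : ℝ) : Integrable (fun x : ℝ => min 1 ((x / B) ^ 2)) μ :=
  Integrable.of_bound (Continuous.aestronglyMeasurable (by fun_prop)) 1
    (Eventually.of_forall fun x => by
      rw [Real.norm_of_nonneg (le_min zero_le_one (sq_nonneg _))]; exact min_le_left _ _)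

lemma minSqMoment_nonneg (μ : Measure ℝ) (B : ℝ) : 0 ≤ minSqMoment μ B :=
  integral_nonneg fun _ => le_min zero_le_one (sq_nonneg _)

/-- Averaging over an interval at the origin converts information on |φ| into a truncated second
moment of the symmetrised law. -/
lemma integral_one_sub_norm_charFun_sq (s : ℝ) :
    ∫ h in (0 : ℝ)..1, (1 - ‖charFun μ (h * s)‖ ^ 2) = ∫ z, sincWeight (s * z) ∂(symmLaw μ) := by
  simp_rw [one_sub_norm_charFun_sq, intervalIntegral.integral_of_le zero_le_one]
  rw [integral_integral_swap]
  · congr 1; ext z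
    rw [← intervalIntegral.integral_of_le zero_le_one, ← integral_one_sub_cos]
    simp_rw [mul_assoc]
  · refine Integrable.of_bound (Continuous.aestronglyMeasurable (by fun_prop)) 2
      (Eventually.of_forall fun z => ?_)
    have h1 := Real.cos_le_one (z.1 * s * z.2)
    have h2 := Real.neg_one_le_cos (z.1 * s * z.2)
    rw [Function.uncurry, Real.norm_of_nonneg (by linarith)]; linarith

lemma integrable_sincWeight_comp {f : ℝ → ℝ} (hf : Measurable f) :
    Integrable (fun x => sincWeight (f x)) μ :=
  Integrable.of_bound (continuous_sincWeight.measurable.comp hf).aestronglyMeasurable 2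
    (Eventually.of_forall fun x => by
      rw [Real.norm_of_nonneg (sincWeight_nonneg _)]; exact sincWeight_le_two _)

/-- If |φ|^{2n} ≥ 1/2 > e^{-1}, then y ≤ e^{y-1} with y = |φ|² gives n(1 - |φ|²) ≤ 1. Averaging this
over |t| ≤ δ bounds the mean of the weight; the factor δ^{-2} comes from rescaling. -/
lemma mul_minSqMoment_symmLaw_le {δ B : ℝ} (hδ : 0 < δ) (hδ1 : δ ≤ 1) {n : ℕ}
    (h : ∀ t : ℝ, |t| ≤ δ → 1 / 2 ≤ (‖charFun μ (t / B)‖ ^ 2) ^ n) :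
    n * minSqMoment (symmLaw μ) B ≤ 40 / δ ^ 2 := by
  have h1 : ∀ t : ℝ, |t| ≤ δ → n * (1 - ‖charFun μ (t / B)‖ ^ 2) ≤ 1 := by
    intro t ht
    set y := ‖charFun μ (t / B)‖ ^ 2 with hy
    have h2 : y ^ n ≤ Real.exp (-(n * (1 - y))) := by
      have : y ≤ Real.exp (y - 1) := by linarith [Real.add_one_le_exp (y - 1)]
      calc y ^ n ≤ Real.exp (y - 1) ^ n := pow_le_pow_left₀ (sq_nonneg _) this n
        _ = _ := by rw [← Real.exp_nat_mul]; congr 1; ring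
    have h3 : Real.exp (-1) < 1 / 2 := by
      rw [Real.exp_neg, inv_lt_comm₀ (Real.exp_pos _) (by norm_num)]
      have := Real.exp_one_gt_d9; norm_num; linarith
    have h4 := h3.trans_le ((h t ht).trans h2)
    linarith [Real.exp_lt_exp.1 h4]
  have h2 : n * ∫ z, sincWeight (δ / B * z) ∂(symmLaw μ) ≤ 1 := by
    rw [← integral_one_sub_norm_charFun_sq, ← intervalIntegral.integral_const_mul]
    have hc : Continuous fun h : ℝ => (n : ℝ) * (1 - ‖charFun μ (h * (δ / B))‖ ^ 2) := by
      have := continuous_charFun (μ := μ)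
      fun_prop
    calc _ ≤ ∫ h in (0 : ℝ)..1, (1 : ℝ) := by
          refine intervalIntegral.integral_mono_on zero_le_one (hc.intervalIntegrable _ _)
            (by simp) fun h hh => ?_
          have := h1 (h * δ) (by
            rw [abs_mul, abs_of_nonneg hh.1, abs_of_pos hδ]; nlinarith [hh.2])
          rwa [mul_div_assoc] at this
      _ = 1 := by simp
  have h3 : δ ^ 2 * minSqMoment (symmLaw μ) B ≤ 40 * ∫ z, sincWeight (δ / B * z) ∂(symmLaw μ) := by
    rw [minSqMoment, ← integral_const_mul, ← integral_const_mul]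
    refine integral_mono ((integrable_min_sq _ B).const_mul _)
      ((integrable_sincWeight_comp _ (by fun_prop)).const_mul _) fun z => ?_
    refine le_trans ?_ (min_one_sq_le_sincWeight _)
    rw [show (δ / B * z) ^ 2 = δ ^ 2 * (z / B) ^ 2 by ring]
    have hδ2 : δ ^ 2 ≤ 1 := by nlinarith
    refine le_min ?_ ?_
    · calc _ ≤ 1 * 1 := mul_le_mul hδ2 (min_le_left _ _) (le_min zero_le_one (sq_nonneg _)) zero_le_one
        _ = 1 := one_mul 1
    · simp only; gcongr; exact min_le_right _ _
  rw [le_div_iff₀ (by positivity)]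
  nlinarith [Nat.cast_nonneg (α := ℝ) n]

lemma minSqMoment_symmLaw_pos (hμ : ∀ x : ℝ, μ ≠ Measure.dirac x) : 0 < minSqMoment (symmLaw μ) 1 := by
  refine (minSqMoment_nonneg _ _).lt_of_ne fun h => ?_
  have h1 := (integral_eq_zero_iff_of_nonneg (fun x => le_min zero_le_one (sq_nonneg (x / 1)))
    (integrable_min_sq (symmLaw μ) 1)).1 h.symm
  have h2 : ∀ᵐ z ∂(symmLaw μ), z = 0 := by
    filter_upwards [h1] with z hz
    by_contra h0
    have : 0 < min 1 ((z / 1) ^ 2) := lt_min one_pos (by positivity)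
    exact this.ne' hz
  have h3 : ∀ᵐ z ∂(μ.prod μ), z.1 - z.2 = 0 := ae_of_ae_map (by fun_prop) h2
  obtain ⟨x, hx⟩ := (Measure.ae_ae_of_ae_prod h3).exists
  have : μ = Measure.dirac x := by
    have e : μ.map (fun y => y) = μ.map (fun _ => x) :=
      Measure.map_congr (by filter_upwards [hx] with y hy; linarith)
    rw [Measure.map_id'] at e
    rw [e, Measure.map_const]; simp
  exact hμ x this

lemma min_mul_minSqMoment_le (B : ℝ) :
    min 1 (1 / B ^ 2) * minSqMoment μ 1 ≤ minSqMoment μ B := by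
  rw [minSqMoment, minSqMoment, ← integral_const_mul]
  refine integral_mono ((integrable_min_sq _ 1).const_mul _) (integrable_min_sq _ B) fun z => ?_
  have hp : 0 ≤ 1 / B ^ 2 := by positivity
  refine le_min ?_ ?_
  · calc _ ≤ (1 : ℝ) * 1 := mul_le_mul (min_le_left _ _) (min_le_left _ _)
          (le_min zero_le_one (sq_nonneg _)) zero_le_one
      _ = 1 := one_mul 1
  · calc _ ≤ 1 / B ^ 2 * (z / 1) ^ 2 := mul_le_mul (min_le_right _ _) (min_le_right _ _)
          (le_min zero_le_one (sq_nonneg _)) hp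
      _ = _ := by ring

/-- The truncated second moment of `μ` is controlled by that of the symmetrised law. -/
lemma exists_minSqMoment_le : ∃ K : ℝ, ∀ B : ℝ,
    minSqMoment μ B ≤ 8 * minSqMoment (symmLaw μ) B + K / B ^ 2 := by
  -- The second variable lies in [-K, K] with probability at least 1/2. This costs a factor 2, and
  -- the comparison below a factor 4, whence the 8.
  obtain ⟨K, hK0, hK⟩ : ∃ K : ℝ, 0 < K ∧ 1 / 2 ≤ μ.real {y | |y| ≤ K} := by
    have hmono : Monotone fun k : ℕ => {y : ℝ | |y| ≤ k} := fun a b hab y (hy : |y| ≤ a) =>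
      hy.trans (by exact_mod_cast hab)
    have h1 := tendsto_measure_iUnion_atTop (μ := μ) hmono
    have hU : (⋃ k : ℕ, {y : ℝ | |y| ≤ k}) = Set.univ := by
      ext y; simpa using exists_nat_ge |y|
    rw [hU, measure_univ] at h1
    have h2 := (ENNReal.tendsto_toReal ENNReal.one_ne_top).comp h1
    have h3 := h2.eventually_const_le (u := 1 / 2) (by norm_num)
    obtain ⟨k, hk, hk1⟩ := (h3.and (eventually_gt_atTop 0)).exists
    exact ⟨k, by exact_mod_cast hk1, hk⟩
  refine ⟨4 * K ^ 2, fun B => ?_⟩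
  have hcont : Continuous fun z : ℝ × ℝ => min 1 (((z.1 - z.2) / B) ^ 2) := by fun_prop
  have hint : Integrable (fun z : ℝ × ℝ => min 1 (((z.1 - z.2) / B) ^ 2)) (μ.prod μ) :=
    Integrable.of_bound hcont.aestronglyMeasurable 1 (Eventually.of_forall fun x => by
      rw [Real.norm_of_nonneg (le_min zero_le_one (sq_nonneg _))]; exact min_le_left _ _)
  have e : minSqMoment (symmLaw μ) B = ∫ z : ℝ × ℝ, min 1 (((z.1 - z.2) / B) ^ 2) ∂(μ.prod μ) := by
    rw [minSqMoment, symmLaw, integral_map (by fun_prop)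
      (Continuous.aestronglyMeasurable (by fun_prop))]
  have hmA : MeasurableSet {y : ℝ | |y| ≤ K} := measurableSet_le (by fun_prop) measurable_const
  have i1 : Integrable (fun x : ℝ => min 1 ((x / B) ^ 2) - 4 * K ^ 2 / B ^ 2) μ :=
    (integrable_min_sq μ B).sub (integrable_const _)
  have i2 : Integrable (fun y : ℝ => Set.indicator {y : ℝ | |y| ≤ K} (fun _ => (1 : ℝ)) y) μ :=
    (integrable_const _).indicator hmA
  have i3 : Integrable (fun x : ℝ => max 0 (min 1 ((x / B) ^ 2) - 4 * K ^ 2 / B ^ 2)) μ :=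
    (integrable_zero _ _ _).sup i1
  have key : ∫ z : ℝ × ℝ, (max 0 (min 1 ((z.1 / B) ^ 2) - 4 * K ^ 2 / B ^ 2)) *
      Set.indicator {y : ℝ | |y| ≤ K} (fun _ => (1 : ℝ)) z.2 ∂(μ.prod μ)
        ≤ ∫ z : ℝ × ℝ, 4 * min 1 (((z.1 - z.2) / B) ^ 2) ∂(μ.prod μ) := by
    refine integral_mono (i3.mul_prod i2) (hint.const_mul 4) fun z => ?_
    have hnn : 0 ≤ 4 * min 1 (((z.1 - z.2) / B) ^ 2) := by
      have : 0 ≤ min 1 (((z.1 - z.2) / B) ^ 2) := le_min zero_le_one (sq_nonneg _)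
      positivity
    by_cases hz : z.2 ∈ {y : ℝ | |y| ≤ K}
    · simp only
      rw [Set.indicator_of_mem hz, mul_one]
      have hz : |z.2| ≤ K := hz
      refine max_le hnn ?_
      rcases le_total |z.1| (2 * K) with h | h
      · have : (z.1 / B) ^ 2 ≤ 4 * K ^ 2 / B ^ 2 := by
          rw [div_pow]; gcongr
          rw [← sq_abs]; nlinarith [abs_nonneg z.1]
        linarith [min_le_right 1 ((z.1 / B) ^ 2)]
      -- When |x| ≥ 2K and |y| ≤ K, the difference is at least |x|/2 in modulus.
      · have h5 : |z.1| / 2 ≤ |z.1 - z.2| := by linarith [abs_sub_abs_le_abs_sub z.1 z.2]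
        have h6 : z.1 ^ 2 ≤ 4 * (z.1 - z.2) ^ 2 := by
          rw [← sq_abs z.1, ← sq_abs (z.1 - z.2)]; nlinarith [abs_nonneg z.1]
        have h7 : (z.1 / B) ^ 2 ≤ 4 * ((z.1 - z.2) / B) ^ 2 := by
          rw [div_pow, div_pow, ← mul_div_assoc]; gcongr
        have h8 : 0 ≤ 4 * K ^ 2 / B ^ 2 := by positivity
        have h9 : min 1 ((z.1 / B) ^ 2) ≤ 4 * min 1 (((z.1 - z.2) / B) ^ 2) := by
          rcases min_cases 1 (((z.1 - z.2) / B) ^ 2) with ⟨e, _⟩ | ⟨e, _⟩ <;> rw [e]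
          · linarith [min_le_left 1 ((z.1 / B) ^ 2)]
          · exact (min_le_right _ _).trans h7
        linarith
    · simp only
      rw [Set.indicator_of_notMem hz, mul_zero]; exact hnn
  rw [integral_prod_mul (fun x : ℝ => max 0 (min 1 ((x / B) ^ 2) - 4 * K ^ 2 / B ^ 2))
    (fun y : ℝ => Set.indicator {y : ℝ | |y| ≤ K} (fun _ => (1 : ℝ)) y), integral_const_mul, ← e,
    integral_indicator_const _ hmA, smul_eq_mul, mul_one] at key
  have h1 : minSqMoment μ B - 4 * K ^ 2 / B ^ 2
      ≤ ∫ x, max 0 (min 1 ((x / B) ^ 2) - 4 * K ^ 2 / B ^ 2) ∂μ := by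
    have : minSqMoment μ B - 4 * K ^ 2 / B ^ 2
        = ∫ x, (min 1 ((x / B) ^ 2) - 4 * K ^ 2 / B ^ 2) ∂μ := by
      rw [integral_sub (integrable_min_sq μ B) (integrable_const _)]; simp [minSqMoment]
    rw [this]
    exact integral_mono i1 i3 fun x => le_max_right _ _
  have h2 : 0 ≤ ∫ x, max 0 (min 1 ((x / B) ^ 2) - 4 * K ^ 2 / B ^ 2) ∂μ :=
    integral_nonneg fun x => le_max_left _ _
  nlinarith

end

/-! ### Growth of the norming constants and linearisation of φ^n. -/

section

variable {μ : Measure ℝ} [IsProbabilityMeasure μ] {B b : ℕ → ℝ} {g : ℝ → ℂ}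

/-- Continuous convergence at 0 keeps |φ(t/B_n)|^n above 3/4 on a fixed interval for all large n;
since (3/4)² > 1/2, the symmetrised bound applies. -/
lemma AttractedTo.exists_symm_bound (h : AttractedTo μ B b g) (hg : g 0 = 1) :
    ∃ C : ℝ, ∀ᶠ n in atTop, n * minSqMoment (symmLaw μ) (B n) ≤ C := by
  have h1 := (h.norm_tendsto 0).eventually_const_lt (u := 3 / 4) (by rw [hg, norm_one]; norm_num)
  obtain ⟨pa, ha, pb, hb, hab⟩ := eventually_prod_iff.1 h1
  obtain ⟨δ, hδ, hball⟩ := Metric.eventually_nhds_iff.1 hb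
  set ε := min 1 (δ / 2) with hε
  have hε0 : 0 < ε := lt_min one_pos (by positivity)
  refine ⟨40 / ε ^ 2, ?_⟩
  filter_upwards [ha] with n hn
  refine mul_minSqMoment_symmLaw_le μ hε0 (min_le_left _ _) fun t ht => ?_
  have h2 := hab hn (hball (y := t) (by
    rw [Real.dist_eq, sub_zero]
    have := min_le_right 1 (δ / 2)
    linarith))
  simp only at h2
  rw [← pow_mul, mul_comm 2 n, pow_mul]
  nlinarith

/-- Nondegeneracy makes the moment at scale 1 positive, and it shrinks at most like B^{-2} when the
scale grows. The alternative B_n ≤ 1 would bound n. -/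
lemma AttractedTo.exists_le_mul_sq (h : AttractedTo μ B b g) (hg : g 0 = 1)
    (hB : ∀ᶠ n in atTop, 0 < B n) (hμ : ∀ x : ℝ, μ ≠ Measure.dirac x) :
    ∃ C : ℝ, 0 < C ∧ ∀ᶠ n : ℕ in atTop, (n : ℝ) ≤ C * B n ^ 2 := by
  obtain ⟨C, hC⟩ := h.exists_symm_bound hg
  have hρ := minSqMoment_symmLaw_pos μ hμ
  set ρ := minSqMoment (symmLaw μ) 1
  refine ⟨max 1 (C / ρ), by positivity, ?_⟩
  filter_upwards [hC, hB, eventually_gt_atTop ⌈C / ρ⌉₊] with n hn hBn hlarge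
  have hlarge : C / ρ < n := (Nat.le_ceil _).trans_lt (by exact_mod_cast hlarge)
  have h1 := min_mul_minSqMoment_le (symmLaw μ) (B n)
  have hn0 : (0 : ℝ) ≤ n := Nat.cast_nonneg n
  have h2 : n * (min 1 (1 / B n ^ 2) * ρ) ≤ C := (mul_le_mul_of_nonneg_left h1 hn0).trans hn
  rw [div_lt_iff₀ hρ] at hlarge
  have hB2 : 0 < B n ^ 2 := by positivity
  rcases min_cases 1 (1 / B n ^ 2) with ⟨e, _⟩ | ⟨e, _⟩ <;> rw [e] at h2
  · linarith
  · have : (n : ℝ) ≤ C / ρ * B n ^ 2 := by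
      rw [div_mul_eq_mul_div, le_div_iff₀ hρ]
      have : n * (1 / B n ^ 2 * ρ) * B n ^ 2 = n * ρ := by field_simp
      nlinarith
    exact this.trans (by gcongr; exact le_max_right _ _)

lemma tendsto_atTop_of_le_mul_sq {C : ℝ} (hC : 0 < C)
    (h : ∀ᶠ n : ℕ in atTop, (n : ℝ) ≤ C * B n ^ 2) (hB : ∀ᶠ n in atTop, 0 < B n) :
    Tendsto B atTop atTop := by
  have h1 : Tendsto (fun n : ℕ => Real.sqrt ((n : ℝ) / C)) atTop atTop :=
    Real.tendsto_sqrt_atTop.comp (tendsto_natCast_atTop_atTop.atTop_div_const hC)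
  refine tendsto_atTop_mono' _ ?_ h1
  filter_upwards [h, hB] with n hn hBn
  rw [Real.sqrt_le_left hBn.le, div_le_iff₀ hC]; linarith

lemma AttractedTo.exists_minSqMoment_bound (h : AttractedTo μ B b g) (hg : g 0 = 1)
    (hB : ∀ᶠ n in atTop, 0 < B n) (hμ : ∀ x : ℝ, μ ≠ Measure.dirac x) :
    ∃ C : ℝ, 0 < C ∧ ∀ᶠ n in atTop, n * minSqMoment μ (B n) ≤ C := by
  obtain ⟨C, hC⟩ := h.exists_symm_bound hg
  obtain ⟨D, hD, hnB⟩ := h.exists_le_mul_sq hg hB hμ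
  obtain ⟨K, hK⟩ := exists_minSqMoment_le μ
  refine ⟨max 1 (8 * C + |K| * D), by positivity, ?_⟩
  filter_upwards [hC, hnB, hB] with n h1 h2 h3
  refine le_trans ?_ (le_max_right _ _)
  have hn0 : (0 : ℝ) ≤ n := Nat.cast_nonneg n
  have hB2 : 0 < B n ^ 2 := by positivity
  have h4 := mul_le_mul_of_nonneg_left (hK (B n)) hn0
  have h5 : n * (K / B n ^ 2) ≤ |K| * D := by
    have h6 : (n : ℝ) / B n ^ 2 ≤ D := by rwa [div_le_iff₀ hB2]
    calc n * (K / B n ^ 2) = K * (n / B n ^ 2) := by ring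
      _ ≤ |K| * (n / B n ^ 2) := by gcongr; exact le_abs_self K
      _ ≤ |K| * D := by gcongr
  nlinarith

lemma exists_setIntegral_sq_ge (hμ : ¬ Integrable (fun x : ℝ => x ^ 2) μ) (D : ℝ) :
    ∃ R : ℕ, D ≤ ∫ x in Set.Icc (-(R : ℝ)) R, x ^ 2 ∂μ := by
  by_contra! hcon
  apply hμ
  have hc : AECover μ atTop fun R : ℕ => Set.Icc (-(R : ℝ)) R :=
    aecover_Icc (tendsto_neg_atTop_atBot.comp tendsto_natCast_atTop_atTop)
      tendsto_natCast_atTop_atTop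
  refine hc.integrable_of_integral_bounded_of_nonneg_ae D (fun R => ?_)
    (Eventually.of_forall fun x => sq_nonneg x) (Eventually.of_forall fun R => (hcon R).le)
  exact (by fun_prop : Continuous fun x : ℝ => x ^ 2).continuousOn.integrableOn_compact isCompact_Icc

/-- Once B_n ≥ R, the bounded quantity n E min(1, (X/B_n)²) dominates n B_n^{-2} times the second
moment over [-R, R], and the latter can be made arbitrarily large. -/
lemma AttractedTo.tendsto_div_sq_of_not_integrable (h : AttractedTo μ B b g) (hg : g 0 = 1)
    (hB : ∀ᶠ n in atTop, 0 < B n) (hμ : ∀ x : ℝ, μ ≠ Measure.dirac x)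
    (hint : ¬ Integrable (fun x : ℝ => x ^ 2) μ) :
    Tendsto (fun n : ℕ => (n : ℝ) / B n ^ 2) atTop (𝓝 0) := by
  obtain ⟨C, hC0, hC⟩ := h.exists_minSqMoment_bound hg hB hμ
  obtain ⟨D, hD, hnB⟩ := h.exists_le_mul_sq hg hB hμ
  have hBt := tendsto_atTop_of_le_mul_sq hD hnB hB
  rw [Metric.tendsto_nhds]
  intro ε hε
  obtain ⟨R, hR⟩ := exists_setIntegral_sq_ge hint (2 * C / ε)
  filter_upwards [hC, hB, hBt.eventually_ge_atTop (R : ℝ)] with n h1 h2 h3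
  have hB2 : 0 < B n ^ 2 := by positivity
  have hn0 : (0 : ℝ) ≤ n := Nat.cast_nonneg n
  rw [Real.dist_eq, sub_zero, abs_of_nonneg (by positivity)]
  have key : (∫ x in Set.Icc (-(R : ℝ)) R, x ^ 2 ∂μ) / B n ^ 2 ≤ minSqMoment μ (B n) := by
    rw [← integral_div, minSqMoment, ← integral_indicator measurableSet_Icc]
    refine integral_mono_of_nonneg (Eventually.of_forall fun x => ?_) (integrable_min_sq μ _)
      (Eventually.of_forall fun x => ?_)
    · exact Set.indicator_nonneg (fun y _ => by positivity) x
    · by_cases hx : x ∈ Set.Icc (-(R : ℝ)) R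
      · simp only [Set.indicator_of_mem hx]
        rw [← div_pow]
        refine le_min ?_ le_rfl
        rw [sq_le_one_iff_abs_le_one, abs_div, abs_of_pos h2, div_le_one h2]
        exact (abs_le.2 hx).trans h3
      · simp only [Set.indicator_of_notMem hx]
        exact le_min zero_le_one (sq_nonneg _)
  have h4 : 2 * C / ε / B n ^ 2 ≤ minSqMoment μ (B n) :=
    (div_le_div_of_nonneg_right hR hB2.le).trans key
  have h5 : n * (2 * C / ε / B n ^ 2) ≤ C := (mul_le_mul_of_nonneg_left h4 hn0).trans h1
  have h6 : n * (2 * C / ε / B n ^ 2) = (n / B n ^ 2) * (2 * C / ε) := by ring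
  rw [h6, ← le_div_iff₀ (by positivity)] at h5
  refine h5.trans_lt ?_
  rw [div_div_eq_mul_div, div_lt_iff₀ (by positivity)]
  nlinarith [mul_pos hC0 hε]

/-- Cauchy–Schwarz, from the discriminant of the nonnegative quadratic s ↦ ∫ (f - s 1_A)², enlarged
by replacing f 1_A with f in its constant term. -/
lemma sq_setIntegral_le {A : Set ℝ} (hA : MeasurableSet A) {f : ℝ → ℝ} (hf : Integrable f μ)
    (hf2 : Integrable (fun x => f x ^ 2) μ) :
    (∫ x in A, f x ∂μ) ^ 2 ≤ μ.real A * ∫ x, f x ^ 2 ∂μ := by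
  have hq : ∀ s : ℝ, 0 ≤ μ.real A * (s * s) + (-2 * ∫ x in A, f x ∂μ) * s + ∫ x, f x ^ 2 ∂μ := by
    intro s
    have i1 : Integrable (fun x => A.indicator f x) μ := hf.indicator hA
    have i2 : Integrable (fun x => A.indicator (fun _ => (1 : ℝ)) x) μ :=
      (integrable_const _).indicator hA
    have e : ∫ x, (f x ^ 2 - 2 * s * A.indicator f x + s * s * A.indicator (fun _ => (1 : ℝ)) x) ∂μ
        = μ.real A * (s * s) + (-2 * ∫ x in A, f x ∂μ) * s + ∫ x, f x ^ 2 ∂μ := by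
      rw [integral_add (f := fun x => f x ^ 2 - 2 * s * A.indicator f x) (hf2.sub (i1.const_mul _))
          (i2.const_mul _),
        integral_sub hf2 (i1.const_mul _), integral_const_mul, integral_const_mul,
        integral_indicator hA, integral_indicator_const _ hA]
      simp; ring
    rw [← e]
    refine integral_nonneg fun x => ?_
    by_cases hx : x ∈ A
    · simp only [Set.indicator_of_mem hx, Pi.zero_apply]
      nlinarith [sq_nonneg (f x - s)]
    · simp only [Set.indicator_of_notMem hx, Pi.zero_apply]
      nlinarith [sq_nonneg (f x)]
  have := discrim_le_zero hq
  unfold discrim at this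
  nlinarith

lemma norm_exp_sub_one_sq_le (t x : ℝ) :
    ‖Complex.exp (t * x * Complex.I) - 1‖ ^ 2 ≤ (4 + t ^ 2) * min 1 (x ^ 2) := by
  have h1 : ‖Complex.exp (t * x * Complex.I) - 1‖ ≤ |t * x| := by
    rw [← Complex.ofReal_mul, mul_comm]
    simpa using Real.norm_exp_I_mul_ofReal_sub_one_le (x := t * x)
  have h2 : ‖Complex.exp (t * x * Complex.I) - 1‖ ≤ 2 := by
    refine (norm_sub_le _ _).trans ?_
    rw [← Complex.ofReal_mul, Complex.norm_exp_ofReal_mul_I, norm_one]; norm_num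
  have h0 := norm_nonneg (Complex.exp (t * x * Complex.I) - 1)
  rcases min_cases 1 (x ^ 2) with ⟨e, _⟩ | ⟨e, _⟩ <;> rw [e]
  · nlinarith [sq_nonneg t]
  · have : ‖Complex.exp (t * x * Complex.I) - 1‖ ^ 2 ≤ (t * x) ^ 2 := by
      rw [← sq_abs (t * x)]; exact pow_le_pow_left₀ h0 h1 2
    nlinarith [sq_nonneg x]

lemma norm_exp_sub_one_le_abs (t x : ℝ) : ‖Complex.exp (t * x * Complex.I) - 1‖ ≤ |t * x| := by
  rw [← Complex.ofReal_mul, mul_comm]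
  simpa using Real.norm_exp_I_mul_ofReal_sub_one_le (x := t * x)

lemma integrable_exp_mul_I (μ : Measure ℝ) [IsProbabilityMeasure μ] (t : ℝ) :
    Integrable (fun x : ℝ => Complex.exp (t * x * Complex.I)) μ :=
  Integrable.of_bound (Continuous.aestronglyMeasurable (by fun_prop)) 1
    (Eventually.of_forall fun x => by rw [← Complex.ofReal_mul, Complex.norm_exp_ofReal_mul_I])

lemma norm_charFun_sub_one_le (s : ℝ) :
    ‖charFun μ s - 1‖ ≤ ∫ x, ‖Complex.exp (s * x * Complex.I) - 1‖ ∂μ := by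
  have : charFun μ s - 1 = ∫ x, (Complex.exp (s * x * Complex.I) - 1) ∂μ := by
    rw [integral_sub (integrable_exp_mul_I μ s) (integrable_const _), charFun_apply_real]; simp
  rw [this]
  exact norm_integral_le_integral_norm _

/-- On |x| ≤ R the integrand is at most R|t|/B. On the complement, Cauchy–Schwarz brings out the
tail probability as a factor, which makes the second term small after multiplication by n. -/
lemma norm_charFun_div_sub_one_sq_le {t R B : ℝ} (hB : 0 < B) (hR : 0 ≤ R) :
    ‖charFun μ (t / B) - 1‖ ^ 2 ≤ 2 * (R * |t|) ^ 2 / B ^ 2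
      + 2 * (4 + t ^ 2) * μ.real {x | R < |x|} * minSqMoment μ B := by
  have hA : MeasurableSet {x : ℝ | R < |x|} := measurableSet_lt measurable_const (by fun_prop)
  set f : ℝ → ℝ := fun x => ‖Complex.exp ((t / B : ℝ) * x * Complex.I) - 1‖ with hf
  have hfc : Continuous f := by fun_prop
  have e : ∀ x : ℝ, ((t / B : ℝ) : ℂ) * x * Complex.I = t * (x / B : ℝ) * Complex.I := fun x => by
    push_cast; ring
  have hf2 : ∀ x, f x ≤ 2 := fun x => by
    refine (norm_sub_le _ _).trans ?_
    rw [← Complex.ofReal_mul, Complex.norm_exp_ofReal_mul_I, norm_one]; norm_num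
  have hf0 : ∀ x, 0 ≤ f x := fun x => norm_nonneg _
  have i1 : Integrable f μ := Integrable.of_bound hfc.aestronglyMeasurable 2
    (Eventually.of_forall fun x => by rw [Real.norm_of_nonneg (hf0 x)]; exact hf2 x)
  have i2 : Integrable (fun x => f x ^ 2) μ :=
    Integrable.of_bound (by fun_prop : Continuous fun x => f x ^ 2).aestronglyMeasurable 4
      (Eventually.of_forall fun x => by
        rw [Real.norm_of_nonneg (sq_nonneg _)]; nlinarith [hf0 x, hf2 x])
  have h1 := sq_setIntegral_le hA i1 i2
  have h2 : ∫ x, f x ^ 2 ∂μ ≤ (4 + t ^ 2) * minSqMoment μ B := by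
    rw [minSqMoment, ← integral_const_mul]
    refine integral_mono i2 ((integrable_min_sq μ B).const_mul _) fun x => ?_
    simp only [hf, e]
    exact norm_exp_sub_one_sq_le t (x / B)
  have h3 : ∫ x in {x : ℝ | R < |x|}ᶜ, f x ∂μ ≤ R * |t| / B := by
    have hb : ∀ x ∈ {x : ℝ | R < |x|}ᶜ, ‖f x‖ ≤ R * |t| / B := by
      intro x hx
      have hx : |x| ≤ R := not_lt.1 hx
      rw [Real.norm_of_nonneg (hf0 x)]
      refine (norm_exp_sub_one_le_abs _ x).trans ?_
      rw [abs_mul, abs_div, abs_of_pos hB, div_mul_eq_mul_div, mul_comm]; gcongr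
    have := norm_setIntegral_le_of_norm_le_const (measure_lt_top μ ({x : ℝ | R < |x|}ᶜ)) hb
    refine (le_abs_self _).trans (this.trans ?_)
    have hp : 0 ≤ R * |t| / B := by positivity
    exact mul_le_of_le_one_right hp measureReal_le_one
  have h4 := norm_charFun_sub_one_le (μ := μ) (t / B)
  rw [← integral_add_compl hA i1] at h4
  have h5 : 0 ≤ ∫ x in {x : ℝ | R < |x|}, f x ∂μ := integral_nonneg hf0
  have h6 : 0 ≤ ∫ x in {x : ℝ | R < |x|}ᶜ, f x ∂μ := integral_nonneg hf0
  have h7 : (∫ x in {x : ℝ | R < |x|}, f x ∂μ) ^ 2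
      ≤ μ.real {x : ℝ | R < |x|} * ((4 + t ^ 2) * minSqMoment μ B) :=
    h1.trans (by gcongr)
  have h8 : (∫ x in {x : ℝ | R < |x|}ᶜ, f x ∂μ) ^ 2 ≤ (R * |t|) ^ 2 / B ^ 2 := by
    rw [← div_pow]; exact pow_le_pow_left₀ h6 h3 2
  have h9 : ‖charFun μ (t / B) - 1‖ ^ 2 ≤ (∫ x in {x : ℝ | R < |x|}, f x ∂μ
      + ∫ x in {x : ℝ | R < |x|}ᶜ, f x ∂μ) ^ 2 := pow_le_pow_left₀ (norm_nonneg _) h4 2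
  have h10 : 2 * (R * |t|) ^ 2 / B ^ 2 = 2 * ((R * |t|) ^ 2 / B ^ 2) := by ring
  rw [h10]
  nlinarith [sq_nonneg (∫ x in {x : ℝ | R < |x|}, f x ∂μ - ∫ x in {x : ℝ | R < |x|}ᶜ, f x ∂μ)]

lemma tendsto_measureReal_abs_gt (μ : Measure ℝ) [IsProbabilityMeasure μ] :
    Tendsto (fun R : ℕ => μ.real {x | (R : ℝ) < |x|}) atTop (𝓝 0) := by
  have h1 := tendsto_measure_iInter_atTop (μ := μ) (s := fun R : ℕ => {x : ℝ | (R : ℝ) < |x|})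
    (fun R => (measurableSet_lt measurable_const (by fun_prop)).nullMeasurableSet)
    (fun a b hab x (hx : (b : ℝ) < |x|) => lt_of_le_of_lt (by exact_mod_cast hab) hx)
    ⟨0, measure_ne_top _ _⟩
  have hI : (⋂ R : ℕ, {x : ℝ | (R : ℝ) < |x|}) = ∅ := by
    ext x
    simpa using exists_nat_ge |x|
  rw [hI, measure_empty] at h1
  exact (ENNReal.tendsto_toReal ENNReal.zero_ne_top).comp h1

/-- `n |φ(t / B_n) - 1|²` tends to zero if the second moment is infinite, or if it is finite and
the mean vanishes. -/
lemma AttractedTo.tendsto_mul_norm_sub_one_sq (h : AttractedTo μ B b g) (hg : g 0 = 1)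
    (hB : ∀ᶠ n in atTop, 0 < B n) (hμ : ∀ x : ℝ, μ ≠ Measure.dirac x)
    (hint : Integrable (fun x : ℝ => x ^ 2) μ → ∫ x, x ∂μ = 0) (t : ℝ) :
    Tendsto (fun n : ℕ => n * ‖charFun μ (t / B n) - 1‖ ^ 2) atTop (𝓝 0) := by
  obtain ⟨C, hC0, hC⟩ := h.exists_minSqMoment_bound hg hB hμ
  obtain ⟨D, hD, hnB⟩ := h.exists_le_mul_sq hg hB hμ
  by_cases hi : Integrable (fun x : ℝ => x ^ 2) μ
  · have hmean := hint hi
    have hBt := tendsto_atTop_of_le_mul_sq hD hnB hB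
    have i1 : Integrable (fun x : ℝ => x) μ := by
      refine (hi.add (integrable_const (1 : ℝ))).mono' (by fun_prop) (Eventually.of_forall fun x => ?_)
      simp only [Pi.add_apply, Real.norm_eq_abs]
      rw [← sq_abs]; nlinarith [sq_nonneg (|x| - 1)]
    set V := ∫ x, x ^ 2 ∂μ with hV
    have hbound : ∀ s : ℝ, ‖charFun μ s - 1‖ ≤ 3 * s ^ 2 * V := by
      intro s
      have i3 : Integrable (fun x : ℝ => ((s * x : ℝ) : ℂ) * Complex.I) μ :=
        ((i1.const_mul s).ofReal).mul_const _
      have e : charFun μ s - 1 = ∫ x, (Complex.exp ((s * x : ℝ) * Complex.I) - 1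
          - (s * x : ℝ) * Complex.I) ∂μ := by
        have e1 : ∀ x : ℝ, Complex.exp ((s * x : ℝ) * Complex.I) = Complex.exp (s * x * Complex.I) :=
          fun x => by push_cast; rfl
        simp_rw [e1]
        rw [integral_sub (f := fun x : ℝ => Complex.exp (s * x * Complex.I) - 1)
          ((integrable_exp_mul_I μ s).sub (integrable_const _)) i3,
          integral_sub (integrable_exp_mul_I μ s) (integrable_const _), integral_mul_const,
          integral_complex_ofReal, integral_const_mul, hmean, charFun_apply_real]
        simp
      rw [e, hV, ← integral_const_mul]
      refine norm_integral_le_of_norm_le (hi.const_mul _) (Eventually.of_forall fun x => ?_)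
      refine (norm_exp_sub_one_sub_le (s * x)).trans (le_of_eq (by ring))
    have h0 : Tendsto (fun n => 9 * t ^ 4 * V ^ 2 * D * (1 / B n) ^ 2) atTop (𝓝 0) := by
      have := ((tendsto_const_nhds (x := (1 : ℝ))).div_atTop hBt).pow 2
      simpa using this.const_mul (9 * t ^ 4 * V ^ 2 * D)
    refine squeeze_zero' (Eventually.of_forall fun n => by positivity) ?_ h0
    filter_upwards [hnB, hB] with n h1 h2
    have h3 := pow_le_pow_left₀ (norm_nonneg _) (hbound (t / B n)) 2
    have hn0 : (0 : ℝ) ≤ n := Nat.cast_nonneg n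
    calc (n : ℝ) * ‖charFun μ (t / B n) - 1‖ ^ 2 ≤ (D * B n ^ 2) * (3 * (t / B n) ^ 2 * V) ^ 2 := by
          gcongr
      _ = _ := by field_simp; ring
  · have hdiv := h.tendsto_div_sq_of_not_integrable hg hB hμ hi
    rw [Metric.tendsto_nhds]
    intro ε hε
    have h1 : Tendsto (fun R : ℕ => 2 * (4 + t ^ 2) * C * μ.real {x | (R : ℝ) < |x|}) atTop (𝓝 0) := by
      simpa using (tendsto_measureReal_abs_gt μ).const_mul (2 * (4 + t ^ 2) * C)
    obtain ⟨R, hR⟩ := (h1.eventually_lt_const (half_pos hε)).exists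
    have h2 : Tendsto (fun n : ℕ => 2 * (R * |t|) ^ 2 * ((n : ℝ) / B n ^ 2)) atTop (𝓝 0) := by
      simpa using hdiv.const_mul (2 * (R * |t|) ^ 2)
    filter_upwards [h2.eventually_lt_const (half_pos hε), hC, hB] with n h3 h4 h5
    have hn0 : (0 : ℝ) ≤ n := Nat.cast_nonneg n
    rw [Real.dist_eq, sub_zero, abs_of_nonneg (by positivity)]
    have h6 := mul_le_mul_of_nonneg_left
      (norm_charFun_div_sub_one_sq_le (μ := μ) (t := t) h5 (Nat.cast_nonneg R)) hn0
    have h7 : 2 * (4 + t ^ 2) * μ.real {x | (R : ℝ) < |x|} * (n * minSqMoment μ (B n))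
        ≤ 2 * (4 + t ^ 2) * μ.real {x | (R : ℝ) < |x|} * C := by gcongr
    calc _ ≤ _ := h6
      _ = 2 * (R * |t|) ^ 2 * ((n : ℝ) / B n ^ 2)
          + 2 * (4 + t ^ 2) * μ.real {x | (R : ℝ) < |x|} * (n * minSqMoment μ (B n)) := by ring
      _ < ε := by linarith

/-- Both z and e^{z-1} lie in the unit disc and differ by at most |z-1|²; the n-th powers are
compared by exchanging one factor at a time. -/
lemma norm_pow_sub_exp_le {z : ℂ} (hz : ‖z‖ ≤ 1) (h1 : ‖z - 1‖ ≤ 1) (n : ℕ) :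
    ‖z ^ n - Complex.exp (n * (z - 1))‖ ≤ n * ‖z - 1‖ ^ 2 := by
  have hw : ‖Complex.exp (z - 1)‖ ≤ 1 := by
    apply Complex.norm_exp_le_one_of_re_nonpos
    have := (Complex.re_le_norm z).trans hz
    simpa using this
  have hstep : ‖z - Complex.exp (z - 1)‖ ≤ ‖z - 1‖ ^ 2 := by
    have := Complex.norm_exp_sub_one_sub_id_le h1
    rw [norm_sub_rev]
    rwa [show Complex.exp (z - 1) - z = Complex.exp (z - 1) - 1 - (z - 1) by ring]
  rw [Complex.exp_nat_mul]
  set w := Complex.exp (z - 1)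
  induction n with
  | zero => simp
  | succ n ih =>
    have e : z ^ (n + 1) - w ^ (n + 1) = z ^ n * (z - w) + (z ^ n - w ^ n) * w := by ring
    rw [e]
    refine (norm_add_le _ _).trans ?_
    rw [norm_mul, norm_mul, norm_pow]
    have h2 : ‖z‖ ^ n ≤ 1 := pow_le_one₀ (norm_nonneg _) hz
    have h3 : ‖z‖ ^ n * ‖z - w‖ ≤ 1 * ‖z - 1‖ ^ 2 := by gcongr
    have h4 : ‖z ^ n - w ^ n‖ * ‖w‖ ≤ (n * ‖z - 1‖ ^ 2) * 1 := by gcongr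
    push_cast
    linarith

lemma AttractedTo.tendsto_pow_sub_exp (h : AttractedTo μ B b g) (hg : g 0 = 1)
    (hB : ∀ᶠ n in atTop, 0 < B n) (hμ : ∀ x : ℝ, μ ≠ Measure.dirac x)
    (hint : Integrable (fun x : ℝ => x ^ 2) μ → ∫ x, x ∂μ = 0) (t : ℝ) :
    Tendsto (fun n : ℕ => charFun μ (t / B n) ^ n - Complex.exp (n * (charFun μ (t / B n) - 1)))
      atTop (𝓝 0) := by
  have h1 := h.tendsto_mul_norm_sub_one_sq hg hB hμ hint t
  rw [tendsto_zero_iff_norm_tendsto_zero]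
  refine squeeze_zero' (Eventually.of_forall fun n => norm_nonneg _) ?_ h1
  filter_upwards [h1.eventually_le_const zero_lt_one, eventually_ge_atTop 1] with n hn hn1
  refine norm_pow_sub_exp_le (norm_charFun_le_one _) ?_ n
  have : (1 : ℝ) ≤ n := by exact_mod_cast hn1
  nlinarith [norm_nonneg (charFun μ (t / B n) - 1), sq_nonneg ‖charFun μ (t / B n) - 1‖]

lemma AttractedTo.tendsto_exp (h : AttractedTo μ B b g) (hg : g 0 = 1)
    (hB : ∀ᶠ n in atTop, 0 < B n) (hμ : ∀ x : ℝ, μ ≠ Measure.dirac x)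
    (hint : Integrable (fun x : ℝ => x ^ 2) μ → ∫ x, x ∂μ = 0) (t : ℝ) :
    Tendsto (fun n : ℕ => Complex.exp (n * (charFun μ (t / B n) - 1) - t * b n * Complex.I))
      atTop (𝓝 (g t)) := by
  have h1 := h.pointwise t
  have h2 := h.tendsto_pow_sub_exp hg hB hμ hint t
  have h3 : Tendsto (fun n : ℕ => (charFun μ (t / B n) ^ n
      - Complex.exp (n * (charFun μ (t / B n) - 1))) * Complex.exp (-(t * b n * Complex.I)))
      atTop (𝓝 0) := by
    rw [tendsto_zero_iff_norm_tendsto_zero] at h2 ⊢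
    refine h2.congr fun n => ?_
    rw [norm_mul, show -((t : ℂ) * b n * Complex.I) = ((-(t * b n) : ℝ) : ℂ) * Complex.I
      by push_cast; ring, Complex.norm_exp_ofReal_mul_I, mul_one]
  have h4 := h1.sub h3
  rw [sub_zero] at h4
  refine h4.congr fun n => ?_
  rw [sub_eq_add_neg (_ * _) (_ * Complex.I), Complex.exp_add]
  ring

/-- A law in the domain of attraction of a stable law of index less than two has infinite
variance. -/
lemma AttractedTo.not_integrable_sq (h : AttractedTo μ B b g) (hg : g 0 = 1)
    (hB : ∀ᶠ n in atTop, 0 < B n) (hμ : ∀ x : ℝ, μ ≠ Measure.dirac x) {α c : ℝ} (hc : 0 < c)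
    (h0 : 0 < α) (hα : α < 2) (hnorm : ∀ t : ℝ, 0 < t → ‖g t‖ = Real.exp (-(c * t ^ α))) :
    ¬ Integrable (fun x : ℝ => x ^ 2) μ := by
  intro hi
  obtain ⟨D, hD, hnB⟩ := h.exists_le_mul_sq hg hB hμ
  set V := ∫ z, z ^ 2 ∂(symmLaw μ) with hV
  have hiν : Integrable (fun z : ℝ => z ^ 2) (symmLaw μ) := by
    rw [symmLaw, integrable_map_measure (by fun_prop) (by fun_prop)]
    have i1 : Integrable (fun z : ℝ × ℝ => z.1 ^ 2) (μ.prod μ) := hi.comp_fst μ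
    have i2 : Integrable (fun z : ℝ × ℝ => z.2 ^ 2) (μ.prod μ) := hi.comp_snd μ
    refine ((i1.const_mul 2).add (i2.const_mul 2)).mono' (by fun_prop) (Eventually.of_forall fun z => ?_)
    simp only [Function.comp_apply, Pi.add_apply]
    rw [Real.norm_of_nonneg (sq_nonneg _)]
    nlinarith [sq_nonneg (z.1 + z.2)]
  have hφ : ∀ s : ℝ, 1 - ‖charFun μ s‖ ^ 2 ≤ s ^ 2 * V := by
    intro s
    rw [one_sub_norm_charFun_sq, hV, ← integral_const_mul]
    refine integral_mono ((integrable_const _).sub (integrable_cos_mul _ s)) (hiν.const_mul _) fun z => ?_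
    have := Real.one_sub_sq_div_two_le_cos (x := s * z)
    simp only
    nlinarith [sq_nonneg (s * z)]
  have hV0 : 0 ≤ V := integral_nonneg fun z => sq_nonneg z
  have key : ∀ t : ℝ, 0 < t → 1 - D * V * t ^ 2 ≤ Real.exp (-(c * t ^ α)) ^ 2 := by
    intro t ht
    rw [← hnorm t ht]
    refine ge_of_tendsto ((h.norm_comp tendsto_id (tendsto_const_nhds (x := t))).pow 2) ?_
    filter_upwards [hnB, hB] with n h1 h2
    -- With finite variance, Bernoulli's inequality and n ≤ D B_n² force |g(t)|² ≥ 1 - D V t², which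
    -- is too flat at 0 for a stable law of index below 2.
    have h3 := one_add_mul_le_pow (a := ‖charFun μ (t / B n)‖ ^ 2 - 1)
      (by linarith [sq_nonneg ‖charFun μ (t / B n)‖]) n
    simp only [id]
    rw [← pow_mul, mul_comm n 2, pow_mul]
    rw [show 1 + (‖charFun μ (t / B n)‖ ^ 2 - 1) = ‖charFun μ (t / B n)‖ ^ 2 by ring] at h3
    have hn0 : (0 : ℝ) ≤ n := Nat.cast_nonneg n
    have h4 := mul_le_mul_of_nonneg_left (hφ (t / B n)) hn0
    have h5 : n * ((t / B n) ^ 2 * V) ≤ (D * B n ^ 2) * ((t / B n) ^ 2 * V) := by gcongr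
    have h6 : (D * B n ^ 2) * ((t / B n) ^ 2 * V) = D * V * t ^ 2 := by field_simp
    linarith
  have hlim : Tendsto (fun t : ℝ => t ^ (2 - α) * (D * V)) (𝓝[>] 0) (𝓝 0) := by
    have h1 := ((Real.continuousAt_rpow_const 0 (2 - α) (Or.inr (by linarith))).tendsto).mono_left
        (nhdsWithin_le_nhds (s := Set.Ioi 0))
    rw [Real.zero_rpow (by linarith)] at h1
    simpa using h1.mul_const (D * V)
  have hlim2 : Tendsto (fun t : ℝ => c * t ^ α) (𝓝[>] 0) (𝓝 0) := by
    have h1 := ((Real.continuousAt_rpow_const 0 α (Or.inr h0.le)).tendsto).mono_left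
        (nhdsWithin_le_nhds (s := Set.Ioi 0))
    rw [Real.zero_rpow h0.ne'] at h1
    simpa using h1.const_mul c
  -- For small t the term D V t² is below half of u = c t^α, while u < 1 gives e^{-2u} ≤ 1 - u/2: a
  -- contradiction.
  obtain ⟨t, ⟨h1, h2⟩, ht⟩ := ((hlim.eventually_lt_const (show (0 : ℝ) < c / 2 by positivity)).and
    (hlim2.eventually_lt_const one_pos)).and self_mem_nhdsWithin |>.exists
  have ht : 0 < t := ht
  have h3 := key t ht
  have hu : 0 < c * t ^ α := by positivity
  set u := c * t ^ α
  have h4 : Real.exp (-u) ≤ 1 / (1 + u) := by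
    rw [Real.exp_neg, ← one_div]
    exact one_div_le_one_div_of_le (by positivity) (by linarith [Real.add_one_le_exp u])
  have h5 : Real.exp (-u) ^ 2 ≤ 1 - u / 2 := by
    have : Real.exp (-u) ≤ 1 := Real.exp_le_one_iff.2 (by linarith)
    have h6 : Real.exp (-u) ^ 2 ≤ Real.exp (-u) := by nlinarith [Real.exp_pos (-u)]
    refine h6.trans (h4.trans ?_)
    rw [div_le_iff₀ (by positivity)]; nlinarith
  have h6 : t ^ 2 = t ^ α * t ^ (2 - α) := by
    rw [← Real.rpow_add ht]; norm_num
  have hta : 0 < t ^ α := by positivity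
  have : D * V * t ^ 2 < u / 2 := by
    rw [h6]; simp only [u]; nlinarith
  linarith

end

/-! ### Real part and scaling of stable exponents. -/

/-- The constant is positive on both sides of α = 1 because cos(πα/2) and α - 1 have opposite signs
throughout; at α = 1 it is π/2. -/
lemma exists_re_stableExponent {α : ℝ} (h0 : 0 < α) (h2 : α ≤ 2) :
    ∃ k : ℝ, 0 < k ∧ ∀ c p q t : ℝ, (stableExponent α c p q t).re = -(k * c * |t| ^ α) := by
  by_cases h1 : α = 1
  · refine ⟨Real.pi / 2, by positivity, fun c p q t => ?_⟩
    rw [stableExponent, if_pos h1, Complex.neg_re, Complex.re_ofReal_mul, Complex.add_re,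
      Complex.re_mul_ofReal, h1, Real.rpow_one, Complex.ofReal_re, Complex.I_re]
    ring
  · refine ⟨-(Real.Gamma (3 - α) / (α * (α - 1)) * Real.cos (Real.pi * α / 2)), ?_, fun c p q t => ?_⟩
    · have hG : 0 < Real.Gamma (3 - α) := Real.Gamma_pos_of_pos (by linarith)
      rcases lt_or_gt_of_ne h1 with h | h
      · have hc : 0 < Real.cos (Real.pi * α / 2) := Real.cos_pos_of_mem_Ioo
          ⟨by nlinarith [Real.pi_pos], by nlinarith [Real.pi_pos]⟩
        have : Real.Gamma (3 - α) / (α * (α - 1)) < 0 := div_neg_of_pos_of_neg hG (by nlinarith)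
        nlinarith
      · have hc : Real.cos (Real.pi * α / 2) < 0 := Real.cos_neg_of_pi_div_two_lt_of_lt
          (by nlinarith [Real.pi_pos]) (by nlinarith [Real.pi_pos])
        have : 0 < Real.Gamma (3 - α) / (α * (α - 1)) := div_pos hG (by nlinarith)
        nlinarith
    · rw [stableExponent, if_neg h1, Complex.re_ofReal_mul, Complex.add_re, Complex.re_mul_ofReal,
        Complex.ofReal_re, Complex.I_re]
      ring

lemma stableExponent_mul_scale (α a c p q t : ℝ) :
    stableExponent α (a * c) p q t = a * stableExponent α c p q t := by
  unfold stableExponent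
  split_ifs <;> push_cast <;> ring

lemma stableExponent_mul_of_ne_one {α : ℝ} (hα : α ≠ 1) (c p q t : ℝ) {κ : ℝ} (hκ : 0 < κ) :
    stableExponent α c p q (κ * t) = stableExponent α (κ ^ α * c) p q t := by
  rw [stableExponent, stableExponent, if_neg hα, if_neg hα, abs_mul, abs_of_pos hκ,
    Real.mul_rpow hκ.le (abs_nonneg t), mul_div_mul_left _ _ hκ.ne']
  push_cast; ring

/-- Homogeneity is exact except at α = 1, where log|κt| = log κ + log|t| adds a linear drift. -/
lemma exists_stableExponent_mul (α c p q : ℝ) {κ : ℝ} (hκ : 0 < κ) :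
    ∃ s : ℝ, ∀ t : ℝ, stableExponent α c p q (κ * t)
      = stableExponent α (κ ^ α * c) p q t + s * t * Complex.I := by
  by_cases h1 : α = 1
  · refine ⟨-(c * κ * (p - q) * Real.log κ), fun t => ?_⟩
    rcases eq_or_ne t 0 with rfl | ht
    · simp [stableExponent, h1]
    · have ht' : |t| ≠ 0 := abs_ne_zero.2 ht
      have e : |t| * (t / |t|) = t := by field_simp
      have ec : ((|t| : ℝ) : ℂ) * ((t / |t| : ℝ) : ℂ) = t := by exact_mod_cast e
      rw [stableExponent, stableExponent, if_pos h1, if_pos h1, abs_mul, abs_of_pos hκ, h1,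
        Real.rpow_one, mul_div_mul_left _ _ hκ.ne', Real.log_mul hκ.ne' ht']
      simp only [Complex.ofReal_mul, Complex.ofReal_add, Complex.ofReal_sub, Complex.ofReal_neg]
      linear_combination (-(c * κ * (p - q) * Real.log κ) * Complex.I : ℂ) * ec
  · exact ⟨0, fun t => by rw [stableExponent_mul_of_ne_one h1 _ _ _ _ hκ]; simp⟩

/-! ### Truncated second moments and the size of a_n. -/

/-- A continuous function equal to `1` on `[-a, a]` and to `0` off `(-b, b)`. -/
noncomputable def cutoff (a b x : ℝ) : ℝ := max 0 (min 1 ((b - |x|) / (b - a)))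

section cutoff

variable {a b : ℝ}

lemma continuous_cutoff (a b : ℝ) : Continuous (cutoff a b) := by unfold cutoff; fun_prop

lemma cutoff_nonneg (a b x : ℝ) : 0 ≤ cutoff a b x := le_max_left _ _

lemma cutoff_le_one (a b x : ℝ) : cutoff a b x ≤ 1 := max_le zero_le_one (min_le_left _ _)

lemma cutoff_eq_one (hab : a < b) {x : ℝ} (hx : |x| ≤ a) : cutoff a b x = 1 := by
  have : 1 ≤ (b - |x|) / (b - a) := by rw [le_div_iff₀ (by linarith)]; linarith
  rw [cutoff, min_eq_left this, max_eq_right zero_le_one]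

lemma cutoff_eq_zero (hab : a < b) {x : ℝ} (hx : b ≤ |x|) : cutoff a b x = 0 := by
  have : (b - |x|) / (b - a) ≤ 0 := div_nonpos_of_nonpos_of_nonneg (by linarith) (by linarith)
  exact max_eq_left ((min_le_right _ _).trans this)

lemma sq_mul_cutoff_le (hab : a < b) (x : ℝ) : x ^ 2 * cutoff a b x ≤ b ^ 2 := by
  rcases le_total b |x| with h | h
  · rw [cutoff_eq_zero hab h]; nlinarith [sq_nonneg b]
  · have := pow_le_pow_left₀ (abs_nonneg x) h 2
    rw [sq_abs] at this
    nlinarith [cutoff_le_one a b x, cutoff_nonneg a b x, sq_nonneg x]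

end cutoff

/-- Weak convergence of the jump measures to the canonical measure of a stable law. -/
structure TendstoCanonical (μ : Measure ℝ) (B : ℕ → ℝ) (α c p q : ℝ) (M : Measure ℝ) : Prop where
  canonical : IsStableCanonical α c p q M
  scale_pos : 0 < c
  norm_pos : ∀ n, 0 < B n
  tendsto_integral : ∀ F : ℝ → ℂ, Continuous F → ∀ C : ℝ, (∀ x, ‖F x‖ ≤ C) →
    Tendsto (fun n => ∫ x, F x ∂(jumpMeasure μ n (B n))) atTop (𝓝 (∫ x, F x ∂M))

namespace TendstoCanonical

variable {μ : Measure ℝ} [IsProbabilityMeasure μ] {B : ℕ → ℝ} {α c p q : ℝ} {M : Measure ℝ}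

lemma tendsto_integral_div (h : TendstoCanonical μ B α c p q M) {f : ℝ → ℂ} {L : ℂ} {C : ℝ}
    (hf : Continuous f) (hf0 : f 0 = 0) (hC : ∀ x, ‖f x‖ ≤ C)
    (hL : Tendsto (fun x : ℝ => f x / (x : ℂ) ^ 2) (𝓝[≠] 0) (𝓝 L)) :
    Tendsto (fun n : ℕ => n * ∫ x, f (x / B n) ∂μ) atTop (𝓝 (∫ x, divWeight f L x ∂M)) := by
  obtain ⟨D, hD⟩ := bounded_divWeight hf hC hL
  refine (h.tendsto_integral _ (continuous_divWeight hf hL) D hD).congr fun n => ?_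
  exact integral_divWeight_jumpMeasure μ n (B n) hf hf0 hL

lemma tendsto_charFun_sub_one (h : TendstoCanonical μ B α c p q M) : ∃ d : ℕ → ℝ, ∀ t : ℝ,
    Tendsto (fun n : ℕ => n * (charFun μ (t / B n) - 1) - d n * t * Complex.I) atTop
      (𝓝 (stableExponent α c p q t)) := by
  obtain ⟨β, hβ⟩ := h.canonical.exponent
  refine ⟨fun n => n * ∫ x, Real.sin (x / B n) ∂μ + β, fun t => ?_⟩
  have h1 := h.tendsto_integral _ (continuous_levyKernel t) _ (norm_levyKernel_le t)
  change Tendsto (fun n => levyExponent (jumpMeasure μ n (B n)) t) atTop (𝓝 (levyExponent M t)) at h1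
  rw [hβ] at h1
  simp_rw [levyExponent_jumpMeasure] at h1
  have h2 := h1.sub_const (β * t * Complex.I)
  rw [add_sub_cancel_right] at h2
  refine h2.congr fun n => ?_
  push_cast; ring

/-- The truncation x² I(|x| < s) is discontinuous, so it is replaced by continuous cutoffs, whose
limits are trapped between the exact truncated moments of M. -/
lemma exists_tendsto_cutoff (h : TendstoCanonical μ B α c p q M) {a b : ℝ} (ha : 0 < a)
    (hab : a < b) : ∃ l : ℝ, c * a ^ (2 - α) ≤ l ∧ l ≤ c * b ^ (2 - α) ∧
      Tendsto (fun n : ℕ => n * ∫ x, (x / B n) ^ 2 * cutoff a b (x / B n) ∂μ) atTop (𝓝 l) := by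
  have := h.canonical.finite
  set f : ℝ → ℂ := fun x => ((x ^ 2 * cutoff a b x : ℝ) : ℂ) with hf
  have hcut := continuous_cutoff a b
  have hfc : Continuous f := by fun_prop
  have hL : Tendsto (fun x : ℝ => f x / (x : ℂ) ^ 2) (𝓝[≠] 0) (𝓝 1) := by
    refine tendsto_const_nhds.congr' ?_
    have h1 : ∀ᶠ x : ℝ in 𝓝[≠] 0, |x| ≤ a :=
      (((continuous_abs.tendsto (0 : ℝ)).eventually_lt_const (by simpa using ha)).filter_mono
        nhdsWithin_le_nhds).mono fun x hx => hx.le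
    filter_upwards [h1, self_mem_nhdsWithin] with x hx hx0
    have hx0' : (x : ℂ) ≠ 0 := by exact_mod_cast hx0
    simp only [f, cutoff_eq_one hab hx]
    push_cast; field_simp
  have hC : ∀ x, ‖f x‖ ≤ b ^ 2 := fun x => by
    rw [Complex.norm_real, Real.norm_of_nonneg (mul_nonneg (sq_nonneg x) (cutoff_nonneg a b x))]
    exact sq_mul_cutoff_le hab x
  have hd : ∀ x, divWeight f 1 x = ((sqKernel x * cutoff a b x : ℝ) : ℂ) := fun x => by
    unfold divWeight sqKernel
    split_ifs with hx
    · rw [hx, cutoff_eq_one hab (by simpa using ha.le)]; norm_num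
    · simp only [f]; push_cast; ring
  have hlim := h.tendsto_integral_div hfc (by simp [f]) hC hL
  simp_rw [hd, integral_complex_ofReal] at hlim
  have i0 : Integrable (fun x => sqKernel x * cutoff a b x) M := by
    refine Integrable.of_bound (measurable_sqKernel.mul hcut.measurable).aestronglyMeasurable
      (40 * max 1 (b ^ 2)) (Eventually.of_forall fun x => ?_)
    rw [Real.norm_of_nonneg (mul_nonneg (sqKernel_nonneg x) (cutoff_nonneg a b x))]
    rcases le_total b |x| with hx | hx
    · rw [cutoff_eq_zero hab hx, mul_zero]; positivity
    · have h1 : x ^ 2 ≤ b ^ 2 := by rw [← sq_abs x]; exact pow_le_pow_left₀ (abs_nonneg x) hx 2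
      calc sqKernel x * cutoff a b x ≤ sqKernel x * 1 := by
            gcongr
            · exact sqKernel_nonneg x
            · exact cutoff_le_one a b x
        _ ≤ 40 * max 1 (x ^ 2) := by rw [mul_one]; exact sqKernel_le x
        _ ≤ _ := by gcongr
  refine ⟨∫ x, sqKernel x * cutoff a b x ∂M, ?_, ?_, ?_⟩
  · rw [← h.canonical.truncated a ha]
    refine integral_mono (integrable_indicator_sqKernel M a) i0 fun x => ?_
    by_cases hx : x ∈ {x : ℝ | |x| < a}
    · rw [Set.indicator_of_mem hx]
      simp only [cutoff_eq_one hab (le_of_lt hx), mul_one, le_refl]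
    · rw [Set.indicator_of_notMem hx]
      exact mul_nonneg (sqKernel_nonneg x) (cutoff_nonneg a b x)
  · rw [← h.canonical.truncated b (ha.trans hab)]
    refine integral_mono i0 (integrable_indicator_sqKernel M b) fun x => ?_
    by_cases hx : x ∈ {x : ℝ | |x| < b}
    · rw [Set.indicator_of_mem hx]
      exact mul_le_of_le_one_right (sqKernel_nonneg x) (cutoff_le_one a b x)
    · rw [Set.indicator_of_notMem hx]
      simp only [cutoff_eq_zero hab (not_lt.1 hx), mul_zero, le_refl]
  · have := (Complex.continuous_re.tendsto _).comp hlim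
    refine this.congr fun n => ?_
    simp only [f, Function.comp_apply]
    rw [integral_complex_ofReal, ← Complex.ofReal_natCast, Complex.re_ofReal_mul, Complex.ofReal_re]

end TendstoCanonical

lemma truncSecondMoment_id_eq (μ : Measure ℝ) (y : ℝ) :
    truncSecondMoment μ id y = ∫ x, Set.indicator {x : ℝ | |x| < y} (fun x => x ^ 2) x ∂μ := by
  rw [integral_indicator (measurableSet_lt (by fun_prop) measurable_const)]
  rfl

section truncSecondMoment

variable (μ : Measure ℝ) [IsProbabilityMeasure μ]

lemma integrable_indicator_sq (y : ℝ) :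
    Integrable (Set.indicator {x : ℝ | |x| < y} fun x => x ^ 2) μ := by
  have hm : MeasurableSet {x : ℝ | |x| < y} := measurableSet_lt (by fun_prop) measurable_const
  refine Integrable.of_bound ((by fun_prop : Measurable fun x : ℝ => x ^ 2).indicator
    hm).aestronglyMeasurable (y ^ 2) (Eventually.of_forall fun x => ?_)
  by_cases h : x ∈ {x : ℝ | |x| < y}
  · rw [Set.indicator_of_mem h, Real.norm_of_nonneg (sq_nonneg x), ← sq_abs x]
    exact pow_le_pow_left₀ (abs_nonneg x) (le_of_lt h) 2
  · rw [Set.indicator_of_notMem h, norm_zero]; positivity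

lemma integrable_sq_mul_cutoff {a b : ℝ} (hab : a < b) (B : ℝ) :
    Integrable (fun x => (x / B) ^ 2 * cutoff a b (x / B)) μ := by
  have := continuous_cutoff a b
  refine Integrable.of_bound (Continuous.aestronglyMeasurable (by fun_prop)) (b ^ 2)
    (Eventually.of_forall fun x => ?_)
  rw [Real.norm_of_nonneg (mul_nonneg (sq_nonneg _) (cutoff_nonneg a b _))]
  exact sq_mul_cutoff_le hab _

lemma truncSecondMoment_div_le {a b s B : ℝ} (hab : a < b) (hB : 0 < B) (hs : s ≤ a) :
    truncSecondMoment μ id (s * B) / B ^ 2 ≤ ∫ x, (x / B) ^ 2 * cutoff a b (x / B) ∂μ := by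
  rw [truncSecondMoment_id_eq, ← integral_div]
  refine integral_mono ((integrable_indicator_sq μ _).div_const _)
    (integrable_sq_mul_cutoff μ hab B) fun x => ?_
  by_cases hx : x ∈ {x : ℝ | |x| < s * B}
  · simp only [Set.indicator_of_mem hx]
    have : |x / B| ≤ a := by
      rw [abs_div, abs_of_pos hB, div_le_iff₀ hB]
      exact (le_of_lt hx).trans (by gcongr)
    rw [cutoff_eq_one hab this, mul_one, div_pow]
  · simp only [Set.indicator_of_notMem hx, zero_div]
    exact mul_nonneg (sq_nonneg _) (cutoff_nonneg a b _)

lemma le_truncSecondMoment_div {a b s B : ℝ} (hab : a < b) (hB : 0 < B) (hs : b ≤ s) :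
    ∫ x, (x / B) ^ 2 * cutoff a b (x / B) ∂μ ≤ truncSecondMoment μ id (s * B) / B ^ 2 := by
  rw [truncSecondMoment_id_eq, ← integral_div]
  refine integral_mono (integrable_sq_mul_cutoff μ hab B)
    ((integrable_indicator_sq μ _).div_const _) fun x => ?_
  by_cases hx : x ∈ {x : ℝ | |x| < s * B}
  · simp only [Set.indicator_of_mem hx]
    rw [← div_pow]
    exact mul_le_of_le_one_right (sq_nonneg _) (cutoff_le_one _ _ _)
  · simp only [Set.indicator_of_notMem hx, zero_div]
    have : b ≤ |x / B| := by
      rw [abs_div, abs_of_pos hB, le_div_iff₀ hB]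
      exact le_trans (by gcongr) (not_lt.1 hx)
    rw [cutoff_eq_zero hab this, mul_zero]

lemma truncSecondMoment_div_sq_le_minSqMoment {y : ℝ} (hy : 0 < y) :
    truncSecondMoment μ id y / y ^ 2 ≤ minSqMoment μ y := by
  rw [truncSecondMoment_id_eq, ← integral_div]
  refine integral_mono ((integrable_indicator_sq μ _).div_const _) (integrable_min_sq μ y) fun x => ?_
  by_cases hx : x ∈ {x : ℝ | |x| < y}
  · simp only [Set.indicator_of_mem hx]
    rw [← div_pow]
    refine le_min ?_ le_rfl
    rw [sq_le_one_iff_abs_le_one, abs_div, abs_of_pos hy, div_le_one hy]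
    exact le_of_lt hx
  · simp only [Set.indicator_of_notMem hx, zero_div]
    exact le_min zero_le_one (sq_nonneg _)

lemma minSqMoment_anti {y z : ℝ} (hy : 0 < y) (hyz : y ≤ z) :
    minSqMoment μ z ≤ minSqMoment μ y := by
  refine integral_mono (integrable_min_sq μ z) (integrable_min_sq μ y) fun x => ?_
  refine min_le_min_left _ ?_
  rw [div_pow, div_pow]
  gcongr

end truncSecondMoment

namespace TendstoCanonical

variable {μ : Measure ℝ} [IsProbabilityMeasure μ] {B : ℕ → ℝ} {α c p q : ℝ} {M : Measure ℝ}

/-- Cutoffs on either side of `s` squeeze the truncated moment. Joint convergence in the index and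
the level is needed for uniformity on compact sets of levels. -/
lemma tendsto_truncSecondMoment (h : TendstoCanonical μ B α c p q M) {s : ℝ} (hs : 0 < s) :
    Tendsto (fun z : ℕ × ℝ => z.1 * (truncSecondMoment μ id (z.2 * B z.1) / B z.1 ^ 2))
      (atTop ×ˢ 𝓝 s) (𝓝 (c * s ^ (2 - α))) := by
  have hcont : ContinuousAt (fun x : ℝ => c * x ^ (2 - α)) s :=
    (Real.continuousAt_rpow_const s _ (Or.inl hs.ne')).const_mul c
  rw [tendsto_order]
  constructor
  · intro l hl
    have h1 : ∀ᶠ x in 𝓝[<] s, l < c * x ^ (2 - α) ∧ 0 < x :=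
      ((hcont.tendsto.eventually_const_lt hl).and (eventually_gt_nhds hs)).filter_mono
        nhdsWithin_le_nhds
    obtain ⟨a, ⟨hla, ha⟩, has⟩ := (h1.and self_mem_nhdsWithin).exists
    have has : a < s := has
    obtain ⟨b, hab, hbs⟩ := exists_between has
    obtain ⟨L, hL, -, hT⟩ := h.exists_tendsto_cutoff ha hab
    have h2 := hT.eventually_const_lt (hla.trans_le hL)
    filter_upwards [tendsto_fst.eventually h2, tendsto_snd.eventually (eventually_gt_nhds hbs)]
      with z h3 h4
    exact h3.trans_le (by gcongr; exact le_truncSecondMoment_div μ hab (h.norm_pos _) h4.le)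
  · intro l hl
    have h1 : ∀ᶠ x in 𝓝[>] s, c * x ^ (2 - α) < l :=
      (hcont.tendsto.eventually_lt_const hl).filter_mono nhdsWithin_le_nhds
    obtain ⟨b, hlb, hsb⟩ := (h1.and self_mem_nhdsWithin).exists
    have hsb : s < b := hsb
    obtain ⟨a, hsa, hab⟩ := exists_between hsb
    obtain ⟨L, -, hL, hT⟩ := h.exists_tendsto_cutoff (hs.trans hsa) hab
    have h2 := hT.eventually_lt_const (hL.trans_lt hlb)
    filter_upwards [tendsto_fst.eventually h2, tendsto_snd.eventually (eventually_lt_nhds hsa)]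
      with z h3 h4
    refine lt_of_le_of_lt ?_ h3
    gcongr; exact truncSecondMoment_div_le μ hab (h.norm_pos _) h4.le

lemma tendsto_ratio_truncSecondMoment (h : TendstoCanonical μ B α c p q M) {s : ℝ} (hs : 0 < s) :
    Tendsto (fun z : ℕ × ℝ =>
      z.1 * (truncSecondMoment μ id (z.2 * B z.1) / (z.2 * B z.1) ^ 2))
      (atTop ×ˢ 𝓝 s) (𝓝 (c * s ^ (-α))) := by
  have h1 : Tendsto (fun z : ℕ × ℝ => (z.2 ^ 2)⁻¹) (atTop ×ˢ 𝓝 s) (𝓝 (s ^ 2)⁻¹) :=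
    (tendsto_snd.pow 2).inv₀ (by positivity)
  have e : c * s ^ (-α) = c * s ^ (2 - α) * (s ^ 2)⁻¹ := by
    rw [mul_assoc, ← Real.rpow_natCast, ← Real.rpow_neg hs.le, ← Real.rpow_add hs]
    congr 2; push_cast; ring
  rw [e]
  refine ((h.tendsto_truncSecondMoment hs).mul h1).congr fun z => ?_
  rw [mul_pow]; ring

/-- By dominated convergence, the integral against M of min(1, (x/(m+1))²) divided by the weight
tends to 0 as m → ∞. This provides a level beyond which the condition defining a_n cannot fail. -/
lemma exists_eventually_minSqMoment_lt (h : TendstoCanonical μ B α c p q M) :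
    ∃ S : ℝ, 0 < S ∧ ∀ᶠ n : ℕ in atTop, n * minSqMoment μ (S * B n) < 1 := by
  have := h.canonical.finite
  set f : ℕ → ℝ → ℂ := fun m x => ((min 1 ((x / (m + 1)) ^ 2) : ℝ) : ℂ) with hf
  set L : ℕ → ℂ := fun m => ((1 / (m + 1) ^ 2 : ℝ) : ℂ) with hLdef
  have hfc : ∀ m, Continuous (f m) := fun m => by fun_prop
  have hL : ∀ m, Tendsto (fun x : ℝ => f m x / (x : ℂ) ^ 2) (𝓝[≠] 0) (𝓝 (L m)) := by
    intro m
    refine tendsto_const_nhds.congr' ?_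
    have h1 : ∀ᶠ x : ℝ in 𝓝[≠] 0, |x| < 1 :=
      ((continuous_abs.tendsto (0 : ℝ)).eventually_lt_const (by simp)).filter_mono
        nhdsWithin_le_nhds
    filter_upwards [h1, self_mem_nhdsWithin] with x hx hx0
    have hx0' : (x : ℂ) ≠ 0 := by exact_mod_cast hx0
    have hm : ((m : ℂ) + 1) ≠ 0 := by exact_mod_cast Nat.succ_ne_zero m
    have : (x / (m + 1)) ^ 2 ≤ 1 := by
      rw [sq_le_one_iff_abs_le_one, abs_div, abs_of_pos (by positivity : (0 : ℝ) < m + 1),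
        div_le_one (by positivity)]
      linarith [Nat.cast_nonneg (α := ℝ) m]
    simp only [f, L, min_eq_right this]
    push_cast; field_simp
  have hC : ∀ m x, ‖f m x‖ ≤ 1 := fun m x => by
    rw [Complex.norm_real, Real.norm_of_nonneg (le_min zero_le_one (sq_nonneg _))]
    exact min_le_left _ _
  have hlim : Tendsto (fun m => ∫ x, divWeight (f m) (L m) x ∂M) atTop (𝓝 (∫ _, (0 : ℂ) ∂M)) := by
    refine tendsto_integral_of_dominated_convergence (fun _ => (40 : ℝ))
      (fun m => (continuous_divWeight (hfc m) (hL m)).aestronglyMeasurable)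
      (integrable_const _) (fun m => Eventually.of_forall fun x => ?_)
      (Eventually.of_forall fun x => ?_)
    · have hm : (1 : ℝ) ≤ m + 1 := by linarith [Nat.cast_nonneg (α := ℝ) m]
      unfold divWeight
      split_ifs with hx
      · simp only [L]
        rw [norm_mul, Complex.norm_real, Real.norm_of_nonneg (by positivity)]
        have : 1 / ((m : ℝ) + 1) ^ 2 ≤ 1 := by
          rw [div_le_one (by positivity)]; nlinarith
        norm_num at this ⊢; linarith
      · simp only [f]
        rw [norm_div, Complex.norm_real, Complex.norm_real, Real.norm_of_nonneg (le_min zero_le_one (sq_nonneg _)),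
          Real.norm_of_nonneg (sincWeight_nonneg x), div_le_iff₀ (sincWeight_pos hx)]
        refine le_trans ?_ (min_one_sq_le_sincWeight x)
        refine min_le_min_left _ ?_
        rw [div_pow]
        exact div_le_self (sq_nonneg x) (by nlinarith)
    · have hinv : Tendsto (fun m : ℕ => 1 / ((m : ℝ) + 1)) atTop (𝓝 0) :=
        tendsto_one_div_add_atTop_nhds_zero_nat
      unfold divWeight
      split_ifs with hx
      · have h1 : Tendsto (fun m : ℕ => ((1 / ((m : ℝ) + 1)) ^ 2)) atTop (𝓝 0) := by
          simpa using hinv.pow 2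
        have h2 := ((Complex.continuous_ofReal.tendsto _).comp h1).const_mul 6
        simp only [Complex.ofReal_zero, mul_zero] at h2
        refine h2.congr fun m => ?_
        simp only [L, Function.comp_apply]; rw [div_pow, one_pow]
      · have h1 : Tendsto (fun m : ℕ => min 1 ((x * (1 / ((m : ℝ) + 1))) ^ 2)) atTop (𝓝 0) := by
          have := (tendsto_const_nhds (x := (1 : ℝ))).min ((hinv.const_mul x).pow 2)
          simpa using this
        have h2 := ((Complex.continuous_ofReal.tendsto _).comp h1).div_const (sincWeight x : ℂ)
        simp only [Complex.ofReal_zero, zero_div] at h2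
        refine h2.congr fun m => ?_
        simp only [f, Function.comp_apply]; rw [mul_one_div]
  rw [integral_zero] at hlim
  obtain ⟨m, hm⟩ := (hlim.norm.eventually_lt_const (u := 1) (by simp)).exists
  refine ⟨m + 1, by positivity, ?_⟩
  have h3 := (h.tendsto_integral_div (hfc m) (by simp [f]) (hC m) (hL m)).norm
  filter_upwards [h3.eventually_lt_const hm] with n hn
  refine lt_of_eq_of_lt ?_ hn
  have e : ∀ x : ℝ, f m (x / B n) = ((min 1 ((x / ((m + 1) * B n)) ^ 2) : ℝ) : ℂ) := fun x => by
    simp only [f]; rw [div_div, mul_comm (B n)]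
  simp_rw [e]
  rw [integral_complex_ofReal, norm_mul, Complex.norm_real, Real.norm_of_nonneg
    (integral_nonneg fun x => le_min zero_le_one (sq_nonneg _)), Complex.norm_natCast]
  rfl

/-- The condition defining a_n concerns all y ≥ x B_n. A compact range of y/B_n is covered by local
uniformity, since c s^{-α} < 1 there; beyond it, monotonicity of E min(1, (X/y)²) in y takes over.
-/
lemma eventually_normConst_le (h : TendstoCanonical μ B α c p q M) (hα : 0 < α) {x : ℝ}
    (hx : 0 < x) (hcx : c * x ^ (-α) < 1) :
    ∀ᶠ n : ℕ in atTop, ∀ y, x * B n ≤ y → n * (truncSecondMoment μ id y / y ^ 2) ≤ 1 := by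
  obtain ⟨S, hS0, hS⟩ := h.exists_eventually_minSqMoment_lt
  have hK : ∀ᶠ n : ℕ in atTop, ∀ s ∈ Set.Icc x S,
      n * (truncSecondMoment μ id (s * B n) / (s * B n) ^ 2) < 1 := by
    refine (isCompact_Icc (a := x) (b := S)).induction_on
      (p := fun K => ∀ᶠ n : ℕ in atTop, ∀ s ∈ K,
        n * (truncSecondMoment μ id (s * B n) / (s * B n) ^ 2) < 1) ?_ ?_ ?_ ?_
    · simp
    · exact fun s t hst ht => ht.mono fun n hn r hr => hn r (hst hr)
    · intro s t hs ht
      filter_upwards [hs, ht] with n h1 h2 r hr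
      exact hr.elim (h1 r) (h2 r)
    · intro s hs
      have hs0 : 0 < s := hx.trans_le hs.1
      have h1 : c * s ^ (-α) < 1 := by
        refine lt_of_le_of_lt ?_ hcx
        have := Real.rpow_le_rpow_of_nonpos hx hs.1 (by linarith : -α ≤ 0)
        exact mul_le_mul_of_nonneg_left this h.scale_pos.le
      have h2 := (h.tendsto_ratio_truncSecondMoment hs0).eventually_lt_const h1
      obtain ⟨pa, ha, pb, hb, hab⟩ := eventually_prod_iff.1 h2
      exact ⟨{r | pb r}, mem_nhdsWithin_of_mem_nhds hb, ha.mono fun n hn r hr => hab hn hr⟩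
  filter_upwards [hK, hS] with n h1 h2 y hy
  have hBn := h.norm_pos n
  have hy0 : 0 < y := (mul_pos hx hBn).trans_le hy
  rcases le_total (y / B n) S with h3 | h3
  · have := h1 (y / B n) ⟨(le_div_iff₀ hBn).2 hy, h3⟩
    rw [div_mul_cancel₀ _ hBn.ne'] at this
    exact this.le
  · rw [le_div_iff₀ hBn] at h3
    calc (n : ℝ) * (truncSecondMoment μ id y / y ^ 2) ≤ n * minSqMoment μ (S * B n) := by
          gcongr
          exact (truncSecondMoment_div_sq_le_minSqMoment μ hy0).trans
            (minSqMoment_anti μ (by positivity) h3)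
      _ ≤ 1 := h2.le

/-- The limit profile s ↦ c s^{-α} crosses the level 1 exactly at s = c^{1/α}. Above it the
condition holds eventually; at a point below it the condition fails and bounds the infimum from
below. -/
lemma tendsto_normConst_div (h : TendstoCanonical μ B α c p q M) (hα : 0 < α) :
    Tendsto (fun n => normConst μ id n / B n) atTop (𝓝 (c ^ (1 / α))) := by
  have hκ : 0 < c ^ (1 / α) := Real.rpow_pos_of_pos h.scale_pos _
  have hκc : c * (c ^ (1 / α)) ^ (-α) = 1 := by
    rw [← Real.rpow_mul h.scale_pos.le, show 1 / α * -α = -1 by field_simp, Real.rpow_neg_one,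
      mul_inv_cancel₀ h.scale_pos.ne']
  set κ := c ^ (1 / α)
  have hub : ∀ x, κ < x → ∀ᶠ n : ℕ in atTop,
      x * B n ∈ {x : ℝ | 0 < x ∧ ∀ y : ℝ, x ≤ y → (n : ℝ) * (truncSecondMoment μ id y / y ^ 2) ≤ 1} := by
    intro x hx
    have hx0 := hκ.trans hx
    have : c * x ^ (-α) < 1 := by
      rw [← hκc]
      exact mul_lt_mul_of_pos_left (Real.rpow_lt_rpow_of_neg hκ hx (by linarith)) h.scale_pos
    filter_upwards [h.eventually_normConst_le hα hx0 this] with n hn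
    exact ⟨mul_pos hx0 (h.norm_pos n), hn⟩
  rw [tendsto_order]
  constructor
  · intro l hl
    obtain ⟨x, hx1, hx2⟩ := exists_between (max_lt hl hκ)
    have hx0 : 0 < x := (le_max_right _ _).trans_lt hx1
    have hlx : l < x := (le_max_left _ _).trans_lt hx1
    have h1 : 1 < c * x ^ (-α) := by
      rw [← hκc]
      exact mul_lt_mul_of_pos_left (Real.rpow_lt_rpow_of_neg hx0 hx2 (by linarith)) h.scale_pos
    have h2 : Tendsto (fun n : ℕ => (n, x)) atTop (atTop ×ˢ 𝓝 x) :=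
      tendsto_id.prodMk tendsto_const_nhds
    have h3 := ((h.tendsto_ratio_truncSecondMoment hx0).comp h2).eventually_const_lt h1
    filter_upwards [h3, hub (κ + 1) (by linarith)] with n h4 h5
    simp only [Function.comp_apply] at h4
    refine hlx.trans_le ((le_div_iff₀ (h.norm_pos n)).2 ?_)
    refine le_csInf ⟨_, h5⟩ fun z hz => ?_
    by_contra! hcon
    exact absurd (hz.2 _ hcon.le) (not_le.2 h4)
  · intro l hl
    obtain ⟨x, hx1, hx2⟩ := exists_between hl
    filter_upwards [hub x hx1] with n hn
    refine lt_of_le_of_lt ((div_le_iff₀ (h.norm_pos n)).2 ?_) hx2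
    exact csInf_le ⟨0, fun z hz => hz.1.le⟩ hn

end TendstoCanonical

/-! ### Stable attraction with a_n as norming constants. -/

/-- Real numbers `x n` tend to `0` if the unimodular numbers `exp (i t x n)` tend to `1` for
every `t`. -/
lemma tendsto_zero_of_tendsto_exp_mul_I {x : ℕ → ℝ}
    (h : ∀ t : ℝ, Tendsto (fun n => Complex.exp (t * x n * Complex.I)) atTop (𝓝 1)) :
    Tendsto x atTop (𝓝 0) := by
  -- The hypothesis is convergence of the characteristic functions of the point masses at `x n` to
  -- that of the point mass at 0.
  refine (tendsto_diracProba_iff_tendsto (x := (0 : ℝ)) (L := atTop.map x)).1 ?_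
  rw [tendsto_map'_iff, ProbabilityMeasure.tendsto_iff_tendsto_charFun]
  intro t
  have e : ∀ y : ℝ, charFun ((diracProba y : ProbabilityMeasure ℝ) : Measure ℝ) t
      = Complex.exp (t * y * Complex.I) := fun y => by
    change charFun (Measure.dirac y) t = _
    rw [charFun_apply_real, integral_dirac]
  simp only [Function.comp_apply, e]
  simpa using h t

/-- A nondegenerate law `μ` is attracted to the stable law with exponent `stableExponent α c p q`,
with positive norming constants. -/
structure StablyAttracted (μ : Measure ℝ) (α c p q : ℝ) (B b : ℕ → ℝ) : Prop where
  index_pos : 0 < α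
  index_le : α ≤ 2
  scale_pos : 0 < c
  p_nonneg : 0 ≤ p
  q_nonneg : 0 ≤ q
  p_add_q : p + q = 1
  norm_pos : ∀ n, 0 < B n
  attracted : AttractedTo μ B b fun t => Complex.exp (stableExponent α c p q t)
  nondegenerate : ∀ x : ℝ, μ ≠ Measure.dirac x

namespace StablyAttracted

variable {μ : Measure ℝ} {α c p q : ℝ} {B b : ℕ → ℝ}

lemma exp_stableExponent_zero (h : StablyAttracted μ α c p q B b) :
    (fun t => Complex.exp (stableExponent α c p q t)) 0 = 1 := by
  simp only [stableExponent_zero h.index_pos, Complex.exp_zero]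

/-- Changing the norming constants by an asymptotically constant factor changes the scale
parameter. -/
lemma change_scale (h : StablyAttracted μ α c p q B b) {B' : ℕ → ℝ} (hB' : ∀ n, 0 < B' n)
    {r : ℝ} (hr0 : 0 < r) (hr : Tendsto (fun n => B n / B' n) atTop (𝓝 r)) :
    ∃ b', StablyAttracted μ α (r ^ α * c) p q B' b' := by
  obtain ⟨s, hs⟩ := exists_stableExponent_mul α c p q hr0
  have h1 := (h.attracted.change_scale (fun n => (h.norm_pos n).ne') hr).add_drift
    (tendsto_const_nhds (x := s))
  refine ⟨fun n => b n * (B n / B' n) + s, h.index_pos, h.index_le, mul_pos (Real.rpow_pos_of_pos hr0 _) h.scale_pos,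
    h.p_nonneg, h.q_nonneg, h.p_add_q, hB', ?_, h.nondegenerate⟩
  convert h1 using 2 with t
  rw [hs, ← Complex.exp_add]
  congr 1; ring

lemma exists_norm (h : StablyAttracted μ α c p q B b) {c' : ℝ} (hc' : 0 < c') :
    ∃ r : ℝ, 0 < r ∧ ∃ b', StablyAttracted μ α c' p q (fun n => B n / r) b' := by
  have hc := h.scale_pos
  set r := (c' / c) ^ (1 / α) with hr
  have hr0 : 0 < r := Real.rpow_pos_of_pos (div_pos hc' hc) _
  have e : r ^ α * c = c' := by
    rw [hr, ← Real.rpow_mul (div_pos hc' hc).le, one_div_mul_cancel h.index_pos.ne', Real.rpow_one,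
      div_mul_cancel₀ _ hc.ne']
  obtain ⟨b', h'⟩ := h.change_scale (B' := fun n => B n / r) (fun n => div_pos (h.norm_pos n) hr0) hr0
    (tendsto_const_nhds.congr fun n => by
      have := (h.norm_pos n).ne'
      field_simp)
  rw [e] at h'
  exact ⟨r, hr0, b', h'⟩

lemma norm_exp_stableExponent (h : StablyAttracted μ α c p q B b) : ∃ k : ℝ, 0 < k ∧
    ∀ t : ℝ, 0 ≤ t → ‖Complex.exp (stableExponent α c p q t)‖ = Real.exp (-(k * t ^ α)) := by
  obtain ⟨k, hk, hre⟩ := exists_re_stableExponent h.index_pos h.index_le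
  refine ⟨k * c, mul_pos hk h.scale_pos, fun t ht => ?_⟩
  rw [Complex.norm_exp, hre, abs_of_nonneg ht]

variable [IsProbabilityMeasure μ]

lemma tendsto_exp (h : StablyAttracted μ α c p q B b)
    (hint : Integrable (fun x : ℝ => x ^ 2) μ → ∫ x, x ∂μ = 0) (t : ℝ) :
    Tendsto (fun n : ℕ => Complex.exp (n * (charFun μ (t / B n) - 1) - t * b n * Complex.I))
      atTop (𝓝 (Complex.exp (stableExponent α c p q t))) :=
  h.attracted.tendsto_exp h.exp_stableExponent_zero (Eventually.of_forall h.norm_pos)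
    h.nondegenerate hint t

/-- The lower bound on Re ψ over [-1, 1] is the smallness that resolves the logarithm: a second
difference at 0 with step t is -Re ψ(t) ≤ 1/4. -/
lemma exists_tendstoCanonical (h : StablyAttracted μ α c p q B b)
    (hint : Integrable (fun x : ℝ => x ^ 2) μ → ∫ x, x ∂μ = 0)
    (hc : ∀ t : ℝ, |t| ≤ 1 → -1 / 4 ≤ (stableExponent α c p q t).re) :
    ∃ M, TendstoCanonical μ B α c p q M := by
  obtain ⟨M, hM⟩ := exists_isStableCanonical h.index_pos h.index_le h.scale_pos.le h.p_nonneg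
    h.q_nonneg h.p_add_q
  have := hM.finite
  have hfin := fun n => isFiniteMeasure_jumpMeasure μ n (B n)
  obtain ⟨β, hβ⟩ := hM.exponent
  obtain ⟨C, hC0, hC⟩ := h.attracted.exists_minSqMoment_bound h.exp_stableExponent_zero
    (Eventually.of_forall h.norm_pos) h.nondegenerate
  have hM0 : M ≠ 0 := by
    rintro rfl
    have := hM.truncated 1 one_pos
    simp only [integral_zero_measure, Real.one_rpow, mul_one] at this
    exact h.scale_pos.ne this
  refine ⟨M, hM, h.scale_pos, h.norm_pos, fun F hF D hD => ?_⟩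
  refine tendsto_integral_of_tendsto_charFun hM0 ?_ hF hD
  refine tendsto_charFun_of_tendsto_exp_levyExponent (C := 2 * C)
    (e := fun n => n * ∫ x, Real.sin (x / B n) ∂μ - b n + β) (fun t => ?_) ?_ fun t ht => ?_
  · have h1 := (h.tendsto_exp hint t).mul_const (Complex.exp (β * t * Complex.I))
    rw [hβ, Complex.exp_add]
    refine h1.congr fun n => ?_
    rw [levyExponent_jumpMeasure, ← Complex.exp_add]
    congr 1; push_cast; ring
  · filter_upwards [hC] with n hn
    rw [jumpMeasure_real_univ]
    have : ∫ x, sincWeight (x / B n) ∂μ ≤ 2 * minSqMoment μ (B n) := by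
      rw [minSqMoment, ← integral_const_mul]
      exact integral_mono (integrable_sincWeight_comp μ (by fun_prop)) ((integrable_min_sq μ _).const_mul 2)
        fun x => sincWeight_le_min _
    have hn0 : (0 : ℝ) ≤ n := Nat.cast_nonneg n
    nlinarith
  · have h1 := congrArg Complex.re (integral_cosKernel_eq M t)
    rw [Complex.ofReal_re] at h1
    rw [h1, secondDiff, levyExponent_zero, zero_add, zero_sub, zero_sub, hβ, hβ, stableExponent_neg]
    have := hc t ht
    simp
    linarith

/-- The norming constants of the theorem may be used for a law in the domain of attraction. -/
lemma exists_normConst (h : StablyAttracted μ α c p q B b)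
    (hint : Integrable (fun x : ℝ => x ^ 2) μ → ∫ x, x ∂μ = 0) :
    ∃ B' b' d : ℕ → ℝ, StablyAttracted μ α 1 p q B' b' ∧
      (∀ᶠ n in atTop, B' n = normConst μ id n) ∧
      (∃ ρ : ℝ, 0 < ρ ∧ Tendsto (fun n => B n / B' n) atTop (𝓝 ρ)) ∧
      ∀ t : ℝ, Tendsto (fun n : ℕ => n * (charFun μ (t / B' n) - 1) - d n * t * Complex.I) atTop
        (𝓝 (stableExponent α 1 p q t)) := by
  obtain ⟨k, hk, hre⟩ := exists_re_stableExponent h.index_pos h.index_le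
  -- With this scale parameter Re ψ(t) = -|t|^α / 4, which meets the smallness condition on [-1, 1].
  set c₀ := 1 / (4 * k) with hc₀
  have hc₀pos : 0 < c₀ := by positivity
  have hsmall : ∀ t : ℝ, |t| ≤ 1 → -1 / 4 ≤ (stableExponent α c₀ p q t).re := by
    intro t ht
    rw [hre, show k * c₀ = 1 / 4 by rw [hc₀]; field_simp]
    have := Real.rpow_le_one (abs_nonneg t) ht h.index_pos.le
    linarith
  have hκ : 0 < c₀ ^ (1 / α) := Real.rpow_pos_of_pos hc₀pos _
  have hκα : (c₀ ^ (1 / α)) ^ α = c₀ := by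
    rw [← Real.rpow_mul hc₀pos.le, one_div_mul_cancel h.index_pos.ne', Real.rpow_one]
  obtain ⟨r, hr, b₁, h₁⟩ := h.exists_norm hc₀pos
  obtain ⟨M₁, hM₁⟩ := h₁.exists_tendstoCanonical hint hsmall
  have hratio := hM₁.tendsto_normConst_div h.index_pos
  set κ := c₀ ^ (1 / α) with hκdef
  have hpos : ∀ᶠ n in atTop, 0 < normConst μ id n := by
    filter_upwards [hratio.eventually_const_lt hκ] with n hn
    by_contra! hcon
    exact absurd hn (not_lt.2 (div_nonpos_of_nonpos_of_nonneg hcon (h₁.norm_pos n).le))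
  -- The ratio limit makes a_n positive eventually; the value 1 fills the remaining indices so that
  -- the norming is positive everywhere.
  set A : ℕ → ℝ := fun n => if 0 < normConst μ id n then normConst μ id n else 1 with hA
  have hA0 : ∀ n, 0 < A n := fun n => by
    simp only [A]; split_ifs with h0
    · exact h0
    · exact one_pos
  have hAeq : ∀ᶠ n in atTop, A n = normConst μ id n := hpos.mono fun n hn => if_pos hn
  have hr1 : Tendsto (fun n => B n / r / A n) atTop (𝓝 κ⁻¹) := by
    refine (hratio.inv₀ hκ.ne').congr' ?_
    filter_upwards [hAeq] with n hn
    rw [hn, inv_div]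
  obtain ⟨b₂, h₂⟩ := h₁.change_scale hA0 (inv_pos.2 hκ) hr1
  have e1 : κ⁻¹ ^ α * c₀ = 1 := by
    rw [Real.inv_rpow hκ.le, hκα, inv_mul_cancel₀ hc₀pos.ne']
  rw [e1] at h₂
  -- Scale parameter 1 need not satisfy the smallness condition, so the linearised convergence is
  -- proved for A_n / κ, whose scale parameter is c₀, and carried back by the substitution t ↦ t/κ.
  have hr2 : Tendsto (fun n => A n / (A n / κ)) atTop (𝓝 κ) :=
    tendsto_const_nhds.congr fun n => by
      have := (hA0 n).ne'
      field_simp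
  obtain ⟨b₃, h₃⟩ := h₂.change_scale (fun n => div_pos (hA0 n) hκ) hκ hr2
  rw [hκα, mul_one] at h₃
  obtain ⟨M₃, hM₃⟩ := h₃.exists_tendstoCanonical hint hsmall
  obtain ⟨d, hd⟩ := hM₃.tendsto_charFun_sub_one
  obtain ⟨s, hs⟩ := exists_stableExponent_mul α c₀ p q (inv_pos.2 hκ)
  rw [e1] at hs
  refine ⟨A, b₂, fun n => d n * κ⁻¹ + s, h₂, hAeq, ⟨r * κ⁻¹, by positivity, ?_⟩, fun t => ?_⟩
  · refine (hr1.const_mul r).congr fun n => ?_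
    field_simp
  have h4 := (hd (κ⁻¹ * t)).sub_const (s * t * Complex.I)
  rw [hs, add_sub_cancel_right] at h4
  refine h4.congr fun n => ?_
  have : κ⁻¹ * t / (A n / κ) = t / A n := by
    have := (hA0 n).ne'
    field_simp
  rw [this]
  push_cast; ring

lemma tendsto_pow_sub_exp (h : StablyAttracted μ α c p q B b)
    (hint : Integrable (fun x : ℝ => x ^ 2) μ → ∫ x, x ∂μ = 0) (t : ℝ) :
    Tendsto (fun n : ℕ => charFun μ (t / B n) ^ n - Complex.exp (n * (charFun μ (t / B n) - 1)))
      atTop (𝓝 0) :=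
  h.attracted.tendsto_pow_sub_exp h.exp_stableExponent_zero (Eventually.of_forall h.norm_pos)
    h.nondegenerate hint t

lemma not_integrable_sq (h : StablyAttracted μ α c p q B b) (hα : α < 2) :
    ¬ Integrable (fun x : ℝ => x ^ 2) μ := by
  obtain ⟨k, hk, hnorm⟩ := h.norm_exp_stableExponent
  exact h.attracted.not_integrable_sq h.exp_stableExponent_zero (Eventually.of_forall h.norm_pos)
    h.nondegenerate hk h.index_pos hα fun t ht => hnorm t ht.le

lemma sinCentering_id_eq (A : ℝ) : ∫ x, Real.sin (x / A) ∂μ = (charFun μ (1 / A)).im := by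
  have h := integral_im (integrable_exp_mul_I μ (1 / A))
  simp only [RCLike.im_to_complex] at h
  rw [charFun_apply_real, ← h]
  congr 1; ext x
  rw [← Complex.ofReal_mul, Complex.exp_ofReal_mul_I_im, one_div_mul_eq_div]

/-- For index one the normed sums, centred by `n E sin (X / a_n)`, converge. -/
lemma tendsto_sinCentering (h : StablyAttracted μ 1 c p q B b) :
    ∃ B' b' : ℕ → ℝ, StablyAttracted μ 1 1 p q B' b' ∧
      (∀ᶠ n in atTop, B' n = normConst μ id n) ∧
      (∃ ρ : ℝ, 0 < ρ ∧ Tendsto (fun n => B n / B' n) atTop (𝓝 ρ)) ∧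
      ∀ t : ℝ, Tendsto (fun n : ℕ => charFun μ (t / B' n) ^ n
        * Complex.exp (-(t * sinCentering μ id n * Complex.I))) atTop
        (𝓝 (Complex.exp (stableExponent 1 1 p q t))) := by
  have hint : Integrable (fun x : ℝ => x ^ 2) μ → ∫ x, x ∂μ = 0 := fun hi =>
    absurd hi (h.not_integrable_sq (by norm_num))
  obtain ⟨A, b', d, h', hAeq, hρ, hd⟩ := h.exists_normConst hint
  refine ⟨A, b', h', hAeq, hρ, fun t => ?_⟩
  have him : Tendsto (fun n : ℕ => sinCentering μ id n - d n) atTop (𝓝 0) := by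
    have h1 := (Complex.continuous_im.tendsto _).comp (hd 1)
    -- At t = 1 the logarithm vanishes, so the imaginary part of n(φ(1/a_n) - 1), namely n E
    -- sin(X/a_n), matches the unknown centring up to o(1).
    have e : (stableExponent 1 1 p q 1).im = 0 := by simp [stableExponent]
    rw [e] at h1
    refine h1.congr' ?_
    filter_upwards [hAeq] with n hn
    simp only [Function.comp_apply]
    rw [sinCentering, ← hn]
    simp only [id]
    rw [sinCentering_id_eq (A n), ← Complex.ofReal_natCast]
    simp
  have h1 : Tendsto (fun n : ℕ => n * (charFun μ (t / A n) - 1)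
      - t * sinCentering μ id n * Complex.I) atTop (𝓝 (stableExponent 1 1 p q t)) := by
    have h2 := (((Complex.continuous_ofReal.tendsto _).comp him).mul_const (t * Complex.I))
    have h3 := (hd t).sub h2
    simp only [Complex.ofReal_zero, zero_mul, sub_zero] at h3
    refine h3.congr fun n => ?_
    simp only [Function.comp_apply]; push_cast; ring
  have h2 := (Complex.continuous_exp.tendsto _).comp h1
  have h3 := h'.tendsto_pow_sub_exp hint t
  have h4 : Tendsto (fun n : ℕ => (charFun μ (t / A n) ^ n
      - Complex.exp (n * (charFun μ (t / A n) - 1)))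
      * Complex.exp (-(t * sinCentering μ id n * Complex.I))) atTop (𝓝 0) := by
    rw [tendsto_zero_iff_norm_tendsto_zero] at h3 ⊢
    refine h3.congr fun n => ?_
    rw [norm_mul, show -((t : ℂ) * sinCentering μ id n * Complex.I)
      = ((-(t * sinCentering μ id n) : ℝ) : ℂ) * Complex.I by push_cast; ring,
      Complex.norm_exp_ofReal_mul_I, mul_one]
  have h5 := h4.add h2
  rw [zero_add] at h5
  refine h5.congr fun n => ?_
  simp only [Function.comp_apply]
  rw [sub_eq_add_neg (_ * _) (_ * Complex.I), Complex.exp_add]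
  ring

end StablyAttracted

/-! ### The weak law of large numbers and a contracting recursion. -/

/-- The weak law of large numbers, for characteristic functions. -/
lemma tendsto_charFun_div_pow {μ : Measure ℝ} [IsProbabilityMeasure μ]
    (hμ : Integrable (fun x : ℝ => x) μ) (s : ℝ) :
    Tendsto (fun n : ℕ => charFun μ (s / n) ^ n) atTop
      (𝓝 (Complex.exp (s * (∫ x, x ∂μ : ℝ) * Complex.I))) := by
  have hL : MemLp id ((1 : ℕ) : ENNReal) μ := by
    rw [Nat.cast_one]; exact memLp_one_iff_integrable.2 hμ
  have hd : HasDerivAt (charFun μ) (Complex.I * (∫ x, x ∂μ : ℝ)) 0 := by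
    have h1 := ((contDiff_charFun hL).differentiable (by simp) 0).hasDerivAt
    have h2 := iteratedDeriv_charFun_zero hL
    rw [iteratedDeriv_one] at h2
    rw [h2] at h1
    simpa [integral_complex_ofReal] using h1
  have hd2 : HasDerivAt (fun u : ℝ => charFun μ (s * u)) (s * (∫ x, x ∂μ : ℝ) * Complex.I) 0 := by
    have h1 : HasDerivAt (fun u : ℝ => s * u) s 0 := by simpa using (hasDerivAt_id (0 : ℝ)).const_mul s
    have h2 := HasDerivAt.scomp (0 : ℝ) (g₁ := charFun μ) (by simpa using hd) h1
    rw [Complex.real_smul, show (s : ℂ) * (Complex.I * (∫ x, x ∂μ : ℝ))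
      = s * (∫ x, x ∂μ : ℝ) * Complex.I by ring] at h2
    exact h2
  have h3 := (hasDerivAt_iff_tendsto_slope_zero.1 hd2)
  -- The slope must be taken at nonzero points, so 1/(n+1) is used and the index is shifted back
  -- below.
  have h4 : Tendsto (fun n : ℕ => ((n : ℝ) + 1)⁻¹) atTop (𝓝[≠] 0) := by
    refine tendsto_nhdsWithin_iff.2 ⟨?_, Eventually.of_forall fun n => ?_⟩
    · simpa using tendsto_one_div_add_atTop_nhds_zero_nat (𝕜 := ℝ)
    · exact (inv_pos.2 (by positivity : (0 : ℝ) < n + 1)).ne'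
  have h5 := h3.comp h4
  have h6 : Tendsto (fun n : ℕ => ((n : ℂ)) * (charFun μ (s / n) - 1)) atTop
      (𝓝 (s * (∫ x, x ∂μ : ℝ) * Complex.I)) := by
    rw [← tendsto_add_atTop_iff_nat 1]
    refine h5.congr fun n => ?_
    simp only [Function.comp_apply, inv_inv, zero_add, mul_zero, charFun_zero, probReal_univ]
    rw [Complex.real_smul, ← div_eq_mul_inv]
    push_cast; ring
  refine (Complex.tendsto_one_add_pow_exp_of_tendsto h6).congr fun n => ?_
  ring

/-- Sequences that satisfy a recursion under halving of the index, with a contracting factor. -/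
lemma tendsto_zero_of_tendsto_sub_mul_half {x r : ℕ → ℝ} {r₀ : ℝ} (hr : Tendsto r atTop (𝓝 r₀))
    (hr₀ : |r₀| < 1) (h : Tendsto (fun m => x m - r m * x (m / 2)) atTop (𝓝 0)) :
    Tendsto x atTop (𝓝 0) := by
  obtain ⟨ρ, hρ0, hρ1⟩ := exists_between hr₀
  have hρpos : 0 < ρ := (abs_nonneg _).trans_lt hρ0
  have key : ∀ ε : ℝ, 0 < ε → ∃ N : ℕ, 1 ≤ N ∧ ∀ m, N ≤ m →
      |x m| ≤ ρ * |x (m / 2)| + (1 - ρ) * ε := by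
    intro ε hε
    have h1 := (h.abs.eventually_lt_const (u := (1 - ρ) * ε) (by
      rw [abs_zero]; exact mul_pos (by linarith) hε)).and (hr.abs.eventually_lt_const hρ0)
    obtain ⟨N, hN⟩ := eventually_atTop.1 (h1.and (eventually_ge_atTop 1))
    refine ⟨max N 1, le_max_right _ _, fun m hm => ?_⟩
    obtain ⟨⟨h2, h3⟩, -⟩ := hN m ((le_max_left _ _).trans hm)
    calc |x m| = |r m * x (m / 2) + (x m - r m * x (m / 2))| := by ring_nf
      _ ≤ |r m| * |x (m / 2)| + (1 - ρ) * ε := by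
        refine (abs_add_le _ _).trans ?_
        rw [abs_mul]; gcongr
      _ ≤ _ := by gcongr
  rw [Metric.tendsto_nhds]
  intro ε₂ hε₂
  set ε := ε₂ / 2 with hε'
  have hε : 0 < ε := by positivity
  obtain ⟨N, hN1, hN⟩ := key ε hε
  set K : ℝ := ∑ i ∈ Finset.range N, |x i| with hK
  have hK0 : 0 ≤ K := Finset.sum_nonneg fun i _ => abs_nonneg _
  have hb : ∀ m, |x m| ≤ K + ε := by
    intro m
    induction m using Nat.strong_induction_on with
    | _ m ih =>
      rcases lt_or_ge m N with hm | hm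
      · have := Finset.single_le_sum (f := fun i => |x i|) (fun i _ => abs_nonneg _)
          (Finset.mem_range.2 hm)
        linarith
      · have h1 := hN m hm
        have h2 := ih (m / 2) (by omega)
        nlinarith
  -- Each halving improves the contribution of the initial bound by a factor ρ, leaving only the
  -- error level ε.
  have hj : ∀ j : ℕ, ∀ᶠ m in atTop, |x m| ≤ ρ ^ j * K + ε := by
    intro j
    induction j with
    | zero => exact Eventually.of_forall fun m => by simpa using hb m
    | succ j ih =>
      have h2 : Tendsto (fun m : ℕ => m / 2) atTop atTop := Nat.tendsto_div_const_atTop (by norm_num)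
      filter_upwards [h2.eventually ih, eventually_ge_atTop N] with m h3 h4
      have h1 := hN m h4
      rw [pow_succ]
      nlinarith
  have hpow : Tendsto (fun j : ℕ => ρ ^ j * K) atTop (𝓝 0) := by
    simpa using (tendsto_pow_atTop_nhds_zero_of_lt_one hρpos.le hρ1).mul_const K
  obtain ⟨j, hj1⟩ := (hpow.eventually_lt_const hε).exists
  filter_upwards [hj j] with m hm
  rw [Real.dist_eq, sub_zero]
  linarith

/-! ### Doubling the index: ratios of norming constants and the drift. -/

namespace StablyAttracted

variable {μ : Measure ℝ} [IsProbabilityMeasure μ] {α c p q : ℝ} {B b : ℕ → ℝ}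

lemma tendsto_atTop (h : StablyAttracted μ α c p q B b) : Tendsto B atTop atTop := by
  obtain ⟨D, hD, hnB⟩ := h.attracted.exists_le_mul_sq h.exp_stableExponent_zero
    (Eventually.of_forall h.norm_pos) h.nondegenerate
  exact tendsto_atTop_of_le_mul_sq hD hnB (Eventually.of_forall h.norm_pos)

lemma two_mul_rpow_eq (hα : 0 < α) {a : ℝ} (ha0 : 0 ≤ a) (ha1 : a ≤ 1)
    (h : (1 - a) ^ α = 2 * a ^ α) : a = (1 + 2 ^ (1 / α))⁻¹ := by
  have h1 : 1 - a = 2 ^ (1 / α) * a := by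
    have h2 := congrArg (fun y : ℝ => y ^ (1 / α)) h
    rw [← Real.rpow_mul (by linarith), Real.mul_rpow two_pos.le (Real.rpow_nonneg ha0 _),
      ← Real.rpow_mul ha0, mul_one_div_cancel hα.ne', Real.rpow_one, Real.rpow_one] at h2
    exact h2
  have h3 : (0 : ℝ) < 1 + 2 ^ (1 / α) := by positivity
  exact eq_inv_of_mul_eq_one_left (by linarith)

/-- A power whose exponent is about doubled is asymptotically a square, for complex numbers that
tend to `1`. -/
lemma tendsto_pow_of_double {w : ℕ → ℝ} {u v : ℕ → ℕ} {l : ℝ}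
    (huv : ∀ j, v j = 2 * u j ∨ v j = 2 * u j + 1) (hw : Tendsto w atTop (𝓝 1))
    (hl : Tendsto (fun j => w j ^ u j) atTop (𝓝 l)) :
    Tendsto (fun j => w j ^ v j) atTop (𝓝 (l ^ 2)) := by
  have hθ : Tendsto (fun j => if v j = 2 * u j then 1 else w j) atTop (𝓝 1) := by
    refine Tendsto.if' ?_ ?_
    · exact tendsto_const_nhds
    · exact hw
  have := (hl.pow 2).mul hθ
  rw [mul_one] at this
  refine this.congr fun j => ?_
  split_ifs with hj
  · rw [hj, mul_one, ← pow_mul, mul_comm]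
  · rw [(huv j).resolve_left hj, ← pow_mul, pow_succ, mul_comm (u j)]

/-- Dividing by the sum B_u + B_v keeps the ratio in [0, 1], so compactness gives a limit a along a
further subsequence. At argument 1/(B_u + B_v), the powers of |φ| tend to exp(-k a^α) and exp(-k
(1-a)^α), and v ≈ 2u gives (1-a)^α = 2a^α, which determines a. -/
lemma tendsto_ratio (h : StablyAttracted μ α c p q B b) {u v : ℕ → ℕ} (hu : Tendsto u atTop atTop)
    (hv : Tendsto v atTop atTop) (huv : ∀ j, v j = 2 * u j ∨ v j = 2 * u j + 1) :
    Tendsto (fun j => B (u j) / B (v j)) atTop (𝓝 ((2 : ℝ) ^ (1 / α))⁻¹) := by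
  obtain ⟨k, hk, hnorm⟩ := h.norm_exp_stableExponent
  have hBt := h.tendsto_atTop
  have hB := h.norm_pos
  have hx : Tendsto (fun j => B (u j) / (B (u j) + B (v j))) atTop (𝓝 (1 + 2 ^ (1 / α))⁻¹) := by
    refine tendsto_of_subseq_tendsto fun ns hns => ?_
    have hmem : ∀ j, B (u (ns j)) / (B (u (ns j)) + B (v (ns j))) ∈ Set.Icc (0 : ℝ) 1 := fun j => by
      have h1 := hB (u (ns j)); have h2 := hB (v (ns j))
      exact ⟨by positivity, by rw [div_le_one (by positivity)]; linarith⟩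
    obtain ⟨a, ha, ms, hms, hlim⟩ := isCompact_Icc.tendsto_subseq hmem
    have hUt : Tendsto (fun j => u (ns (ms j))) atTop atTop := hu.comp (hns.comp hms.tendsto_atTop)
    have hVt : Tendsto (fun j => v (ns (ms j))) atTop atTop := hv.comp (hns.comp hms.tendsto_atTop)
    set U : ℕ → ℕ := fun j => u (ns (ms j)) with hU
    set V : ℕ → ℕ := fun j => v (ns (ms j)) with hV
    set W : ℕ → ℝ := fun j => B (U j) + B (V j) with hW
    have hlimU : Tendsto (fun j => B (U j) / W j) atTop (𝓝 a) := hlim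
    have hlimV : Tendsto (fun j => B (V j) / W j) atTop (𝓝 (1 - a)) := by
      refine (hlimU.const_sub 1).congr fun j => ?_
      have h1 := hB (U j); have h2 := hB (V j)
      simp only [W]
      field_simp; ring
    have hWt : Tendsto W atTop atTop :=
      tendsto_atTop_mono (fun j => le_add_of_nonneg_right (hB (V j)).le) (hBt.comp hUt)
    have e : ∀ n j, B n / W j / B n = 1 / W j := fun n j => by
      have := (hB n).ne'
      field_simp
    have t1 := h.attracted.norm_comp hUt hlimU
    have t2 := h.attracted.norm_comp hVt hlimV
    simp only [e, hnorm a ha.1, hnorm (1 - a) (by linarith [ha.2])] at t1 t2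
    have hφ : Tendsto (fun j => ‖charFun μ (1 / W j)‖) atTop (𝓝 1) := by
      have h1 := (continuous_charFun (μ := μ)).norm.tendsto 0
      rw [charFun_zero, probReal_univ, Complex.ofReal_one, norm_one] at h1
      exact h1.comp (tendsto_const_nhds.div_atTop hWt)
    have t3 := tendsto_pow_of_double (u := U) (v := V) (fun j => huv _) hφ t1
    have heq := tendsto_nhds_unique t2 t3
    rw [← Real.exp_nat_mul, Real.exp_eq_exp] at heq
    refine ⟨ms, ?_⟩
    rw [← two_mul_rpow_eq h.index_pos ha.1 ha.2 (mul_left_cancel₀ hk.ne' (by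
      push_cast at heq; linarith))]
    exact hlim
  have hp : (0 : ℝ) < 2 ^ (1 / α) := by positivity
  have h1 : 1 - (1 + (2 : ℝ) ^ (1 / α))⁻¹ ≠ 0 := by
    have : (1 + (2 : ℝ) ^ (1 / α))⁻¹ < 1 := inv_lt_one_of_one_lt₀ (by linarith)
    linarith
  have h2 := hx.div (hx.const_sub 1) h1
  have e : (1 + (2 : ℝ) ^ (1 / α))⁻¹ / (1 - (1 + (2 : ℝ) ^ (1 / α))⁻¹) = ((2 : ℝ) ^ (1 / α))⁻¹ := by
    have h3 : (1 + (2 : ℝ) ^ (1 / α)) ≠ 0 := by positivity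
    have e1 : 1 - (1 + (2 : ℝ) ^ (1 / α))⁻¹ = 2 ^ (1 / α) * (1 + (2 : ℝ) ^ (1 / α))⁻¹ := by
      field_simp; ring
    rw [e1]
    field_simp
  rw [e] at h2
  refine h2.congr fun j => ?_
  have h3 := hB (u j); have h4 := hB (v j)
  have e1 : 1 - B (u j) / (B (u j) + B (v j)) = B (v j) / (B (u j) + B (v j)) := by
    field_simp; ring
  rw [Pi.div_apply, e1, div_div_div_cancel_right₀ (by positivity)]

/-- For α ≠ 1 one has 2ψ(2^{-1/α} t) = ψ(t) exactly. Comparing φ(t/B_v)^v with the square of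
φ(t/B_v)^u therefore leaves a pure phase that tends to 1 for every t. An odd v contributes one extra
factor tending to 1. -/
lemma tendsto_drift_sub (h : StablyAttracted μ α c p q B b) (hα : α ≠ 1) {u v : ℕ → ℕ}
    (hu : Tendsto u atTop atTop) (hv : Tendsto v atTop atTop)
    (huv : ∀ j, v j = 2 * u j ∨ v j = 2 * u j + 1) :
    Tendsto (fun j => b (v j) - 2 * (B (u j) / B (v j)) * b (u j)) atTop (𝓝 0) := by
  refine tendsto_zero_of_tendsto_exp_mul_I fun t => ?_
  have hr := h.tendsto_ratio hu hv huv
  set r : ℕ → ℝ := fun j => B (u j) / B (v j) with hrdef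
  set l : ℝ := ((2 : ℝ) ^ (1 / α))⁻¹ with hl
  have hl0 : 0 < l := by positivity
  have hlα : l ^ α = 1 / 2 := by
    rw [hl, Real.inv_rpow (by positivity), ← Real.rpow_mul two_pos.le,
      one_div_mul_cancel h.index_pos.ne', Real.rpow_one, one_div]
  have t1 := h.attracted.comp hv (tendsto_const_nhds (x := t))
  have t2 := (h.attracted.comp hu (hr.mul_const t)).pow 2
  have eg : Complex.exp (stableExponent α c p q (l * t)) ^ 2
      = Complex.exp (stableExponent α c p q t) := by
    rw [← Complex.exp_nat_mul, stableExponent_mul_of_ne_one hα _ _ _ _ hl0, stableExponent_mul_scale,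
      hlα]
    congr 1; push_cast; ring
  rw [eg] at t2
  have hφ : Tendsto (fun j => charFun μ (t / B (v j))) atTop (𝓝 1) := by
    have h1 := (continuous_charFun (μ := μ)).tendsto 0
    rw [charFun_zero, probReal_univ, Complex.ofReal_one] at h1
    exact h1.comp (tendsto_const_nhds.div_atTop (h.tendsto_atTop.comp hv))
  have hθ : Tendsto (fun j => if v j = 2 * u j then 1 else charFun μ (t / B (v j))) atTop (𝓝 1) :=
    Tendsto.if' tendsto_const_nhds hφ
  have t3 := (t2.mul hθ).div t1 (Complex.exp_ne_zero _)
  rw [mul_one, div_self (Complex.exp_ne_zero _)] at t3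
  refine t3.congr' ?_
  filter_upwards [t1.eventually_ne (Complex.exp_ne_zero _)] with j hj
  rw [Pi.div_apply, div_eq_iff hj]
  have e1 : r j * t / B (u j) = t / B (v j) := by
    have h3 := (h.norm_pos (u j)).ne'; have h4 := (h.norm_pos (v j)).ne'
    simp only [r]; field_simp
  have e2 : (charFun μ (t / B (v j)) ^ u j) ^ 2 * (if v j = 2 * u j then 1
      else charFun μ (t / B (v j))) = charFun μ (t / B (v j)) ^ v j := by
    split_ifs with hj
    · rw [hj, mul_one, ← pow_mul, mul_comm]
    · rw [(huv j).resolve_left hj, ← pow_mul, pow_succ, mul_comm (u j)]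
  rw [e1, mul_pow, mul_right_comm, e2, mul_left_comm, ← Complex.exp_add, ← Complex.exp_nat_mul]
  congr 2
  simp only [r]
  push_cast; ring

/-- The recursion factor tends to 2·2^{-1/α}, which is less than 1 exactly because α < 1. -/
lemma tendsto_drift_of_lt_one (h : StablyAttracted μ α c p q B b) (hα : α < 1) :
    Tendsto b atTop (𝓝 0) := by
  have hhalf : Tendsto (fun m : ℕ => m / 2) atTop atTop := Nat.tendsto_div_const_atTop (by norm_num)
  have huv : ∀ j : ℕ, id j = 2 * (j / 2) ∨ id j = 2 * (j / 2) + 1 := fun j => by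
    simp only [id]; omega
  refine tendsto_zero_of_tendsto_sub_mul_half ((h.tendsto_ratio hhalf tendsto_id huv).const_mul 2) ?_
    (h.tendsto_drift_sub hα.ne hhalf tendsto_id huv)
  have h1 : (2 : ℝ) < 2 ^ (1 / α) := by
    conv_lhs => rw [← Real.rpow_one 2]
    exact Real.rpow_lt_rpow_of_exponent_lt one_lt_two (by rw [lt_div_iff₀ h.index_pos]; linarith)
  rw [abs_of_pos (by positivity), ← div_eq_mul_inv, div_lt_one (by positivity)]
  exact h1

/-- For index greater than one, the norming constants grow slower than linearly. -/
lemma exists_norm_double_le (h : StablyAttracted μ α c p q B b) (hα : 1 < α) :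
    ∃ ρ : ℝ, 0 < ρ ∧ ρ < 1 ∧ ∀ᶠ n : ℕ in atTop, B (2 * n) ≤ 2 * ρ * B n := by
  have hdouble : Tendsto (fun m : ℕ => 2 * m) atTop atTop :=
    tendsto_id.const_mul_atTop' two_pos
  have hr := (h.tendsto_ratio tendsto_id hdouble fun j => Or.inl rfl).inv₀ (by positivity)
  rw [inv_inv] at hr
  have h1 : (2 : ℝ) ^ (1 / α) < 2 := by
    conv_rhs => rw [← Real.rpow_one 2]
    exact Real.rpow_lt_rpow_of_exponent_lt one_lt_two
      (by rw [div_lt_iff₀ h.index_pos]; linarith)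
  obtain ⟨σ, hσ1, hσ2⟩ := exists_between h1
  have hσ0 : 0 < σ := lt_trans (by positivity) hσ1
  refine ⟨σ / 2, by positivity, by linarith, ?_⟩
  filter_upwards [hr.eventually_lt_const hσ1] with n hn
  simp only [id, inv_div] at hn
  rw [div_lt_iff₀ (h.norm_pos n)] at hn
  linarith

lemma norm_two_pow_mul_le {ρ : ℝ} (hρ : 0 < ρ) {N : ℕ} (h : ∀ n, N ≤ n → B (2 * n) ≤ 2 * ρ * B n)
    {n : ℕ} (hn : N ≤ n) (k : ℕ) : B (2 ^ k * n) ≤ (2 * ρ) ^ k * B n := by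
  induction k with
  | zero => simp
  | succ k ih =>
    have h1 := h (2 ^ k * n) (hn.trans (Nat.le_mul_of_pos_left n (by positivity)))
    rw [pow_succ' 2, mul_assoc, pow_succ (2 * ρ)]
    nlinarith

lemma tendsto_norm_two_pow_div (hB : ∀ n, 0 < B n) {ρ : ℝ} (hρ : 0 < ρ)
    (hρ1 : ρ < 1) {N : ℕ} (hN : ∀ n, N ≤ n → B (2 * n) ≤ 2 * ρ * B n) {n : ℕ} (hn : N ≤ n) :
    Tendsto (fun k : ℕ => B (2 ^ k * n) / (2 ^ k * n : ℕ)) atTop (𝓝 0) := by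
  have h1 : Tendsto (fun k : ℕ => ρ ^ k * (B n / n)) atTop (𝓝 0) := by
    simpa using (tendsto_pow_atTop_nhds_zero_of_lt_one hρ.le hρ1).mul_const (B n / n)
  refine squeeze_zero (fun k => div_nonneg (hB _).le (Nat.cast_nonneg _)) (fun k => ?_) h1
  have h2 := norm_two_pow_mul_le hρ hN hn k
  push_cast
  calc B (2 ^ k * n) / (2 ^ k * n) ≤ (2 * ρ) ^ k * B n / (2 ^ k * n) := by gcongr
    _ = ρ ^ k * (B n / n) := by rw [mul_pow]; field_simp

/-- The recursion now expands, so it is run backwards from infinity. Along m = 2^k n the quantity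
y_k = b_m B_m / m tends to 0 by the weak law, while its increments are at most ε(1-ρ)ρ^{k+1} B_n/n.
Summing them gives |y_0| ≤ ε B_n/n, that is |b_n| ≤ ε. -/
lemma tendsto_drift_of_one_lt (h : StablyAttracted μ α c p q B b) (hα : 1 < α)
    (hint : Integrable (fun x : ℝ => x) μ) (hmean : ∫ x, x ∂μ = 0) :
    Tendsto b atTop (𝓝 0) := by
  obtain ⟨ρ, hρ, hρ1, hBρ⟩ := h.exists_norm_double_le hα
  have hdouble : Tendsto (fun m : ℕ => 2 * m) atTop atTop :=
    tendsto_id.const_mul_atTop' two_pos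
  have hδ := h.tendsto_drift_sub hα.ne' tendsto_id hdouble fun j => Or.inl rfl
  rw [Metric.tendsto_nhds]
  intro ε₂ hε₂
  set ε := ε₂ / 2 with hε'
  have hε : 0 < ε := by positivity
  have hδ' := hδ.abs.eventually_lt_const (u := ε * (1 - ρ))
    (by rw [abs_zero]; exact mul_pos hε (by linarith))
  obtain ⟨N, hN⟩ := eventually_atTop.1 ((hBρ.and hδ').and (eventually_ge_atTop 1))
  filter_upwards [eventually_ge_atTop (max N 1)] with n hn
  have hnN : N ≤ n := (le_max_left _ _).trans hn
  have hn1 : 1 ≤ n := (le_max_right _ _).trans hn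
  have hn0 : (0 : ℝ) < n := by exact_mod_cast hn1
  set m : ℕ → ℕ := fun k => 2 ^ k * n with hm
  have hmpos : ∀ k, (0 : ℝ) < m k := fun k => by
    have : 0 < m k := by positivity
    exact_mod_cast this
  have hmt : Tendsto m atTop atTop :=
    tendsto_atTop_mono (fun k => Nat.le_mul_of_pos_right _ hn1)
      (tendsto_pow_atTop_atTop_of_one_lt one_lt_two)
  set z : ℕ → ℝ := fun k => B (m k) / m k with hz
  have hz0 : Tendsto z atTop (𝓝 0) :=
    tendsto_norm_two_pow_div h.norm_pos hρ hρ1 (fun n hn => (hN n hn).1.1) hnN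
  have hzle : ∀ k, z k ≤ ρ ^ k * (B n / n) := fun k => by
    have h2 := norm_two_pow_mul_le hρ (fun n hn => (hN n hn).1.1) hnN k
    simp only [z, m]
    push_cast
    calc B (2 ^ k * n) / (2 ^ k * n) ≤ (2 * ρ) ^ k * B n / (2 ^ k * n) := by gcongr
      _ = ρ ^ k * (B n / n) := by rw [mul_pow]; field_simp
  set y : ℕ → ℝ := fun k => b (m k) * z k with hy
  have hstep : ∀ k, |y (k + 1) - y k| ≤ ρ ^ (k + 1) * (B n / n) * (ε * (1 - ρ)) := by
    intro k
    have hmk : m (k + 1) = 2 * m k := by simp only [m]; ring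
    have e : y (k + 1) - y k = z (k + 1) * (b (2 * m k) - 2 * (B (m k) / B (2 * m k)) * b (m k)) := by
      have h3 := (h.norm_pos (2 * m k)).ne'
      have h4 := (hmpos k).ne'
      simp only [y, z, hmk]
      push_cast
      field_simp
    rw [e, abs_mul]
    have hzpos : 0 ≤ z (k + 1) := div_nonneg (h.norm_pos _).le (hmpos _).le
    rw [abs_of_nonneg hzpos]
    have h5 := (hN (m k) (hnN.trans (Nat.le_mul_of_pos_left n (by positivity)))).1.2
    simp only [id] at h5
    have hBn := h.norm_pos n
    gcongr
    exact hzle (k + 1)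
  have hsum : ∀ k, |y k - y 0| ≤ (B n / n) * ε * (1 - ρ ^ k) := by
    intro k
    induction k with
    | zero => simp
    | succ k ih =>
      have h1 := hstep k
      have hBn : 0 < B n / n := div_pos (h.norm_pos n) hn0
      have hρk : 0 < ρ ^ k := pow_pos hρ k
      calc |y (k + 1) - y 0| = |(y (k + 1) - y k) + (y k - y 0)| := by ring_nf
        _ ≤ ρ ^ (k + 1) * (B n / n) * (ε * (1 - ρ)) + (B n / n) * ε * (1 - ρ ^ k) :=
          (abs_add_le _ _).trans (add_le_add h1 ih)
        _ ≤ _ := by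
          have : 0 ≤ (B n / n) * ε * ρ ^ k * (1 - ρ) ^ 2 := by positivity
          rw [pow_succ]; nlinarith
  have hylim : Tendsto y atTop (𝓝 0) := by
    refine tendsto_zero_of_tendsto_exp_mul_I fun s => ?_
    have t1 := h.attracted.comp hmt (hz0.const_mul s)
    rw [mul_zero, stableExponent_zero h.index_pos, Complex.exp_zero] at t1
    have t2 := (tendsto_charFun_div_pow hint s).comp hmt
    rw [hmean, Complex.ofReal_zero, mul_zero, zero_mul, Complex.exp_zero] at t2
    have t3 := t2.div t1 one_ne_zero
    rw [div_one] at t3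
    refine t3.congr' ?_
    filter_upwards [t1.eventually_ne one_ne_zero] with k hk
    rw [Pi.div_apply, div_eq_iff hk]
    have e : s * z k / B (m k) = s / m k := by
      have h3 := (h.norm_pos (m k)).ne'
      have h4 := (hmpos k).ne'
      simp only [z]; field_simp
    simp only [Function.comp_apply]
    rw [e, mul_left_comm, ← Complex.exp_add]
    have : (s : ℂ) * y k * Complex.I + -(((s * z k : ℝ) : ℂ) * b (m k) * Complex.I) = 0 := by
      simp only [y]; push_cast; ring
    rw [this, Complex.exp_zero, mul_one]
  have hBn : 0 < B n / n := div_pos (h.norm_pos n) hn0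
  have hfin : |0 - y 0| ≤ (B n / n) * ε := by
    refine le_of_tendsto ((hylim.sub_const (y 0)).abs) (Eventually.of_forall fun k => ?_)
    refine (hsum k).trans ?_
    have : 0 ≤ (B n / n) * ε * ρ ^ k := by positivity
    linarith
  have ey : y 0 = b n * (B n / n) := by simp [y, z, m]
  rw [zero_sub, abs_neg, ey, abs_mul, abs_of_pos hBn, mul_comm] at hfin
  have := le_of_mul_le_mul_left hfin hBn
  rw [Real.dist_eq, sub_zero]
  linarith

end StablyAttracted

/-! ### Integrability and mean zero for index above 1; convergence results. -/

lemma measureReal_abs_gt_le_minSqMoment (μ : Measure ℝ) [IsProbabilityMeasure μ] {A : ℝ}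
    (hA : 0 < A) : μ.real {x | A < |x|} ≤ minSqMoment μ A := by
  have hm : MeasurableSet {x : ℝ | A < |x|} := measurableSet_lt measurable_const (by fun_prop)
  rw [← integral_indicator_one hm]
  refine integral_mono ((integrable_const (1 : ℝ)).indicator hm) (integrable_min_sq μ A) fun x => ?_
  by_cases hx : x ∈ {x : ℝ | A < |x|}
  · simp only [Set.indicator_of_mem hx, Pi.one_apply]
    refine le_min le_rfl ?_
    rw [one_le_sq_iff_one_le_abs, abs_div, abs_of_pos hA, one_le_div hA]
    exact le_of_lt hx
  · simp only [Set.indicator_of_notMem hx]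
    exact le_min zero_le_one (sq_nonneg _)

lemma abs_le_add_sum_indicator {A : ℕ → ℝ} (hA : ∀ k, 0 < A k) (K : ℕ) {x : ℝ} (hx : |x| ≤ A K) :
    |x| ≤ A 0 + ∑ k ∈ Finset.range K, A (k + 1) * Set.indicator {x | A k < |x|} 1 x := by
  induction K with
  | zero => simpa using hx
  | succ K ih =>
    rw [Finset.sum_range_succ]
    have hnn : ∀ k, 0 ≤ A (k + 1) * Set.indicator {x | A k < |x|} (1 : ℝ → ℝ) x := fun k =>
      mul_nonneg (hA _).le (Set.indicator_nonneg (fun _ _ => zero_le_one) _)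
    rcases le_or_gt |x| (A K) with h | h
    · have := ih h
      linarith [hnn K]
    · have h1 : Set.indicator {x | A K < |x|} (1 : ℝ → ℝ) x = 1 := Set.indicator_of_mem h 1
      have h2 : 0 ≤ ∑ k ∈ Finset.range K, A (k + 1) * Set.indicator {x | A k < |x|} (1 : ℝ → ℝ) x :=
        Finset.sum_nonneg fun k _ => hnn k
      rw [h1]
      linarith [(hA 0).le]

/-- Summation over the shells A_k < |x| ≤ A_{k+1}: the scales grow like (2ρ)^k and the tails decay
like 2^{-k}, leaving a geometric series of ratio ρ < 1. -/
lemma integrable_id_of_tail_le {μ : Measure ℝ} [IsProbabilityMeasure μ] {A : ℕ → ℝ} {C ρ : ℝ}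
    (hA : ∀ k, 0 < A k) (hAt : Tendsto A atTop atTop) (hρ : 0 < ρ) (hρ1 : ρ < 1)
    (hgrow : ∀ k, A k ≤ (2 * ρ) ^ k * A 0) (htail : ∀ k, μ.real {x | A k < |x|} ≤ C / 2 ^ k) :
    Integrable (fun x : ℝ => x) μ := by
  have hm : ∀ k, MeasurableSet {x : ℝ | A k < |x|} := fun k =>
    measurableSet_lt measurable_const (by fun_prop)
  have hC : 0 ≤ C := by simpa using measureReal_nonneg.trans (htail 0)
  have hb : ∀ K, ∑ k ∈ Finset.range K, A (k + 1) * μ.real {x | A k < |x|}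
      ≤ 2 * ρ * A 0 * C * (1 - ρ)⁻¹ := by
    intro K
    have h1 : ∀ k ∈ Finset.range K, A (k + 1) * μ.real {x | A k < |x|}
        ≤ 2 * ρ * A 0 * C * ρ ^ k := by
      intro k _
      calc A (k + 1) * μ.real {x | A k < |x|} ≤ ((2 * ρ) ^ (k + 1) * A 0) * (C / 2 ^ k) := by
            have := (hA 0).le
            gcongr
            · exact hgrow _
            · exact htail k
        _ = _ := by rw [pow_succ, mul_pow]; field_simp
    refine (Finset.sum_le_sum h1).trans ?_
    rw [← Finset.mul_sum]
    have := (hA 0).le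
    gcongr
    rw [← one_div, le_div_iff₀ (by linarith), mul_comm, mul_neg_geom_sum]
    linarith [pow_nonneg hρ.le K]
  have hcover : AECover μ atTop fun R : ℕ => Set.Icc (-(R : ℝ)) R :=
    aecover_Icc (tendsto_neg_atTop_atBot.comp tendsto_natCast_atTop_atTop)
      tendsto_natCast_atTop_atTop
  have key : Integrable (fun x : ℝ => |x|) μ := by
    refine hcover.integrable_of_integral_bounded_of_nonneg_ae (A 0 + 2 * ρ * A 0 * C * (1 - ρ)⁻¹)
      (fun R => ?_) (Eventually.of_forall fun x => abs_nonneg x) (Eventually.of_forall fun R => ?_)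
    · exact continuous_abs.continuousOn.integrableOn_compact isCompact_Icc
    · obtain ⟨K, hK⟩ := (hAt.eventually_ge_atTop (R : ℝ)).exists
      have i1 : ∀ k ∈ Finset.range K, Integrable
          (fun x => A (k + 1) * Set.indicator {x | A k < |x|} (1 : ℝ → ℝ) x) μ := fun k _ =>
        ((integrable_const (1 : ℝ)).indicator (hm k)).const_mul _
      have h1 : ∫ x in Set.Icc (-(R : ℝ)) R, |x| ∂μ ≤ ∫ x, (A 0 + ∑ k ∈ Finset.range K,
          A (k + 1) * Set.indicator {x | A k < |x|} (1 : ℝ → ℝ) x) ∂μ := by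
        rw [← integral_indicator measurableSet_Icc]
        refine integral_mono_of_nonneg (Eventually.of_forall fun x =>
          Set.indicator_nonneg (fun y _ => abs_nonneg y) x)
          ((integrable_const _).add (integrable_finsetSum _ i1)) (Eventually.of_forall fun x => ?_)
        by_cases hx : x ∈ Set.Icc (-(R : ℝ)) R
        · simp only [Set.indicator_of_mem hx]
          exact abs_le_add_sum_indicator hA K ((abs_le.2 hx).trans hK)
        · simp only [Set.indicator_of_notMem hx]
          exact add_nonneg (hA 0).le (Finset.sum_nonneg fun k _ =>
            mul_nonneg (hA _).le (Set.indicator_nonneg (fun _ _ => zero_le_one) _))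
      rw [integral_add (integrable_const _) (integrable_finsetSum _ i1),
        integral_finsetSum _ i1] at h1
      simp_rw [integral_const_mul, integral_indicator_one (hm _)] at h1
      simp only [integral_const, probReal_univ, one_smul] at h1
      linarith [hb K]
  exact (integrable_norm_iff (by fun_prop)).1 key

namespace StablyAttracted

variable {μ : Measure ℝ} [IsProbabilityMeasure μ] {α c p q : ℝ} {B b : ℕ → ℝ}

lemma integrable_id (h : StablyAttracted μ α c p q B b) (hα : 1 < α) :
    Integrable (fun x : ℝ => x) μ := by
  obtain ⟨ρ, hρ, hρ1, hBρ⟩ := h.exists_norm_double_le hα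
  obtain ⟨C, hC0, hC⟩ := h.attracted.exists_minSqMoment_bound h.exp_stableExponent_zero
    (Eventually.of_forall h.norm_pos) h.nondegenerate
  obtain ⟨N, hN⟩ := eventually_atTop.1 ((hBρ.and hC).and (eventually_ge_atTop 1))
  obtain ⟨n, hnN, hn1⟩ : ∃ n, N ≤ n ∧ 1 ≤ n := ⟨max N 1, le_max_left _ _, le_max_right _ _⟩
  have hmt : Tendsto (fun k : ℕ => 2 ^ k * n) atTop atTop :=
    tendsto_atTop_mono (fun k => Nat.le_mul_of_pos_right _ hn1)
      (tendsto_pow_atTop_atTop_of_one_lt one_lt_two)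
  refine integrable_id_of_tail_le (A := fun k => B (2 ^ k * n)) (C := C) (fun k => h.norm_pos _)
    (h.tendsto_atTop.comp hmt) hρ hρ1 (fun k => ?_) fun k => ?_
  · simpa using norm_two_pow_mul_le hρ (fun n hn => (hN n hn).1.1) hnN k
  · refine (measureReal_abs_gt_le_minSqMoment μ (h.norm_pos _)).trans ?_
    have h1 := (hN (2 ^ k * n)
      (hnN.trans (Nat.le_mul_of_pos_left n (by positivity)))).1.2
    have h2 := minSqMoment_nonneg μ (B (2 ^ k * n))
    have h3 : (1 : ℝ) ≤ n := by exact_mod_cast hn1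
    rw [le_div_iff₀ (by positivity), mul_comm]
    refine le_trans ?_ h1
    push_cast
    gcongr
    exact le_mul_of_one_le_right (by positivity) h3

/-- Since B_m / m → 0 along m = 2^k n and the centring converges, S_m / m tends to 0 in law. By the
weak law it also tends to the mean. -/
lemma integral_id_eq_zero (h : StablyAttracted μ α c p q B b) (hα : 1 < α) {b₀ : ℝ}
    (hb : Tendsto b atTop (𝓝 b₀)) : ∫ x, x ∂μ = 0 := by
  have hint := h.integrable_id hα
  obtain ⟨ρ, hρ, hρ1, hBρ⟩ := h.exists_norm_double_le hα
  obtain ⟨N, hN⟩ := eventually_atTop.1 hBρ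
  obtain ⟨n, hnN, hn1⟩ : ∃ n, N ≤ n ∧ 1 ≤ n := ⟨max N 1, le_max_left _ _, le_max_right _ _⟩
  have hmt : Tendsto (fun k : ℕ => 2 ^ k * n) atTop atTop :=
    tendsto_atTop_mono (fun k => Nat.le_mul_of_pos_right _ hn1)
      (tendsto_pow_atTop_atTop_of_one_lt one_lt_two)
  have hz := tendsto_norm_two_pow_div h.norm_pos hρ hρ1 hN hnN
  have hzero : Tendsto (fun _ : ℕ => ∫ x, x ∂μ) atTop (𝓝 0) := by
    refine tendsto_zero_of_tendsto_exp_mul_I fun s => ?_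
    have t1 := h.attracted.comp hmt (hz.const_mul s)
    have t2 := (hz.const_mul s).mul (hb.comp hmt)
    rw [mul_zero, stableExponent_zero h.index_pos, Complex.exp_zero] at t1
    rw [mul_zero, zero_mul] at t2
    have t3 : Tendsto (fun k : ℕ => Complex.exp (((s * (B (2 ^ k * n) / (2 ^ k * n : ℕ))
        * b (2 ^ k * n) : ℝ) : ℂ) * Complex.I)) atTop (𝓝 1) := by
      have hc : Continuous fun y : ℝ => Complex.exp ((y : ℂ) * Complex.I) := by fun_prop
      have := (hc.tendsto 0).comp t2
      simpa [Function.comp_def] using this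
    have t4 := (tendsto_charFun_div_pow hint s).comp hmt
    have t5 := t1.mul t3
    rw [mul_one] at t5
    have t6 : Tendsto (fun k : ℕ => charFun μ (s / (2 ^ k * n : ℕ)) ^ (2 ^ k * n)) atTop (𝓝 1) := by
      refine t5.congr fun k => ?_
      have hB := (h.norm_pos (2 ^ k * n)).ne'
      have e : s * (B (2 ^ k * n) / (2 ^ k * n : ℕ)) / B (2 ^ k * n) = s / (2 ^ k * n : ℕ) := by
        field_simp
      rw [e, mul_assoc, ← Complex.exp_add]
      have : ∀ z w : ℂ, z = -w → Complex.exp (w + z) = 1 := fun z w hzw => by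
        rw [hzw, add_neg_cancel, Complex.exp_zero]
      rw [this _ _ (by push_cast; ring), mul_one]
    rw [tendsto_nhds_unique t6 t4]
    exact tendsto_const_nhds
  exact tendsto_nhds_unique tendsto_const_nhds hzero

/-- For index one, convergence without centring forces the sequence `n E sin (X / a_n)` to
converge. -/
lemma exists_tendsto_sinCentering (h : StablyAttracted μ 1 c p q B b) {b₀ : ℝ}
    (hb : Tendsto b atTop (𝓝 b₀)) : ∃ l : ℝ, Tendsto (sinCentering μ id) atTop (𝓝 l) := by
  obtain ⟨B', b', h', -, ⟨ρ, hρ, hratio⟩, hlim⟩ := h.tendsto_sinCentering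
  obtain ⟨s, hs⟩ := exists_stableExponent_mul 1 c p q hρ
  have hattr := h.attracted.change_scale (fun n => (h.norm_pos n).ne') hratio
  have hd : Tendsto (fun n => b n * (B n / B' n)) atTop (𝓝 (b₀ * ρ)) := hb.mul hratio
  have hexp : ∀ t : ℝ, Tendsto (fun n => Complex.exp (t * sinCentering μ id n * Complex.I)) atTop
      (𝓝 (Complex.exp (t * (b₀ * ρ + s : ℝ) * Complex.I
        + (ρ * c - 1 : ℝ) * stableExponent 1 1 p q t))) := by
    intro t
    have t1 := hattr.pointwise t
    have t2 : Tendsto (fun n => Complex.exp (t * (b n * (B n / B' n) : ℝ) * Complex.I)) atTop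
        (𝓝 (Complex.exp (t * (b₀ * ρ : ℝ) * Complex.I))) := by
      have hc : Continuous fun y : ℝ => Complex.exp (t * (y : ℂ) * Complex.I) := by fun_prop
      exact (hc.tendsto _).comp hd
    have t3 := (t1.mul t2).div (hlim t) (Complex.exp_ne_zero _)
    have e : Complex.exp (stableExponent 1 c p q (ρ * t)) * Complex.exp (t * (b₀ * ρ : ℝ) * Complex.I)
        / Complex.exp (stableExponent 1 1 p q t) = Complex.exp (t * (b₀ * ρ + s : ℝ) * Complex.I
        + (ρ * c - 1 : ℝ) * stableExponent 1 1 p q t) := by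
      rw [← Complex.exp_add, ← Complex.exp_sub, hs, Real.rpow_one,
        show ρ * c = (ρ * c) * 1 by ring, stableExponent_mul_scale]
      congr 1; push_cast; ring
    rw [e] at t3
    refine t3.congr' ?_
    filter_upwards [(hlim t).eventually_ne (Complex.exp_ne_zero _)] with n hn
    rw [Pi.div_apply, div_eq_iff hn, mul_left_comm, ← Complex.exp_add, mul_assoc, ← Complex.exp_add]
    congr 2; ring
  -- The left side has modulus 1, which forces the real part of the limiting exponent to vanish and
  -- so makes the scale parameters agree.
  have hρc : ρ * c = 1 := by
    have h1 := (hexp 1).norm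
    have e : ∀ n, ‖Complex.exp (((1 : ℝ) : ℂ) * sinCentering μ id n * Complex.I)‖ = 1 := fun n => by
      rw [← Complex.ofReal_mul, Complex.norm_exp_ofReal_mul_I]
    simp_rw [e] at h1
    have h2 := tendsto_nhds_unique h1 tendsto_const_nhds
    obtain ⟨k, hk, hre⟩ := exists_re_stableExponent one_pos one_le_two
    rw [Complex.norm_exp, Real.exp_eq_one_iff, Complex.add_re, Complex.re_ofReal_mul, hre,
      ← Complex.ofReal_mul, Complex.re_ofReal_mul] at h2
    simp only [Complex.I_re, mul_zero, zero_add, abs_one, Real.rpow_one, mul_one, mul_eq_zero,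
      neg_eq_zero, hk.ne', or_false] at h2
    linarith
  refine ⟨b₀ * ρ + s, ?_⟩
  rw [← tendsto_sub_nhds_zero_iff]
  refine tendsto_zero_of_tendsto_exp_mul_I fun t => ?_
  have h1 := (hexp t).mul_const (Complex.exp (-(t * (b₀ * ρ + s : ℝ) * Complex.I)))
  rw [hρc, ← Complex.exp_add] at h1
  simp only [sub_self, Complex.ofReal_zero, zero_mul, add_zero, add_neg_cancel, Complex.exp_zero]
    at h1
  refine h1.congr fun n => ?_
  rw [← Complex.exp_add]
  congr 1; push_cast; ring

/-- For index different from one, the sums normed by `a_n` converge without centring. -/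
lemma tendsto_charFun_pow (h : StablyAttracted μ α c p q B b) (hα : α ≠ 1)
    (hmean : 1 < α → ∫ x, x ∂μ = 0) :
    ∀ t : ℝ, Tendsto (fun n : ℕ => charFun μ (t / normConst μ id n) ^ n) atTop
      (𝓝 (Complex.exp (stableExponent α 1 p q t))) := by
  intro t
  -- For α < 2 the variance is infinite and the condition is vacuous; for α = 2 it is the assumption
  -- of mean zero.
  have hint : Integrable (fun x : ℝ => x ^ 2) μ → ∫ x, x ∂μ = 0 := fun hi => by
    rcases h.index_le.lt_or_eq with h2 | rfl
    · exact absurd hi (h.not_integrable_sq h2)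
    · exact hmean one_lt_two
  obtain ⟨B', b', d, h', hB', -, -⟩ := h.exists_normConst hint
  have hb' : Tendsto b' atTop (𝓝 0) := by
    rcases lt_or_gt_of_ne hα with h1 | h1
    · exact h'.tendsto_drift_of_lt_one h1
    · exact h'.tendsto_drift_of_one_lt h1 (h.integrable_id h1) (hmean h1)
  have t1 := h'.attracted.pointwise t
  have t2 : Tendsto (fun n => Complex.exp (t * b' n * Complex.I)) atTop (𝓝 1) := by
    have hc : Continuous fun y : ℝ => Complex.exp (t * (y : ℂ) * Complex.I) := by fun_prop
    simpa [Function.comp_def] using (hc.tendsto 0).comp hb'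
  have t3 := t1.mul t2
  rw [mul_one] at t3
  refine t3.congr' ?_
  filter_upwards [hB'] with n hn
  rw [hn, mul_assoc, ← Complex.exp_add, neg_add_cancel, Complex.exp_zero, mul_one]

lemma tendsto_charFun_pow_of_sinCentering (h : StablyAttracted μ 1 c p q B b) {l : ℝ}
    (hl : Tendsto (sinCentering μ id) atTop (𝓝 l)) (t : ℝ) :
    Tendsto (fun n : ℕ => charFun μ (t / normConst μ id n) ^ n) atTop
      (𝓝 (Complex.exp (l * t * Complex.I + stableExponent 1 1 p q t))) := by
  obtain ⟨B', b', h', hB', -, hlim⟩ := h.tendsto_sinCentering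
  have t2 : Tendsto (fun n => Complex.exp (t * sinCentering μ id n * Complex.I)) atTop
      (𝓝 (Complex.exp (t * l * Complex.I))) := by
    have hc : Continuous fun y : ℝ => Complex.exp (t * (y : ℂ) * Complex.I) := by fun_prop
    exact (hc.tendsto l).comp hl
  have t3 := (hlim t).mul t2
  rw [← Complex.exp_add, add_comm, mul_comm (t : ℂ) (l : ℂ)] at t3
  refine t3.congr' ?_
  filter_upwards [hB'] with n hn
  rw [hn, mul_assoc, ← Complex.exp_add, neg_add_cancel, Complex.exp_zero, mul_one]

end StablyAttracted

/-! ### Transfer to random variables and the theorem. -/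

/-- An affine image of `G` has any prescribed drift and scale parameter 1, so the limit law needs no
separate construction. -/
lemma exists_isStableLaw {α γ c p q : ℝ} {G : ProbabilityMeasure ℝ} (hG : IsStableLaw α γ c p q G)
    (hc : 0 < c) (γ' : ℝ) : ∃ G' : ProbabilityMeasure ℝ, IsStableLaw α γ' 1 p q G' := by
  set κ : ℝ := (1 / c) ^ (1 / α) with hκ
  have hκ0 : 0 < κ := by positivity
  have hκα : κ ^ α * c = 1 := by
    rw [hκ, ← Real.rpow_mul (by positivity), one_div_mul_cancel hG.index_pos.ne', Real.rpow_one,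
      one_div_mul_cancel hc.ne']
  obtain ⟨s, hs⟩ := exists_stableExponent_mul α c p q hκ0
  set τ : ℝ := γ' - γ * κ - s with hτ
  have hf : AEMeasurable (fun x : ℝ => κ * x + τ) (G : Measure ℝ) := by fun_prop
  refine ⟨G.map hf, hG.index_pos, hG.index_le, zero_le_one, hG.p_nonneg, hG.q_nonneg, hG.p_add_q,
    fun t => ?_⟩
  have e : charFun ((G.map hf : ProbabilityMeasure ℝ) : Measure ℝ) t
      = charFun (G : Measure ℝ) (κ * t) * Complex.exp (t * τ * Complex.I) := by
    rw [ProbabilityMeasure.toMeasure_map, charFun_apply_real, charFun_apply_real,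
      integral_map hf (Continuous.aestronglyMeasurable (by fun_prop)), ← integral_mul_const]
    congr 1; ext x
    rw [← Complex.exp_add]
    congr 1; push_cast; ring
  rw [e, hG.charFun_eq, stableCharFun_eq, stableCharFun_eq, hs, hκα, ← Complex.exp_add]
  congr 1
  simp only [τ]
  push_cast; ring

section

variable {Ω : Type*} [MeasurableSpace Ω] {P : Measure Ω} {X : Ω → ℝ}

lemma truncSecondMoment_map (hX : AEMeasurable X P) (x : ℝ) :
    truncSecondMoment P X x = truncSecondMoment (P.map X) id x := by
  unfold truncSecondMoment
  rw [setIntegral_map (measurableSet_lt (by fun_prop) measurable_const)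
    (Continuous.aestronglyMeasurable (by fun_prop)) hX]
  rfl

lemma normConst_map (hX : AEMeasurable X P) (n : ℕ) :
    normConst P X n = normConst (P.map X) id n := by
  unfold normConst
  simp_rw [truncSecondMoment_map hX]

lemma sinCentering_map (hX : AEMeasurable X P) : sinCentering P X = sinCentering (P.map X) id := by
  ext n
  unfold sinCentering
  rw [normConst_map hX, integral_map hX (Continuous.aestronglyMeasurable (by fun_prop))]
  rfl

variable {Xs : ℕ → Ω → ℝ}

lemma aemeasurable_partialSum (hXs : ∀ i, AEMeasurable (Xs i) P) (n : ℕ) :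
    AEMeasurable (partialSum Xs n) P :=
  Finset.aemeasurable_fun_sum _ fun i _ => hXs i

lemma charFun_map_partialSum (hindep : iIndepFun Xs P) (hident : ∀ i, IdentDistrib (Xs i) X P P)
    (n : ℕ) (A B t : ℝ) :
    charFun (P.map fun ω => (partialSum Xs n ω - A) / B) t
      = charFun (P.map X) (t / B) ^ n * Complex.exp (-(t * (A / B : ℝ) * Complex.I)) := by
  have mX := fun i => (hident i).aemeasurable_fst
  have hS := aemeasurable_partialSum mX n
  have e : charFun (P.map (partialSum Xs n)) (t / B) = charFun (P.map X) (t / B) ^ n := by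
    have : partialSum Xs n = fun ω => ∑ i ∈ Finset.range n, Xs i ω := rfl
    rw [this, (hindep.restrict _).charFun_map_fun_finsetSum_eq_prod (fun _ _ => mX _)]
    simp [fun i => (hident i).map_eq]
  rw [← e, charFun_apply_real, charFun_apply_real,
    integral_map (by fun_prop) (Continuous.aestronglyMeasurable (by fun_prop)),
    integral_map hS (Continuous.aestronglyMeasurable (by fun_prop)), ← integral_mul_const]
  congr 1; ext ω
  rw [← Complex.exp_add]
  congr 1; push_cast; ring

lemma map_ne_dirac (hX : AEMeasurable X P) (hnd : ¬ ∃ x : ℝ, X =ᵐ[P] fun _ => x) (x : ℝ) :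
    P.map X ≠ Measure.dirac x := by
  intro h
  refine hnd ⟨x, ?_⟩
  refine ae_of_ae_map (p := fun y => y = x) hX ?_
  rw [h, ae_dirac_eq]
  rfl

variable [IsProbabilityMeasure P]

lemma stablyAttracted_of_tendstoInDistribution (hindep : iIndepFun Xs P)
    (hident : ∀ i, IdentDistrib (Xs i) X P P) (hnd : ¬ ∃ x : ℝ, X =ᵐ[P] fun _ => x)
    {α γ c p q : ℝ} {G : ProbabilityMeasure ℝ} (hG : IsStableLaw α γ c p q G) (hc : 0 < c)
    {A B : ℕ → ℝ} (hB : ∀ n, 0 < B n)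
    (h : TendstoInDistribution (fun n ω => (partialSum Xs n ω - A n) / B n) atTop
      (id : ℝ → ℝ) (fun _ => P) (G : Measure ℝ)) :
    StablyAttracted (P.map X) α c p q B fun n => A n / B n + γ := by
  have hX := (hident 0).aemeasurable_snd
  have hattr : AttractedTo (P.map X) B (fun n => A n / B n) (stableCharFun α γ c p q) := by
    intro t₀
    -- Convergence in distribution gives the continuous convergence on which all changes of norming
    -- rest.
    have h1 := tendsto_charFun_prod h.tendsto t₀
    simp only [ProbabilityMeasure.coe_mk, Measure.map_id, hG.charFun_eq] at h1
    refine h1.congr fun z => ?_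
    exact charFun_map_partialSum hindep hident _ _ _ _
  refine ⟨hG.index_pos, hG.index_le, hc, hG.p_nonneg, hG.q_nonneg, hG.p_add_q, hB, ?_,
    map_ne_dirac hX hnd⟩
  convert hattr.add_drift (tendsto_const_nhds (x := γ)) using 2 with t
  rw [stableCharFun_eq, ← Complex.exp_add]
  congr 1; ring

lemma tendstoInDistribution_of_tendsto_charFun (hindep : iIndepFun Xs P)
    (hident : ∀ i, IdentDistrib (Xs i) X P P) {B : ℕ → ℝ} {G : ProbabilityMeasure ℝ}
    (h : ∀ t : ℝ, Tendsto (fun n : ℕ => charFun (P.map X) (t / B n) ^ n) atTop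
      (𝓝 (charFun (G : Measure ℝ) t))) :
    TendstoInDistribution (fun n ω => partialSum Xs n ω / B n) atTop
      (id : ℝ → ℝ) (fun _ => P) (G : Measure ℝ) where
  forall_aemeasurable n :=
    (aemeasurable_partialSum (fun i => (hident i).aemeasurable_fst) n).div_const _
  tendsto := by
    refine ProbabilityMeasure.tendsto_iff_tendsto_charFun.2 fun t => ?_
    simp only [ProbabilityMeasure.coe_mk, Measure.map_id]
    refine (h t).congr fun n => ?_
    have := charFun_map_partialSum hindep hident n 0 (B n) t
    simpa using this.symm

end

theorem lemma1 {Ω : Type*} [MeasurableSpace Ω] (P : Measure Ω) [IsProbabilityMeasure P]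
    (X : Ω → ℝ) (Xs : ℕ → Ω → ℝ)
    (hindep : iIndepFun Xs P) (hident : ∀ i, IdentDistrib (Xs i) X P P)
    (hnondeg : ¬ ∃ x : ℝ, X =ᵐ[P] fun _ => x)
    (α γ c p q : ℝ) (G : ProbabilityMeasure ℝ) (hG : IsStableLaw α γ c p q G) (hc : 0 < c) :
    ((∃ A : ℕ → ℝ, (∀ n, 0 < A n) ∧
        TendstoInDistribution (fun n ω => partialSum Xs n ω / A n) atTop
          (id : ℝ → ℝ) (fun _ => P) (G : Measure ℝ)) →
      InDomainOfAttraction P Xs G ∧ CenteringCondition P X α) ∧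
    (InDomainOfAttraction P Xs G → CenteringCondition P X α →
      ∃ γ' : ℝ, (α ≠ 1 → γ' = 0) ∧
        (α = 1 → Tendsto (sinCentering P X) atTop (𝓝 γ')) ∧
        ∃ G' : ProbabilityMeasure ℝ, IsStableLaw α γ' 1 p q G' ∧
          TendstoInDistribution (fun n ω => partialSum Xs n ω / normConst P X n) atTop
            (id : ℝ → ℝ) (fun _ => P) (G' : Measure ℝ)) := by
  have hX := (hident 0).aemeasurable_snd
  have hprob : IsProbabilityMeasure (P.map X) := Measure.isProbabilityMeasure_map hX
  have hmean : ∫ x, x ∂(P.map X) = ∫ ω, X ω ∂P := integral_map hX (by fun_prop)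
  constructor
  · rintro ⟨A, hA, hT⟩
    have hT' : TendstoInDistribution (fun n ω => (partialSum Xs n ω - 0) / A n) atTop
        (id : ℝ → ℝ) (fun _ => P) (G : Measure ℝ) := by simpa using hT
    have h := stablyAttracted_of_tendstoInDistribution hindep hident hnondeg hG hc
      (A := fun _ => 0) hA hT'
    simp only [zero_div, zero_add] at h
    refine ⟨⟨fun _ => 0, A, hA, hT'⟩, fun hα => ⟨?_, ?_⟩, fun hα => ?_⟩
    · exact (integrable_map_measure (by fun_prop) hX).1 (h.integrable_id hα.1)
    · rw [← hmean]
      exact h.integral_id_eq_zero hα.1 tendsto_const_nhds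
    · subst hα
      rw [sinCentering_map hX]
      exact h.exists_tendsto_sinCentering tendsto_const_nhds
  · rintro ⟨A, B, hB, hT⟩ hcent
    have h := stablyAttracted_of_tendstoInDistribution hindep hident hnondeg hG hc hB hT
    simp_rw [normConst_map hX]
    by_cases hα : α = 1
    · subst hα
      obtain ⟨l, hl⟩ := hcent.2 rfl
      obtain ⟨G', hG'⟩ := exists_isStableLaw hG hc l
      refine ⟨l, fun hne => absurd rfl hne, fun _ => hl, G', hG', ?_⟩
      rw [sinCentering_map hX] at hl
      refine tendstoInDistribution_of_tendsto_charFun hindep hident fun t => ?_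
      rw [hG'.charFun_eq, stableCharFun_eq]
      exact h.tendsto_charFun_pow_of_sinCentering hl t
    · obtain ⟨G', hG'⟩ := exists_isStableLaw hG hc 0
      refine ⟨0, fun _ => rfl, fun h1 => absurd h1 hα, G', hG', ?_⟩
      refine tendstoInDistribution_of_tendsto_charFun hindep hident fun t => ?_
      rw [hG'.charFun_eq, stableCharFun_eq, Complex.ofReal_zero, zero_mul, zero_mul, zero_add]
      exact h.tendsto_charFun_pow hα (fun h1 => hmean.trans (hcent.1 ⟨h1, h.index_le⟩).2) t
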